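/- Let $F$ be the function field of a geometrically connected smooth projective curve $\mathcal C$ over the finite field $\mathbb F_q$, let $\infty$ be a closed point of $\mathcal C$ of degree $\deg(\infty)$ over $\mathbb F_q$, let $A\subset F$ be the ring of functions regular away from $\infty$, and let $F_\infty$ be the completion of $F$ at $\infty$. An $A$-lattice is a projective $A$-submodule $Y\subset F^2$ of rank two; $\Gamma(Y)\le GL_2(F)$ is the group of $F$-linear automorphisms of $F^2$ leaving $Y$ invariant, and for an ideal $\mathfrak a$ of $A$, $\Gamma(Y,\mathfrak a)\le\Gamma(Y)$ is the subgroup of elements inducing the identity on $Y/\mathfrak aY$. Let $\Gamma\le GL_2(F)$ be an arithmetic subgroup, i.e. $\Gamma(Y,\mathfrak a)\le\Gamma\le\Gamma(Y)$ for some $A$-lattice $Y$ and some non-zero ideal $\mathfrak a$. It acts, as a subgroup of $GL_2(F_\infty)$, on the Bruhat–Tits tree $\mathcal T$ of $PGL_2(F_\infty)$. For an oriented edge $e$ write $o(e)$, $t(e)$, $\overline e$ for its origin, its terminal vertex and the edge with reversed orientation. Let $H_1(\Gamma\backslash\mathcal T,\mathbb Z)$ be the group of functions $\mathcal E(\Gamma\backslash\mathcal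 T)\to\mathbb Z$ on oriented edges generated by the functions $\sum_{i=1}^n i_{e_i}$, for closed paths $e_1,\dots,e_n$ in $\Gamma\backslash\mathcal T$, where $i_e$ is $1$ at $e$, $-1$ at $\overline e$ and $0$ elsewhere. Let $H_!(\mathcal T,\mathbb Z)^\Gamma$ be the group of $\Gamma$-invariant functions $\phi:\mathcal E(\mathcal T)\to\mathbb Z$ which are harmonic, that is, $\phi(e)+\phi(\overline e)=0$ for every edge $e$ and $\sum_{o(e)=v}\phi(e)=0$ for every vertex $v$, and which are supported on finitely many edges of $\Gamma\backslash\mathcal T$. Let $z(\Gamma)$ be the order of the centre of $\Gamma$, and for an edge $e$ of $\mathcal T$ let $\Gamma_e$ be its stabiliser in $\Gamma$ and $\widetilde e$ its image in $\Gamma\backslash\mathcal T$. Then $z(\Gamma)$ and all $|\Gamma_e|$ are finite, the rule $$j_\Gamma(\phi)(e)=\frac{|\Gamma_e|\,\phi(\widetilde e)}{z(\Gamma)}$$ defines a homomorphism $j_\Gamma:H_1(\Gamma\backslash\mathcal T,\mathbb Z)\to H_!(\mathcal T,\mathbb Z)^\Gamma$, this homomorphism is injective, and its cokernel is finite, of exponent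 dividing $q^{\deg(\infty)}-1$. -/

import Mathlib

open scoped MatrixGroups

noncomputable section

/-! ## Oriented graphs, homology and harmonic cochains -/

/-- An oriented graph (in the sense of Serre) equipped with an orientation-reversing involution
`bar` on its edges; `o` and `t` are the original and terminal vertex of an edge. -/
structure OrientedGraph.{u, v} where
  V : Type u
  E : Type v
  o : E → V
  t : E → V
  bar : E → E
  o_bar : ∀ e, o (bar e) = t e
  t_bar : ∀ e, t (bar e) = o e
  bar_bar : ∀ e, bar (bar e) = e

namespace OrientedGraph

/-- The list `e₁, …, eₙ` of edges is a path from `u` to `v`: `o e₁ = u`, `t eᵢ = o eᵢ₊₁`,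
`t eₙ = v` (the empty list is a path from `u` to `u`). -/
def IsPath (G : OrientedGraph) : G.V → List G.E → G.V → Prop
  | u, [], v => u = v
  | u, e :: l, v => G.o e = u ∧ IsPath G (G.t e) l v

open Classical in
/-- The function `i_e` on edges: `1` at `e`, `-1` at `bar e`, and `0` elsewhere. -/
def edgeFun (G : OrientedGraph) (e : G.E) : G.E → ℤ :=
  Pi.single e 1 - Pi.single (G.bar e) 1

/-- `H₁(G, ℤ)`: the group of integral functions on the edges that is generated by the functions
`i_{e₁} + ⋯ + i_{eₙ}` of the closed paths `e₁, …, eₙ`. -/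
def H1 (G : OrientedGraph) : AddSubgroup (G.E → ℤ) :=
  AddSubgroup.closure {f | ∃ (u : G.V) (l : List G.E), G.IsPath u l u ∧ f = (l.map G.edgeFun).sum}

/-- Harmonic cochains on an oriented graph, with values in an abelian group: alternating functions
on the edges such that, at each vertex `v`, the values on the edges with origin `v` sum to zero.
The finiteness requirement makes the sum meaningful; it is automatic on locally finite graphs. -/
def IsHarmonic (G : OrientedGraph) {R : Type*} [AddCommGroup R] (φ : G.E → R) : Prop :=
  (∀ e, φ e + φ (G.bar e) = 0) ∧
  ∀ v, {e : G.E | G.o e = v ∧ φ e ≠ 0}.Finite ∧ ∑ᶠ (e : G.E) (_ : G.o e = v), φ e = 0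

/-- The group `H(G, R)` of `R`-valued harmonic cochains on `G`. -/
def harmonicCochains (G : OrientedGraph) (R : Type*) [AddCommGroup R] : AddSubgroup (G.E → R) where
  carrier := {φ | G.IsHarmonic φ}
  zero_mem' := by
    refine ⟨fun e => by simp, fun v => ⟨by simp, by simp⟩⟩
  add_mem' := by
    rintro φ ψ ⟨h1, h2⟩ ⟨h3, h4⟩
    refine ⟨fun e => ?_, fun v => ⟨?_, ?_⟩⟩
    · have := congrArg₂ (· + ·) (h1 e) (h3 e)
      simp only [add_zero] at this
      rw [← this]
      simp only [Pi.add_apply]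
      abel
    · refine ((h2 v).1.union (h4 v).1).subset ?_
      rintro e ⟨he, hne⟩
      by_contra hcon
      simp only [Set.mem_union, Set.mem_ofPred_eq, he, true_and, not_or, not_not] at hcon
      exact hne (by simp [hcon.1, hcon.2])
    · have e1 := finsum_mem_add_distrib' (s := {e : G.E | G.o e = v}) (f := φ) (g := ψ)
        (h2 v).1 (h4 v).1
      have e2 := (h2 v).2
      have e3 := (h4 v).2
      simp only [Set.mem_ofPred_eq] at e1
      simp only [Pi.add_apply]
      rw [e1, e2, e3, add_zero]
  neg_mem' := by
    rintro φ ⟨h1, h2⟩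
    refine ⟨fun e => ?_, fun v => ⟨?_, ?_⟩⟩
    · have := congrArg Neg.neg (h1 e)
      rw [neg_zero, neg_add] at this
      exact this
    · simpa using (h2 v).1
    · have e2 := (h2 v).2
      simp only [Pi.neg_apply, finsum_neg_distrib, e2, neg_zero]

end OrientedGraph

/-! ## The Bruhat–Tits tree of `PGL₂(K)` -/

namespace BruhatTits

variable {K : Type*} [Field K] (O : ValuationSubring K)

/-- `O`-lattices in `K²`: finitely generated `O`-submodules that span `K²` over `K`. -/
def Lattice : Type _ := {L : Submodule O (Fin 2 → K) // L.IsLattice K}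

/-- The action of a matrix on column vectors, as an `O`-linear map. -/
def mulVecO (g : GL (Fin 2) K) : (Fin 2 → K) →ₗ[O] (Fin 2 → K) :=
  (Matrix.mulVecLin g.1).restrictScalars O

theorem mem_map_mulVecO (g : GL (Fin 2) K) (L : Submodule O (Fin 2 → K)) (x : Fin 2 → K) :
    x ∈ L.map (mulVecO O g) ↔ Matrix.mulVec (g⁻¹).1 x ∈ L := by
  constructor
  · rintro ⟨y, hy, rfl⟩
    have : Matrix.mulVec (g⁻¹).1 (mulVecO O g y) = y := by
      change Matrix.mulVec (g⁻¹).1 (Matrix.mulVec g.1 y) = y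
      rw [Matrix.mulVec_mulVec, ← Units.val_mul, inv_mul_cancel, Units.val_one, Matrix.one_mulVec]
    rw [this]
    exact hy
  · intro h
    refine ⟨_, h, ?_⟩
    change Matrix.mulVec g.1 (Matrix.mulVec (g⁻¹).1 x) = x
    rw [Matrix.mulVec_mulVec, ← Units.val_mul, mul_inv_cancel, Units.val_one, Matrix.one_mulVec]

/-- `GL₂(K)` acts on lattices by `g • L = g(L)`. -/
instance : MulAction (GL (Fin 2) K) (Lattice O) where
  smul g L := ⟨L.1.map (mulVecO O g), by
    have h1 := L.2.fg
    have h2 := L.2.span_eq_top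
    refine ⟨h1.map _, ?_⟩
    rw [eq_top_iff]
    intro x _
    have hx : Matrix.mulVec (g⁻¹).1 x ∈ Submodule.span K (L.1 : Set (Fin 2 → K)) := by
      rw [h2]; trivial
    have h3 := Submodule.mem_map_of_mem (f := Matrix.mulVecLin g.1) hx
    rw [Submodule.map_span] at h3
    have h4 : Matrix.mulVecLin g.1 (Matrix.mulVec (g⁻¹).1 x) = x := by
      change Matrix.mulVec g.1 (Matrix.mulVec (g⁻¹).1 x) = x
      rw [Matrix.mulVec_mulVec, ← Units.val_mul, mul_inv_cancel, Units.val_one,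
        Matrix.one_mulVec]
    rw [h4] at h3
    exact h3⟩
  one_smul L := by
    apply Subtype.ext
    ext x
    change x ∈ L.1.map (mulVecO O 1) ↔ _
    rw [mem_map_mulVecO]
    simp
  mul_smul g h L := by
    apply Subtype.ext
    ext x
    change x ∈ L.1.map (mulVecO O (g * h)) ↔ x ∈ (L.1.map (mulVecO O h)).map (mulVecO O g)
    rw [mem_map_mulVecO, mem_map_mulVecO, mem_map_mulVecO, Matrix.mulVec_mulVec, mul_inv_rev,
      Units.val_mul]

theorem mem_smul (g : GL (Fin 2) K) (L : Lattice O) (x : Fin 2 → K) :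
    x ∈ (g • L).1 ↔ Matrix.mulVec (g⁻¹).1 x ∈ L.1 :=
  mem_map_mulVecO O g L.1 x

/-- Two lattices are homothetic if `L' = c L` for some `c ∈ Kˣ`. -/
def homothety : Setoid (Lattice O) where
  r L L' := ∃ c : K, c ≠ 0 ∧ ∀ x, c • x ∈ L'.1 ↔ x ∈ L.1
  iseqv := by
    refine ⟨fun L => ⟨1, one_ne_zero, by simp⟩, ?_, ?_⟩
    · rintro L L' ⟨c, hc, h⟩
      refine ⟨c⁻¹, inv_ne_zero hc, fun x => ?_⟩
      rw [← h, smul_inv_smul₀ hc]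
    · rintro L L' L'' ⟨c, hc, h⟩ ⟨d, hd, h'⟩
      refine ⟨d * c, mul_ne_zero hd hc, fun x => ?_⟩
      rw [mul_smul, h', h]

/-- The vertices of the tree: homothety classes of lattices. -/
def Vertex : Type _ := Quotient (homothety O)

/-- The homothety class of a lattice. -/
def Vertex.mk (L : Lattice O) : Vertex O := Quotient.mk (homothety O) L

/-- `g • [L] = [g(L)]`. -/
instance : MulAction (GL (Fin 2) K) (Vertex O) where
  smul g := Quotient.map (fun L => g • L) (by
    rintro L L' ⟨c, hc, h⟩
    refine ⟨c, hc, fun x => ?_⟩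
    rw [mem_smul, mem_smul, Matrix.mulVec_smul, h])
  one_smul v := by
    induction v using Quotient.inductionOn with
    | _ L => exact congrArg (Vertex.mk O) (one_smul _ L)
  mul_smul g h v := by
    induction v using Quotient.inductionOn with
    | _ L => exact congrArg (Vertex.mk O) (mul_smul g h L)

theorem smul_mk (g : GL (Fin 2) K) (L : Lattice O) :
    g • Vertex.mk O L = Vertex.mk O (g • L) := rfl

/-- The Bruhat–Tits tree: two distinct vertices are adjacent iff they have representatives one of
which is a maximal proper `O`-submodule of the other (that is, the quotient is isomorphic to the
residue field of `O`). -/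
def tree : SimpleGraph (Vertex O) :=
  SimpleGraph.fromRel fun v w => ∃ L M : Lattice O,
    Vertex.mk O L = v ∧ Vertex.mk O M = w ∧ L.1 ⋖ M.1

theorem smul_covBy (g : GL (Fin 2) K) {L M : Lattice O} (h : L.1 ⋖ M.1) :
    (g • L).1 ⋖ (g • M).1 := by
  have key : ∀ (L M : Lattice O) (g : GL (Fin 2) K), L.1 < M.1 → (g • L).1 < (g • M).1 := by
    intro L M g h
    obtain ⟨h1, x, hx, hx'⟩ := SetLike.lt_iff_le_and_exists.mp h
    refine SetLike.lt_iff_le_and_exists.mpr ⟨Submodule.map_mono h1, mulVecO O g x,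
      Submodule.mem_map_of_mem hx, fun hh => hx' ?_⟩
    rw [mem_smul] at hh
    change Matrix.mulVec (g⁻¹).1 (Matrix.mulVec g.1 x) ∈ _ at hh
    rwa [Matrix.mulVec_mulVec, ← Units.val_mul, inv_mul_cancel, Units.val_one,
      Matrix.one_mulVec] at hh
  refine ⟨key L M g h.1, fun N hN hN' => ?_⟩
  have e : ∀ (P Q : Submodule O (Fin 2 → K)) (g : GL (Fin 2) K), P < Q →
      P.map (mulVecO O g) < Q.map (mulVecO O g) := by
    intro P Q g h
    refine lt_of_le_of_ne (Submodule.map_mono h.le) fun he => h.ne ?_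
    ext x
    have := SetLike.ext_iff.mp he (Matrix.mulVec g.1 x)
    rw [mem_map_mulVecO, mem_map_mulVecO] at this
    rwa [Matrix.mulVec_mulVec, ← Units.val_mul, inv_mul_cancel, Units.val_one,
      Matrix.one_mulVec] at this
  have b : ∀ P : Lattice O, (g • P).1.map (mulVecO O g⁻¹) = P.1 := fun P =>
    congrArg Subtype.val (inv_smul_smul g P)
  have a1 := e _ _ g⁻¹ hN
  have a2 := e _ _ g⁻¹ hN'
  rw [b] at a1 a2
  exact h.2 a1 a2

theorem smul_adj (g : GL (Fin 2) K) {v w : Vertex O} (h : (tree O).Adj v w) :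
    (tree O).Adj (g • v) (g • w) := by
  rw [tree, SimpleGraph.fromRel_adj] at h ⊢
  refine ⟨fun he => h.1 (MulAction.injective g he), ?_⟩
  rcases h.2 with ⟨L, M, rfl, rfl, hLM⟩ | ⟨L, M, rfl, rfl, hLM⟩
  · exact Or.inl ⟨g • L, g • M, rfl, rfl, smul_covBy O g hLM⟩
  · exact Or.inr ⟨g • L, g • M, rfl, rfl, smul_covBy O g hLM⟩

/-- The oriented edges of the tree: ordered pairs of adjacent vertices. -/
abbrev Edge : Type _ := (tree O).Dart

/-- The action of `GL₂(K)` on oriented edges. -/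
instance : MulAction (GL (Fin 2) K) (Edge O) where
  smul g e := ⟨(g • e.fst, g • e.snd), smul_adj O g e.adj⟩
  one_smul _ := SimpleGraph.Dart.ext _ _ (Prod.ext (one_smul _ _) (one_smul _ _))
  mul_smul _ _ _ := SimpleGraph.Dart.ext _ _ (Prod.ext (mul_smul _ _ _) (mul_smul _ _ _))

/-- The Bruhat–Tits tree as an oriented graph. -/
def treeGraph : OrientedGraph where
  V := Vertex O
  E := Edge O
  o e := e.fst
  t e := e.snd
  bar e := e.symm
  o_bar _ := rfl
  t_bar _ := rfl
  bar_bar e := e.symm_symm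

variable (G : Subgroup (GL (Fin 2) K))

/-- The vertices of `G \ T`. -/
abbrev QVertex : Type _ := MulAction.orbitRel.Quotient G (Vertex O)

/-- The edges of `G \ T`. -/
abbrev QEdge : Type _ := MulAction.orbitRel.Quotient G (Edge O)

/-- The image in `G \ T` of an edge of the tree. -/
def toQEdge (e : Edge O) : QEdge O G := Quotient.mk (MulAction.orbitRel G (Edge O)) e

/-- The quotient graph `G \ T`. -/
def quotientGraph : OrientedGraph where
  V := QVertex O G
  E := QEdge O G
  o := Quotient.map (sa := MulAction.orbitRel G (Edge O)) (sb := MulAction.orbitRel G (Vertex O))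
    (fun e => e.fst) (by rintro _ e ⟨g, rfl⟩; exact ⟨g, rfl⟩)
  t := Quotient.map (sa := MulAction.orbitRel G (Edge O)) (sb := MulAction.orbitRel G (Vertex O))
    (fun e => e.snd) (by rintro _ e ⟨g, rfl⟩; exact ⟨g, rfl⟩)
  bar := Quotient.map (sa := MulAction.orbitRel G (Edge O)) (sb := MulAction.orbitRel G (Edge O))
    (fun e => e.symm) (by rintro _ e ⟨g, rfl⟩; exact ⟨g, rfl⟩)
  o_bar e := by induction e using Quotient.inductionOn with | _ e => rfl
  t_bar e := by induction e using Quotient.inductionOn with | _ e => rfl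
  bar_bar e := by
    induction e using Quotient.inductionOn with
    | _ e => exact congrArg (toQEdge O G) e.symm_symm

/-- `H_!(T, M)^G`: the group of `G`-invariant `M`-valued harmonic cochains on the tree that are
supported on finitely many edges of `G \ T`. -/
def HShriek (M : Type*) [AddCommGroup M] : AddSubgroup (Edge O → M) where
  carrier := {φ | φ ∈ (treeGraph O).harmonicCochains M ∧ (∀ g ∈ G, ∀ e, φ (g • e) = φ e) ∧
    (toQEdge O G '' Function.support φ).Finite}
  zero_mem' := ⟨AddSubgroup.zero_mem _, fun _ _ _ => rfl, by
    rw [Function.support_zero, Set.image_empty]; exact Set.finite_empty⟩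
  add_mem' := by
    rintro φ ψ ⟨h1, h2, h3⟩ ⟨h4, h5, h6⟩
    refine ⟨AddSubgroup.add_mem _ h1 h4, fun g hg e => ?_, ?_⟩
    · rw [Pi.add_apply, Pi.add_apply, h2 g hg, h5 g hg]
    · refine (h3.union h6).subset ?_
      rw [← Set.image_union]
      exact Set.image_mono (Function.support_add φ ψ)
  neg_mem' := by
    rintro φ ⟨h1, h2, h3⟩
    refine ⟨AddSubgroup.neg_mem _ h1, fun g hg e => ?_, ?_⟩
    · rw [Pi.neg_apply, Pi.neg_apply, h2 g hg]
    · rw [Function.support_neg]; exact h3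

end BruhatTits

/-! ## Function fields and arithmetic groups -/

/-- `F` is the function field of a geometrically connected smooth projective curve over the
(perfect) field `k`: it is finitely generated of transcendence degree one over `k`, and `k` is
algebraically closed in `F`. -/
structure IsFunctionFieldOfCurve (k F : Type*) [Field k] [Field F] [Algebra k F] : Prop where
  fg : (⊤ : IntermediateField k F).FG
  trdeg : Algebra.trdeg k F = 1
  constants : ∀ x : F, IsAlgebraic k x → x ∈ Set.range (algebraMap k F)

/-- A place of `F / k`, that is, (the local ring of) a closed point of the curve: a valuation ring
of `F` that contains `k` and is different from `F`. -/
structure Place (k F : Type*) [Field k] [Field F] [Algebra k F] where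
  ring : ValuationSubring F
  algebraMap_mem : ∀ c : k, algebraMap k F c ∈ ring
  ne_top : ring ≠ ⊤

namespace Place

variable {k F : Type*} [Field k] [Field F] [Algebra k F] (P : Place k F)

/-- The residue field of `P` is an extension of `k`. -/
def residueHom : k →+* IsLocalRing.ResidueField P.ring :=
  (IsLocalRing.residue P.ring).comp ((algebraMap k F).codRestrict P.ring P.algebraMap_mem)

/-- The degree of `P`: the degree over `k` of its residue field. -/
def degree : ℕ :=
  letI : Algebra k (IsLocalRing.ResidueField P.ring) := P.residueHom.toAlgebra
  Module.finrank k (IsLocalRing.ResidueField P.ring)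

/-- The ring `A` of the functions that are regular away from `P`. -/
def regularAway : Subring F :=
  ⨅ Q : {Q : Place k F // Q ≠ P}, Q.1.ring.toSubring

/-- The completion `F_P` of `F`. -/
abbrev Completion : Type _ := P.ring.valuation.Completion

/-- The valuation ring of the completion. -/
abbrev integers : ValuationSubring P.Completion :=
  (Valued.v : Valuation P.Completion P.ring.ValueGroup).valuationSubring

/-- The embedding of `F` in its completion. -/
def toCompletion : F →+* P.Completion :=
  (UniformSpace.Completion.coeRingHom (α := WithVal P.ring.valuation)).comp
    (WithVal.equiv P.ring.valuation).symm.toRingHom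

/-- `A`-lattices in `F²`: projective `A`-submodules of rank two. -/
def IsALattice (Y : Submodule P.regularAway (Fin 2 → F)) : Prop :=
  Module.Projective P.regularAway Y ∧ Module.finrank P.regularAway Y = 2

/-- `Γ(Y)`: the automorphisms of `F²` that leave `Y` invariant. -/
def stabLattice (Y : Submodule P.regularAway (Fin 2 → F)) : Subgroup (GL (Fin 2) F) where
  carrier := {g | ∀ y, Matrix.mulVec g.1 y ∈ Y ↔ y ∈ Y}
  one_mem' := fun y => by rw [Units.val_one, Matrix.one_mulVec]
  mul_mem' := by
    intro g h hg hh y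
    rw [Units.val_mul, ← Matrix.mulVec_mulVec, hg, hh]
  inv_mem' := by
    intro g hg y
    rw [← hg, Matrix.mulVec_mulVec, ← Units.val_mul, mul_inv_cancel, Units.val_one,
      Matrix.one_mulVec]

/-- `Γ(Y, 𝔞)`: the elements of `Γ(Y)` that induce the identity on `Y / 𝔞Y`. -/
def congruenceSubgroup (Y : Submodule P.regularAway (Fin 2 → F)) (𝔞 : Ideal P.regularAway) :
    Subgroup (GL (Fin 2) F) where
  carrier := {g | g ∈ P.stabLattice Y ∧ ∀ y ∈ Y, Matrix.mulVec g.1 y - y ∈ 𝔞 • Y}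
  one_mem' := ⟨Subgroup.one_mem _, fun y _ => by
    rw [Units.val_one, Matrix.one_mulVec, sub_self]; exact Submodule.zero_mem _⟩
  mul_mem' := by
    rintro g h ⟨hg, hg'⟩ ⟨hh, hh'⟩
    refine ⟨Subgroup.mul_mem _ hg hh, fun y hy => ?_⟩
    have := Submodule.add_mem _ (hg' _ ((hh y).2 hy)) (hh' y hy)
    rwa [Matrix.mulVec_mulVec, ← Units.val_mul, sub_add_sub_cancel] at this
  inv_mem' := by
    rintro g ⟨hg, hg'⟩
    have hi : g⁻¹ ∈ P.stabLattice Y := Subgroup.inv_mem _ hg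
    refine ⟨hi, fun y hy => ?_⟩
    have := Submodule.neg_mem _ (hg' _ ((hi y).2 hy))
    rwa [Matrix.mulVec_mulVec, ← Units.val_mul, mul_inv_cancel, Units.val_one, Matrix.one_mulVec,
      neg_sub] at this

/-- Arithmetic subgroups of `GL₂(F)`. -/
def IsArithmetic (Γ : Subgroup (GL (Fin 2) F)) : Prop :=
  ∃ (Y : Submodule P.regularAway (Fin 2 → F)) (𝔞 : Ideal P.regularAway),
    P.IsALattice Y ∧ 𝔞 ≠ ⊥ ∧ Γ ≤ P.stabLattice Y ∧ P.congruenceSubgroup Y 𝔞 ≤ Γ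

/-- The oriented edges of the Bruhat–Tits tree of `PGL₂(F_P)`. -/
abbrev TEdge : Type _ := BruhatTits.Edge P.integers

/-- `Γ` as a subgroup of `GL₂(F_P)`, through which it acts on the tree. -/
def localGroup (Γ : Subgroup (GL (Fin 2) F)) : Subgroup (GL (Fin 2) P.Completion) :=
  Γ.map (Matrix.GeneralLinearGroup.map P.toCompletion)

/-- The stabiliser `Γ_e` of an edge of the tree. -/
abbrev edgeStabilizer (Γ : Subgroup (GL (Fin 2) F)) (e : P.TEdge) : Subgroup (P.localGroup Γ) :=
  MulAction.stabilizer (P.localGroup Γ) e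

/-- The quotient graph `Γ \ T`. -/
abbrev quotientGraph (Γ : Subgroup (GL (Fin 2) F)) : OrientedGraph :=
  BruhatTits.quotientGraph P.integers (P.localGroup Γ)

/-- The image in `Γ \ T` of an edge of the tree. -/
abbrev toQuotient (Γ : Subgroup (GL (Fin 2) F)) (e : P.TEdge) : (P.quotientGraph Γ).E :=
  BruhatTits.toQEdge P.integers (P.localGroup Γ) e

/-- `H_!(T, ℤ)^Γ`. -/
abbrev cuspidalCochains (Γ : Subgroup (GL (Fin 2) F)) : AddSubgroup (P.TEdge → ℤ) :=
  BruhatTits.HShriek P.integers (P.localGroup Γ) ℤ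

end Place

end

/-! By flow decomposition, `H1` of a graph consists of its circulations, the finitely supported
alternating functions without divergence (`OrientedGraph.mem_H1_iff`). Suppose that `φ` on the tree
and `ψ` on the quotient satisfy `c φ(e) = |Γ_e| ψ(ẽ)` for some `c ≠ 0`. Then `φ` is a cuspidal
cochain if and only if `ψ` is a circulation (`BruhatTits.mem_HShriek_iff`): of the edges at `v`,
exactly `|Γ_v| / |Γ_e|` are equivalent to `e`, so that the weighted sum over the star of `v` is
`|Γ_v|` times the divergence of `ψ` at the image of `v`. The centre of `Γ` consists of scalars,
which fix all edges, so `z(Γ)` divides every `|Γ_e|`; taking `c = z(Γ)` gives `j`. It is injective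
since the orders `|Γ_e|` are not zero.

Let `Q = q ^ deg(∞)` be the order of the residue field. The exponent of the cokernel divides `Q - 1`
as soon as `|Γ_e|` divides `(Q - 1) z(Γ) φ(e)` for every cuspidal `φ`: then `c = (Q - 1) z(Γ)`
attaches to `φ` a circulation that `j` sends to `(Q - 1) φ`. Two facts give this divisibility.

The first is `Place.exists_card_edgeSubgroup`: `|Γ_e| = m z(Γ) |U|`, where `m` divides `Q - 1` and
`U` is unipotent. The number `m` is the order of the image of the quotient of the two diagonal
characters of the Iwahori group. On the kernel of this quotient the common eigenvalue is a constant,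
because trace and determinant have no poles at all; hence the kernel is the product of the scalars
in `Γ` and a unipotent group.

The second is `Place.card_dvd_apply_edgeOf`: `|U|` divides `φ(e)`. The group `U` fixes an end of the
tree, the edges pointing to this end correspond to balls of `F_∞`, and harmonicity makes `φ` a
finitely additive function of balls, invariant under a finite group of translations isomorphic to
`U`. Cut the ball of `e` into balls so small that the translations permute them freely.

Finiteness of the cokernel then follows from finite generation of the group of cuspidal cochains,
which rests on reduction theory. By a counting analogue of Minkowski's theorem, the vertices outside
finitely many classes modulo `Γ` have so many unipotents in `Γ` around them that a harmonic
invariant cochain grows geometrically along a ray unless it vanishes there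
(`Place.eq_zero_of_unipotents`); a cuspidal cochain has only finitely many values. So one finite set
of edges determines all cuspidal cochains. The facts on function fields behind this are that `A` is
discrete in `F_∞`, that `F` is the sum of `A` and a ball, and that functions without poles are
constant. -/

/-! ## The cycle group of an oriented graph -/

namespace OrientedGraph

variable (G : OrientedGraph)

theorem bar_injective : Function.Injective G.bar := fun a b h => by
  rw [← G.bar_bar a, h, G.bar_bar]

open Classical in
theorem edgeFun_apply (e x : G.E) :
    G.edgeFun e x = (if x = e then 1 else 0) - (if x = G.bar e then 1 else 0) := by
  simp [edgeFun, Pi.single_apply]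

theorem edgeFun_alternating (e x : G.E) : G.edgeFun e x + G.edgeFun e (G.bar x) = 0 := by
  classical
  have h1 : G.bar x = G.bar e ↔ x = e := G.bar_injective.eq_iff
  have h2 : G.bar x = e ↔ x = G.bar e :=
    ⟨fun h => by rw [← h, G.bar_bar], fun h => by rw [h, G.bar_bar]⟩
  simp only [edgeFun_apply, h1, h2]
  ring

theorem support_edgeFun_subset (e : G.E) : Function.support (G.edgeFun e) ⊆ {e, G.bar e} := by
  classical
  intro x hx
  by_contra h
  simp only [Set.mem_insert_iff, Set.mem_singleton_iff, not_or] at h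
  exact hx (by simp [edgeFun_apply, h.1, h.2])

/-- The divergence of an integral function on the edges at a vertex. -/
noncomputable def divergence (f : G.E → ℤ) (v : G.V) : ℤ := ∑ᶠ (e : G.E) (_ : G.o e = v), f e

theorem divergence_add {f g : G.E → ℤ} (hf : (Function.support f).Finite)
    (hg : (Function.support g).Finite) (v : G.V) :
    G.divergence (f + g) v = G.divergence f v + G.divergence g v :=
  finsum_mem_add_distrib' (s := {e : G.E | G.o e = v}) (hf.subset Set.inter_subset_right)
    (hg.subset Set.inter_subset_right)

theorem divergence_neg (f : G.E → ℤ) (v : G.V) : G.divergence (-f) v = -G.divergence f v := by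
  simp only [divergence, Pi.neg_apply, finsum_neg_distrib]

open Classical in
theorem divergence_single (e : G.E) (c : ℤ) (v : G.V) :
    G.divergence (Pi.single e c) v = if G.o e = v then c else 0 := by
  unfold divergence
  rw [finsum_eq_single _ e fun x hx => by simp [Pi.single_eq_of_ne hx]]
  rw [finsum_eq_if, Pi.single_eq_same]

open Classical in
theorem divergence_edgeFun (e : G.E) (v : G.V) :
    G.divergence (G.edgeFun e) v = (if G.o e = v then 1 else 0) - if G.t e = v then 1 else 0 := by
  have hs : ∀ (x : G.E) (c : ℤ), (Function.support (Pi.single x c : G.E → ℤ)).Finite :=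
    fun x c => (Set.finite_singleton x).subset Pi.support_single_subset
  rw [edgeFun, sub_eq_add_neg, ← Pi.single_neg, divergence_add G (hs _ _) (hs _ _),
    divergence_single, divergence_single, G.o_bar]
  split_ifs <;> simp

theorem support_add_finite {α : Type*} {f g : α → ℤ} (hf : (Function.support f).Finite)
    (hg : (Function.support g).Finite) : (Function.support (f + g)).Finite :=
  (hf.union hg).subset (Function.support_add f g)

theorem support_path_finite (l : List G.E) :
    (Function.support (l.map G.edgeFun).sum).Finite := by
  induction l with
  | nil => simp
  | cons e l ih =>
    rw [List.map_cons, List.sum_cons]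
    exact support_add_finite ((Set.toFinite {e, G.bar e}).subset (G.support_edgeFun_subset e)) ih

open Classical in
theorem divergence_path (l : List G.E) (u w : G.V) (h : G.IsPath u l w) (v : G.V) :
    G.divergence (l.map G.edgeFun).sum v = (if u = v then 1 else 0) - if w = v then 1 else 0 := by
  induction l generalizing u with
  | nil =>
    obtain rfl : u = w := h
    simp [divergence]
  | cons e l ih =>
    obtain ⟨rfl, h2⟩ := h
    rw [List.map_cons, List.sum_cons, divergence_add G
      ((Set.toFinite {e, G.bar e}).subset (G.support_edgeFun_subset e)) (G.support_path_finite l),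
      ih _ h2, divergence_edgeFun]
    ring

theorem alternating_path (l : List G.E) (x : G.E) :
    (l.map G.edgeFun).sum x + (l.map G.edgeFun).sum (G.bar x) = 0 := by
  induction l with
  | nil => simp
  | cons e l ih =>
    rw [List.map_cons, List.sum_cons, Pi.add_apply, Pi.add_apply]
    linear_combination G.edgeFun_alternating e x + ih

/-- Circulations: finitely supported alternating functions without divergence. -/
def IsCirculation (f : G.E → ℤ) : Prop :=
  (Function.support f).Finite ∧ (∀ e, f e + f (G.bar e) = 0) ∧ ∀ v, G.divergence f v = 0

variable {G}

theorem IsCirculation.neg {f : G.E → ℤ} (hf : G.IsCirculation f) : G.IsCirculation (-f) :=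
  ⟨by rw [Function.support_neg]; exact hf.1,
    fun e => by rw [Pi.neg_apply, Pi.neg_apply]; linear_combination - hf.2.1 e,
    fun v => by rw [divergence_neg, hf.2.2, neg_zero]⟩

theorem IsCirculation.add {f g : G.E → ℤ} (hf : G.IsCirculation f) (hg : G.IsCirculation g) :
    G.IsCirculation (f + g) :=
  ⟨support_add_finite hf.1 hg.1,
    fun e => by rw [Pi.add_apply, Pi.add_apply]; linear_combination hf.2.1 e + hg.2.1 e,
    fun v => by rw [divergence_add G hf.1 hg.1, hf.2.2, hg.2.2, add_zero]⟩

theorem isCirculation_of_closedPath {u : G.V} {l : List G.E} (h : G.IsPath u l u) :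
    G.IsCirculation (l.map G.edgeFun).sum :=
  ⟨G.support_path_finite l, G.alternating_path l,
    fun v => by classical rw [divergence_path G l u u h, sub_self]⟩

theorem isCirculation_of_mem_H1 {f : G.E → ℤ} (hf : f ∈ G.H1) : G.IsCirculation f := by
  induction hf using AddSubgroup.closure_induction with
  | mem f hf =>
    obtain ⟨u, l, h, rfl⟩ := hf
    exact isCirculation_of_closedPath h
  | zero => exact ⟨by simp, by simp, by simp [divergence]⟩
  | add f g _ _ hf hg => exact hf.add hg
  | neg f _ hf => exact hf.neg

/-- A circulation that is positive on an edge is positive on some edge that follows it. -/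
theorem IsCirculation.exists_next {f : G.E → ℤ} (hf : G.IsCirculation f) {e : G.E}
    (he : 0 < f e) : ∃ e', G.o e' = G.t e ∧ 0 < f e' := by
  classical
  by_contra! hcon
  have hd := hf.2.2 (G.t e)
  change ∑ᶠ (x) (_ : x ∈ {x | G.o x = G.t e}), f x = 0 at hd
  rw [finsum_mem_eq_sum_of_inter_support_eq (s := {x | G.o x = G.t e})
    (t := (hf.1.toFinset.filter fun x => G.o x = G.t e)) (f := f)
    (by ext x; simp; tauto)] at hd
  have hneg : f (G.bar e) < 0 := by linarith [hf.2.1 e]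
  have : ∑ x ∈ hf.1.toFinset.filter (fun x => G.o x = G.t e), f x < 0 := by
    refine Finset.sum_neg' (fun x hx => ?_) ⟨G.bar e, ?_, hneg⟩
    · simp only [Finset.mem_filter] at hx
      exact hcon x hx.2
    · simp [G.o_bar, hneg.ne]
  exact this.ne hd

theorem isPath_iterate (s : ℕ → G.E) (hs : ∀ n, G.o (s (n + 1)) = G.t (s n)) (n k : ℕ) :
    G.IsPath (G.o (s k)) ((List.range n).map fun i => s (k + i)) (G.o (s (k + n))) := by
  induction n generalizing k with
  | zero => exact rfl
  | succ n ih =>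
    rw [List.range_succ_eq_map, List.map_cons, List.map_map]
    refine ⟨rfl, ?_⟩
    have := ih (k + 1)
    rw [hs] at this
    have h1 : ∀ i, k + 1 + i = k + (i + 1) := fun i => by omega
    simp only [h1] at this
    exact this

/-- A nonzero circulation contains a closed path without repetition. -/
theorem IsCirculation.exists_cycle {f : G.E → ℤ} (hf : G.IsCirculation f) (h0 : f ≠ 0) :
    ∃ (u : G.V) (l : List G.E), G.IsPath u l u ∧ l.Nodup ∧ l ≠ [] ∧ ∀ e ∈ l, 0 < f e := by
  obtain ⟨e0, he0⟩ : ∃ e, 0 < f e := by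
    by_contra! hcon
    refine h0 (funext fun e => le_antisymm (hcon e) ?_)
    have h1 := hf.2.1 e
    have h2 := hcon (G.bar e)
    change 0 ≤ f e
    linarith
  let X := {e // 0 < f e}
  have hX : Finite X := (hf.1.subset fun e (he : 0 < f e) => he.ne').to_subtype
  -- Choosing a successor of each positive edge gives a self-map of a finite set. The orbit of a
  -- periodic point, followed for its minimal period, is a closed path without repeated edges.
  choose s hs1 hs2 using fun e : X => hf.exists_next e.2
  let S : X → X := fun e => ⟨s e, hs2 e⟩
  obtain ⟨m, n, hmn, heq⟩ := Finite.exists_ne_map_eq_of_infinite fun n : ℕ => S^[n] ⟨e0, he0⟩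
  wlog hlt : m < n generalizing m n
  · exact this n m hmn.symm heq.symm (by omega)
  let x := S^[m] ⟨e0, he0⟩
  have hper : x ∈ Function.periodicPts S := by
    refine ⟨n - m, by omega, ?_⟩
    change S^[n - m] (S^[m] _) = _
    rw [← Function.iterate_add_apply, Nat.sub_add_cancel hlt.le]
    exact heq.symm
  have hpos := Function.minimalPeriod_pos_of_mem_periodicPts hper
  have hpath := isPath_iterate (fun i => (S^[i] x).1)
    (fun i => by rw [Function.iterate_succ_apply']; exact hs1 _) (Function.minimalPeriod S x) 0
  rw [Nat.zero_add, Function.iterate_minimalPeriod] at hpath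
  refine ⟨_, _, hpath, ?_, ?_, ?_⟩
  · refine List.Nodup.map_on ?_ List.nodup_range
    intro i hi j hj hij
    rw [List.mem_range] at hi hj
    simp only [Nat.zero_add] at hij
    exact Function.iterate_injOn_Iio_minimalPeriod hi hj (Subtype.ext hij)
  · simpa using hpos.ne'
  · intro e he
    obtain ⟨i, _, rfl⟩ := List.mem_map.mp he
    exact (S^[0 + i] x).2

/-- Since `f` is alternating and positive on `l`, it is negative on the reverses of the edges of
`l`. So where `f ≥ 0` the cycle takes only the values `0` and `1`, and subtracting it brings `f`
closer to zero without changing signs. -/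
theorem sum_edgeFun_apply_of_mem {f : G.E → ℤ} (hf : G.IsCirculation f) {l : List G.E}
    (hl : l.Nodup) (hpos : ∀ e ∈ l, 0 < f e) (x : G.E) (hx : 0 ≤ f x) :
    0 ≤ (l.map G.edgeFun).sum x ∧ (l.map G.edgeFun).sum x ≤ f x ∧
      (x ∈ l → 0 < (l.map G.edgeFun).sum x) := by
  classical
  have key : ∀ l : List G.E, l.Nodup → (∀ e ∈ l, 0 < f e) →
      (l.map G.edgeFun).sum x = if x ∈ l then 1 else 0 := by
    intro l hl hpos
    induction l with
    | nil => simp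
    | cons e l ih =>
      rw [List.map_cons, List.sum_cons, Pi.add_apply,
        ih (List.nodup_cons.mp hl).2 fun e he => hpos e (List.mem_cons_of_mem _ he),
        edgeFun_apply, if_neg (c := x = G.bar e), sub_zero]
      · by_cases hxe : x = e
        · subst hxe
          simp [(List.nodup_cons.mp hl).1]
        · simp [hxe]
      · rintro rfl
        have := hpos e List.mem_cons_self
        linarith [hf.2.1 e]
  rw [key l hl hpos]
  split_ifs with h
  · exact ⟨zero_le_one, hpos x h, fun _ => zero_lt_one⟩
  · exact ⟨le_rfl, hx, fun h' => absurd h' h⟩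

/-- Flow decomposition: induction on the total mass `∑ |f e|`, which drops when a cycle of positive
edges is subtracted. -/
theorem mem_H1_of_isCirculation {f : G.E → ℤ} (hf : G.IsCirculation f) : f ∈ G.H1 := by
  obtain ⟨n, hn⟩ : ∃ n, n = ∑ᶠ e, (f e).natAbs := ⟨_, rfl⟩
  induction n using Nat.strong_induction_on generalizing f with
  | _ n ih =>
  by_cases h0 : f = 0
  · rw [h0]; exact AddSubgroup.zero_mem _
  obtain ⟨u, l, hpath, hnd, hne, hpos⟩ := hf.exists_cycle h0
  set g := (l.map G.edgeFun).sum with hg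
  have hgH : g ∈ G.H1 := AddSubgroup.subset_closure ⟨u, l, hpath, hg⟩
  have hgc := isCirculation_of_closedPath hpath
  rw [← hg] at hgc
  have hfg : G.IsCirculation (f + -g) := hf.add hgc.neg
  have hle : ∀ x, ((f + -g) x).natAbs ≤ (f x).natAbs := by
    have h1 : ∀ x, 0 ≤ f x → ((f + -g) x).natAbs ≤ (f x).natAbs := by
      intro x hx
      have := sum_edgeFun_apply_of_mem hf hnd hpos x hx
      rw [← hg] at this
      rw [Pi.add_apply, Pi.neg_apply]
      omega
    intro x
    by_cases hx : 0 ≤ f x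
    · exact h1 x hx
    · have h2 := hf.2.1 x
      have h3 := hfg.2.1 x
      have h4 := h1 (G.bar x) (by omega)
      omega
  obtain ⟨e, he⟩ := List.exists_mem_of_ne_nil l hne
  have hlt : ∑ᶠ e, ((f + -g) e).natAbs < ∑ᶠ e, (f e).natAbs := by
    rw [finsum_eq_sum_of_support_subset (s := hf.1.toFinset) (fun x => ((f + -g) x).natAbs)
        (fun x hx => by
          have := hle x
          simp only [Function.mem_support] at hx
          simp only [Set.Finite.coe_toFinset, Function.mem_support]
          intro h
          rw [h] at this
          omega),
      finsum_eq_sum_of_support_subset (s := hf.1.toFinset) (fun x => (f x).natAbs)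
        (fun x hx => by simpa using hx)]
    refine Finset.sum_lt_sum (fun x _ => hle x) ⟨e, ?_, ?_⟩
    · simpa using (hpos e he).ne'
    · have := sum_edgeFun_apply_of_mem hf hnd hpos e (hpos e he).le
      rw [← hg] at this
      have h2 := this.2.2 he
      rw [Pi.add_apply, Pi.neg_apply]
      omega
  have := AddSubgroup.add_mem _ (ih _ (hn ▸ hlt) hfg rfl) hgH
  rwa [neg_add_cancel_right] at this

/-- The group `H₁(G, ℤ)` consists of the circulations of `G`. -/
theorem mem_H1_iff {f : G.E → ℤ} : f ∈ G.H1 ↔ G.IsCirculation f :=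
  ⟨isCirculation_of_mem_H1, mem_H1_of_isCirculation⟩

end OrientedGraph

/-! ## Discrete valuation rings of a field -/

namespace ValuationSubring

variable {F : Type*} [Field F] (V : ValuationSubring F)

/-- `π` is a uniformizer: the valuation is discrete and its value group is generated by the value
of `π`. -/
structure IsUniformizer (π : F) : Prop where
  ne_zero : π ≠ 0
  lt_one : V.valuation π < 1
  exists_zpow : ∀ x, x ≠ 0 → ∃ n : ℤ, V.valuation x = V.valuation π ^ n

/-- By finiteness there is a largest value below `1`. It generates the value group: the quotient of
a value by the last power of it that still exceeds this value is below `1`, so maximality bounds it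
by the generator. -/
theorem exists_uniformizer (hV : V ≠ ⊤)
    (hfin : ∀ f, f ≠ 0 → V.valuation f < 1 →
      {c | V.valuation f < c ∧ c ≤ 1 }.Finite) : ∃ π, V.IsUniformizer π := by
  obtain ⟨f, hf0, hf1⟩ : ∃ f, f ≠ 0 ∧ V.valuation f < 1 := by
    obtain ⟨y, hy⟩ : ∃ y, y ∉ V := by
      by_contra! h
      exact hV (_root_.eq_top_iff.mpr fun x _ => h x)
    refine ⟨y⁻¹, inv_ne_zero fun h => hy (h ▸ V.zero_mem), ?_⟩
    rw [← V.valuation_le_one_iff, not_le] at hy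
    rw [map_inv₀]
    exact inv_lt_one_of_one_lt₀ hy
  obtain ⟨π, hπ0, hπ1, hmax⟩ : ∃ π, π ≠ 0 ∧ V.valuation π < 1 ∧
      ∀ x, V.valuation x < 1 → V.valuation x ≤ V.valuation π := by
    let S := {c | V.valuation f ≤ c ∧ c < 1}
    have hS : S.Finite := ((hfin f hf0 hf1).union (Set.finite_singleton (V.valuation f))).subset
      fun c hc => hc.1.lt_or_eq.imp (fun h => ⟨h, hc.2.le⟩) fun h => h.symm
    obtain ⟨c, hc, hcm⟩ := hS.exists_maximal ⟨V.valuation f, le_rfl, hf1⟩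
    obtain ⟨π, rfl⟩ := V.valuation_surjective c
    refine ⟨π, ?_, hc.2, fun x hx => ?_⟩
    · rintro rfl
      have := hc.1
      rw [map_zero, le_zero_iff, map_eq_zero] at this
      exact hf0 this
    · by_contra! hcon
      exact (hcm ⟨hc.1.trans hcon.le, hx⟩ hcon.le).not_gt hcon
  have hπv : V.valuation π ≠ 0 := (map_ne_zero _).mpr hπ0
  have hsmall : ∀ x, x ≠ 0 → V.valuation x < 1 → ∃ n : ℤ, V.valuation x = V.valuation π ^ n := by
    intro x hx0 hx1
    have hex : ∃ n : ℕ, V.valuation π ^ n ≤ V.valuation x := by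
      by_contra! hcon
      have hinj : Function.Injective fun n : ℕ => V.valuation π ^ n :=
        (pow_right_strictAnti₀ (zero_lt_iff.mpr hπv) hπ1).injective
      exact Set.infinite_range_of_injective hinj ((hfin x hx0 hx1).subset (by
        rintro _ ⟨n, rfl⟩
        exact ⟨hcon n, pow_le_one₀ zero_le hπ1.le⟩))
    classical
    have h1 := Nat.find_spec hex
    have h2 := fun m => Nat.find_min (m := m) hex
    generalize Nat.find hex = n at h1 h2
    cases n with
    | zero => exact absurd (h1.trans_lt hx1) (by simp)
    | succ n =>
      refine ⟨(n + 1 : ℕ), le_antisymm ?_ (by rw [zpow_natCast]; exact h1)⟩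
      have h3 := not_le.mp (h2 n (Nat.lt_succ_self n))
      have h4 : V.valuation (x / π ^ n) < 1 := by
        rw [map_div₀, map_pow]
        exact (div_lt_one₀ (pow_pos (zero_lt_iff.mpr hπv) n)).mpr h3
      have h5 := hmax _ h4
      rw [map_div₀, map_pow, div_le_iff₀ (pow_pos (zero_lt_iff.mpr hπv) n)] at h5
      rw [zpow_natCast, pow_succ']
      exact h5
  refine ⟨π, hπ0, hπ1, fun x hx0 => ?_⟩
  rcases lt_trichotomy (V.valuation x) 1 with h | h | h
  · exact hsmall x hx0 h
  · exact ⟨0, by simpa using h⟩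
  · obtain ⟨n, hn⟩ := hsmall x⁻¹ (inv_ne_zero hx0) (by
      rw [map_inv₀]; exact inv_lt_one_of_one_lt₀ h)
    refine ⟨-n, ?_⟩
    rw [zpow_neg, ← hn, map_inv₀, inv_inv]

variable {V} in
theorem IsUniformizer.ne_zero' {π : F} (h : V.IsUniformizer π) : V.valuation π ≠ 0 :=
  (map_ne_zero _).mpr h.ne_zero

variable {V} in
theorem IsUniformizer.zpow_le_zpow_iff {π : F} (h : V.IsUniformizer π) {m n : ℤ} :
    V.valuation π ^ m ≤ V.valuation π ^ n ↔ n ≤ m :=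
  zpow_le_zpow_iff_right_of_lt_one₀ (zero_lt_iff.mpr h.ne_zero') h.lt_one

variable {V} in
theorem IsUniformizer.zpow_lt_zpow_iff {π : F} (h : V.IsUniformizer π) {m n : ℤ} :
    V.valuation π ^ m < V.valuation π ^ n ↔ n < m :=
  zpow_lt_zpow_iff_right_of_lt_one₀ (zero_lt_iff.mpr h.ne_zero') h.lt_one

variable {V} in
/-- The valuation of a discrete valuation ring has no proper overrings but the field itself. -/
theorem IsUniformizer.eq_of_le {π : F} (h : V.IsUniformizer π) {W : ValuationSubring F}
    (hVW : V ≤ W) (hW : W ≠ ⊤) : V = W := by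
  refine le_antisymm hVW fun x hx => ?_
  by_contra hxV
  refine hW (_root_.eq_top_iff.mpr fun y _ => ?_)
  by_cases hy : y = 0
  · rw [hy]; exact W.zero_mem
  have hx1 : 1 < V.valuation x := by
    rw [← V.valuation_le_one_iff, not_le] at hxV; exact hxV
  have hx0 : x ≠ 0 := by rintro rfl; exact hxV V.zero_mem
  obtain ⟨n, hn⟩ := h.exists_zpow x hx0
  obtain ⟨m, hm⟩ := h.exists_zpow y hy
  have hn0 : n < 0 := by
    rw [hn, ← zpow_zero (V.valuation π), h.zpow_lt_zpow_iff] at hx1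
    exact hx1
  -- The element `x` of `W` has a pole for `V`, so a high power of it dominates any given `y`: the
  -- quotient lies in `V`, and therefore `y` lies in `W`.
  have hk : V.valuation (y / x ^ m.natAbs) ≤ 1 := by
    rw [map_div₀, map_pow, hm, hn, ← zpow_natCast, ← zpow_mul, ← zpow_sub₀ h.ne_zero',
      ← zpow_zero (V.valuation π), h.zpow_le_zpow_iff]
    have : |m| ≤ -n * |m| := le_mul_of_one_le_left (abs_nonneg m) (by omega)
    have h2 := neg_abs_le m
    rw [Int.natCast_natAbs]
    linarith
  have := W.mul_mem _ _ (hVW (V.mem_of_valuation_le_one _ hk)) (pow_mem hx m.natAbs)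
  rwa [div_mul_cancel₀ _ (pow_ne_zero _ hx0)] at this

end ValuationSubring

/-! ## Function fields of curves -/

namespace IsFunctionFieldOfCurve

variable {k F : Type*} [Field k] [Field F] [Algebra k F]

/-- As the transcendence degree is one, `y` alone is a transcendence basis, and `F` is algebraic and
finitely generated over `k(y)`. -/
theorem finiteDimensional (hF : IsFunctionFieldOfCurve k F) {y : F} (hy : Transcendental k y) :
    FiniteDimensional (IntermediateField.adjoin k {y}) F := by
  have hfg : Algebra.EssFiniteType k F := IntermediateField.fg_top_iff.mp hF.fg
  have hai : AlgebraicIndependent k ![y] := algebraicIndependent_iff_transcendental.mpr hy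
  have htb : IsTranscendenceBasis k ![y] :=
    hai.isTranscendenceBasis_of_lift_trdeg_le_of_finite (by rw [hF.trdeg]; simp)
  have halg := htb.isAlgebraic_field
  have hr : Set.range ![y] = {y} := by simp
  rw [hr] at halg
  have : Algebra.EssFiniteType (IntermediateField.adjoin k {y}) F := .of_comp k _ _
  exact Algebra.finite_of_essFiniteType_of_isAlgebraic

/-- If elements of a ring `R` containing `k` and `u` are linearly independent over `k` modulo
`u R`, then they are linearly independent over `k(u)`. -/
theorem linearIndependent_of_mod {u : F} (hu : Transcendental k u) {R : Subring F}
    (hkR : ∀ c : k, algebraMap k F c ∈ R) (huR : u ∈ R) {ι : Type*} [Fintype ι] {e : ι → F}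
    (he : ∀ i, e i ∈ R)
    (hind : ∀ c : ι → k, (∃ r ∈ R, ∑ i, c i • e i = u * r) → c = 0) :
    LinearIndependent (IntermediateField.adjoin k {u}) e := by
  have hu0 : u ≠ 0 := by rintro rfl; exact hu isAlgebraic_zero
  have hpol : ∀ p : Polynomial k, Polynomial.aeval u p ∈ R := by
    intro p
    induction p using Polynomial.induction_on with
    | C a => rw [Polynomial.aeval_C]; exact hkR a
    | add p q hp hq => rw [map_add]; exact R.add_mem hp hq
    | monomial n a _ =>
      rw [map_mul, map_pow, Polynomial.aeval_X, Polynomial.aeval_C]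
      exact R.mul_mem (hkR a) (pow_mem huR _)
  -- In a relation `∑ pᵢ(u) eᵢ = 0`, reduction modulo `u R` shows that the constant coefficients
  -- vanish. The relation can then be divided by `u`, which lowers the degrees.
  have key : ∀ (N : ℕ) (p : ι → Polynomial k), (∀ i, (p i).natDegree < N + 1) →
      ∑ i, Polynomial.aeval u (p i) * e i = 0 → p = 0 := by
    intro N
    induction N with
    | zero =>
      intro p hp hs
      have hc : (fun i => (p i).coeff 0) = 0 := by
        refine hind _ ⟨0, R.zero_mem, ?_⟩
        rw [mul_zero, ← hs]
        refine Finset.sum_congr rfl fun i _ => ?_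
        conv_rhs => rw [Polynomial.eq_C_of_natDegree_eq_zero (Nat.lt_one_iff.mp (hp i))]
        rw [Polynomial.aeval_C, Algebra.smul_def]
      funext i
      rw [Polynomial.eq_C_of_natDegree_eq_zero (Nat.lt_one_iff.mp (hp i)), congrFun hc i]
      simp
    | succ N ih =>
      intro p hp hs
      have hdec : ∀ i, Polynomial.aeval u (p i) =
          u * Polynomial.aeval u (p i).divX + algebraMap k F ((p i).coeff 0) := by
        intro i
        conv_lhs => rw [← Polynomial.divX_mul_X_add (p i)]
        rw [map_add, map_mul, Polynomial.aeval_X, Polynomial.aeval_C, mul_comm]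
      have hc : (fun i => (p i).coeff 0) = 0 := by
        refine hind _ ⟨-∑ i, Polynomial.aeval u (p i).divX * e i, R.neg_mem (R.sum_mem fun i _ =>
          R.mul_mem (hpol _) (he i)), ?_⟩
        rw [mul_neg, eq_neg_iff_add_eq_zero, ← hs, Finset.mul_sum, ← Finset.sum_add_distrib]
        refine Finset.sum_congr rfl fun i _ => ?_
        rw [hdec, Algebra.smul_def]
        ring
      have hq := ih (fun i => (p i).divX) (fun i => by
        rw [Polynomial.natDegree_divX_eq_natDegree_tsub_one]
        have := hp i
        omega) (by
        have h2 : u * ∑ i, Polynomial.aeval u (p i).divX * e i = 0 := by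
          rw [← hs, Finset.mul_sum]
          refine Finset.sum_congr rfl fun i _ => ?_
          rw [hdec i, congrFun hc i]
          simp [mul_assoc]
        exact (mul_eq_zero.mp h2).resolve_left hu0)
      funext i
      rw [← Polynomial.divX_mul_X_add (p i), congrFun hc i, congrFun hq i]
      simp
  -- Clearing denominators reduces independence over `k(u)` to independence over `k[u]`.
  open scoped IntermediateField.algebraAdjoinAdjoin in
  rw [← LinearIndependent.iff_fractionRing (R := Algebra.adjoin k {u}),
    Fintype.linearIndependent_iff]
  intro g hg
  have hex : ∀ i, ∃ p : Polynomial k, Polynomial.aeval u p = (g i : F) := fun i => by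
    have h := (g i).2
    generalize (g i : F) = z at h
    rw [Algebra.adjoin_singleton_eq_range_aeval] at h
    exact h
  choose p hp using hex
  have hp0 := key (Finset.univ.sup fun i => (p i).natDegree) p (fun i => Nat.lt_succ_of_le
    (Finset.le_sup (f := fun i => (p i).natDegree) (Finset.mem_univ i))) (by
      rw [← hg]
      refine Finset.sum_congr rfl fun i _ => ?_
      rw [hp, Algebra.smul_def]
      rfl)
  intro i
  apply Subtype.ext
  rw [← hp i, hp0]
  simp

end IsFunctionFieldOfCurve

/-! ### Places of a function field: discreteness, finite residue fields, approximation, finiteness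
of poles. -/

namespace Place

variable {k F : Type*} [Field k] [Field F] [Algebra k F] (P : Place k F)

theorem ext_ring {P Q : Place k F} (h : P.ring = Q.ring) : P = Q := by
  cases P; cases Q; cases h; rfl

theorem valuation_algebraMap {c : k} (hc : c ≠ 0) : P.ring.valuation (algebraMap k F c) = 1 := by
  have h1 := (P.ring.valuation_le_one_iff _).mpr (P.algebraMap_mem c)
  have h2 := (P.ring.valuation_le_one_iff _).mpr (P.algebraMap_mem c⁻¹)
  refine le_antisymm h1 ?_
  rw [map_inv₀, map_inv₀] at h2
  have h0 : P.ring.valuation (algebraMap k F c) ≠ 0 := by simpa using hc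
  exact (inv_le_one₀ (zero_lt_iff.mpr h0)).mp h2

theorem valuation_algebraMap_le (c : k) : P.ring.valuation (algebraMap k F c) ≤ 1 :=
  (P.ring.valuation_le_one_iff _).mpr (P.algebraMap_mem c)

theorem valuation_aeval_le {y : F} (hy : P.ring.valuation y ≤ 1) (p : Polynomial k) :
    P.ring.valuation (Polynomial.aeval y p) ≤ 1 := by
  rw [ValuationSubring.valuation_le_one_iff] at *
  rw [Polynomial.aeval_eq_sum_range]
  exact sum_mem fun i _ => by
    rw [Algebra.smul_def]
    exact mul_mem (P.algebraMap_mem _) (pow_mem hy i)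

/-- At a pole of `y` the leading term strictly dominates the others. -/
theorem valuation_aeval_of_one_lt {y : F} (hy : 1 < P.ring.valuation y) {p : Polynomial k}
    (hp : p ≠ 0) :
    P.ring.valuation (Polynomial.aeval y p) = P.ring.valuation y ^ p.natDegree := by
  have hy0 : 0 < P.ring.valuation y := zero_lt_one.trans hy
  have hlead : P.ring.valuation (p.coeff p.natDegree • y ^ p.natDegree) =
      P.ring.valuation y ^ p.natDegree := by
    rw [Algebra.smul_def, map_mul, P.valuation_algebraMap (by simpa using hp), one_mul, map_pow]
  rw [Polynomial.aeval_eq_sum_range, Finset.sum_range_succ, Valuation.map_add_eq_of_lt_right,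
    hlead]
  rw [hlead]
  refine Valuation.map_sum_lt _ (pow_pos hy0 _).ne' fun i hi => ?_
  rw [Algebra.smul_def, map_mul, map_pow]
  refine lt_of_le_of_lt (mul_le_of_le_one_left' (P.valuation_algebraMap_le _)) ?_
  exact pow_lt_pow_right₀ hy (Finset.mem_range.mp hi)

variable (hF : IsFunctionFieldOfCurve k F)

include hF in
theorem transcendental_of_one_lt {y : F} (hy : 1 < P.ring.valuation y) : Transcendental k y := by
  intro h
  obtain ⟨c, rfl⟩ := hF.constants y h
  exact hy.not_ge (P.valuation_algebraMap_le c)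

include hF in
theorem transcendental_of_lt_one {y : F} (hy0 : y ≠ 0) (hy : P.ring.valuation y < 1) :
    Transcendental k y := by
  intro h
  obtain ⟨c, rfl⟩ := hF.constants y h
  have hc : c ≠ 0 := by rintro rfl; exact hy0 (map_zero _)
  exact hy.ne (P.valuation_algebraMap hc)

/-- The elements of value at most `γ`. -/
def ball (γ : P.ring.ValueGroup) : Submodule k F where
  carrier := {x | P.ring.valuation x ≤ γ}
  zero_mem' := by simp
  add_mem' := fun ha hb => P.ring.valuation.map_add_le ha hb
  smul_mem' c x hx := by
    change P.ring.valuation (c • x) ≤ γ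
    rw [Algebra.smul_def, map_mul]
    exact (mul_le_of_le_one_left' (P.valuation_algebraMap_le _)).trans hx

theorem mem_ball {γ : P.ring.ValueGroup} {x : F} : x ∈ P.ball γ ↔ P.ring.valuation x ≤ γ :=
  Iff.rfl

variable [Finite k]

include hF in
-- Residues modulo `f` that are independent over `k` lift to elements independent over `k(f)`. So
-- the ring of `P` modulo `f` has dimension at most `[F : k(f)]` over the finite field `k`.
theorem exists_finite_residues {f : F} (hf0 : f ≠ 0) (hf : P.ring.valuation f < 1) :
    ∃ s : Set F, s.Finite ∧ ∀ x, P.ring.valuation x ≤ 1 →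
      ∃ y ∈ s, P.ring.valuation (x - y) ≤ P.ring.valuation f := by
  classical
  have hft := P.transcendental_of_lt_one hF hf0 hf
  have hfd := hF.finiteDimensional hft
  let M := P.ball (P.ring.valuation f)
  let W := (P.ball 1).map M.mkQ
  have hrank : Module.rank k W ≤ (Module.finrank (IntermediateField.adjoin k {f}) F : ℕ) := by
    refine rank_le fun s hs => ?_
    have hex : ∀ i : s, ∃ e, P.ring.valuation e ≤ 1 ∧ M.mkQ e = (i : W) := fun i => by
      simpa only [W, Submodule.mem_map, mem_ball] using i.1.2
    choose e he1 he2 using hex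
    have hli := IsFunctionFieldOfCurve.linearIndependent_of_mod hft (R := P.ring.toSubring) (e := e)
      P.algebraMap_mem ((P.ring.valuation_le_one_iff _).mp hf.le)
      (fun i => (P.ring.valuation_le_one_iff _).mp (he1 i)) (by
        rintro c ⟨r, hr, hc⟩
        rw [Fintype.linearIndependent_iff] at hs
        funext i
        refine hs c ?_ i
        apply Subtype.ext
        have h0 : M.mkQ (∑ i, c i • e i) = 0 := by
          rw [hc, Submodule.mkQ_apply, Submodule.Quotient.mk_eq_zero]
          change P.ring.valuation (f * r) ≤ P.ring.valuation f
          rw [map_mul]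
          exact mul_le_of_le_one_right' ((P.ring.valuation_le_one_iff _).mpr hr)
        rw [map_sum] at h0
        simp only [map_smul, he2] at h0
        rw [Submodule.coe_zero, ← h0, Submodule.coe_sum]
        rfl)
    have := hli.fintype_card_le_finrank
    rwa [Fintype.card_coe] at this
  have hfin : Module.Finite k W := Module.rank_lt_aleph0_iff.mp (hrank.trans_lt (Cardinal.natCast_lt_aleph0))
  have hfinW : Finite W := Module.finite_of_finite k
  have hex : ∀ w : W, ∃ e, P.ring.valuation e ≤ 1 ∧ M.mkQ e = (w : F ⧸ M) := fun w => by
    simpa only [W, Submodule.mem_map, mem_ball] using w.2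
  choose e he1 he2 using hex
  refine ⟨Set.range e, Set.finite_range e, fun x hx => ⟨e ⟨M.mkQ x, x, P.mem_ball.mpr hx, rfl⟩, ⟨_, rfl⟩, ?_⟩⟩
  have := he2 ⟨M.mkQ x, x, P.mem_ball.mpr hx, rfl⟩
  exact (Submodule.Quotient.eq M).mp this.symm

include hF in
-- A value larger than that of `f` depends only on the class modulo `f`, and there are finitely many
-- classes.
theorem exists_uniformizer : ∃ π, P.ring.IsUniformizer π := by
  refine P.ring.exists_uniformizer P.ne_top fun f hf0 hf1 => ?_
  obtain ⟨s, hs, hsx⟩ := P.exists_finite_residues hF hf0 hf1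
  refine (hs.image P.ring.valuation).subset ?_
  rintro c ⟨hc1, hc2⟩
  obtain ⟨x, rfl⟩ := P.ring.valuation_surjective c
  obtain ⟨y, hy, hxy⟩ := hsx x hc2
  refine ⟨y, hy, ?_⟩
  have := Valuation.map_sub_eq_of_lt_left _ (hxy.trans_lt hc1)
  rwa [sub_sub_cancel] at this

include hF in
theorem finite_residueField : Finite (IsLocalRing.ResidueField P.ring) := by
  obtain ⟨π, hπ⟩ := P.exists_uniformizer hF
  obtain ⟨s, hs, hsx⟩ := P.exists_finite_residues hF hπ.ne_zero hπ.lt_one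
  have : Finite (Subtype.val ⁻¹' s : Set P.ring) := hs.preimage Subtype.val_injective.injOn
  refine Finite.of_surjective (fun x : (Subtype.val ⁻¹' s : Set P.ring) =>
    IsLocalRing.residue P.ring x.1) fun r => ?_
  obtain ⟨x, rfl⟩ := IsLocalRing.residue_surjective r
  obtain ⟨y, hy, hxy⟩ := hsx x (P.ring.valuation_le_one x)
  have hlt := hxy.trans_lt hπ.lt_one
  have hyV : y ∈ P.ring := by
    have := P.ring.sub_mem x.2 ((P.ring.valuation_le_one_iff _).mp hlt.le)
    rwa [sub_sub_cancel] at this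
  refine ⟨⟨⟨y, hyV⟩, hy⟩, ?_⟩
  symm
  rw [← sub_eq_zero, ← map_sub, IsLocalRing.residue_eq_zero_iff,
    ValuationSubring.valuation_lt_one_iff]
  exact hlt

include hF in
theorem card_residueField :
    Nat.card (IsLocalRing.ResidueField P.ring) = Nat.card k ^ P.degree := by
  let _ : Algebra k (IsLocalRing.ResidueField P.ring) := P.residueHom.toAlgebra
  have := P.finite_residueField hF
  exact Module.natCard_eq_pow_finrank (K := k)

include hF in
theorem exists_pow_mul_lt {z : F} (hz : P.ring.valuation z < 1) (w : F) :
    ∃ N : ℕ, ∀ n, N ≤ n → P.ring.valuation (z ^ n * w) < 1 := by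
  obtain ⟨π, hπ⟩ := P.exists_uniformizer hF
  by_cases hw : w = 0
  · exact ⟨0, fun n _ => by rw [hw, mul_zero, map_zero]; exact zero_lt_one⟩
  by_cases hz0 : z = 0
  · exact ⟨1, fun n hn => by
      rw [hz0, zero_pow (by omega), zero_mul, map_zero]; exact zero_lt_one⟩
  obtain ⟨a, ha⟩ := hπ.exists_zpow z hz0
  obtain ⟨b, hb⟩ := hπ.exists_zpow w hw
  have ha0 : 0 < a := by
    rw [ha, ← zpow_zero (P.ring.valuation π), hπ.zpow_lt_zpow_iff] at hz
    exact hz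
  refine ⟨b.natAbs + 1, fun n hn => ?_⟩
  rw [map_mul, map_pow, ha, hb, ← zpow_natCast, ← zpow_mul, ← zpow_add₀ hπ.ne_zero',
    ← zpow_zero (P.ring.valuation π), hπ.zpow_lt_zpow_iff]
  have h1 : (n : ℤ) ≤ a * n := le_mul_of_one_le_left (by omega) ha0
  omega

include hF in
theorem not_le_of_ne {P Q : Place k F} (h : P ≠ Q) : ¬ P.ring ≤ Q.ring := fun hle => by
  obtain ⟨π, hπ⟩ := P.exists_uniformizer hF
  exact h (ext_ring (hπ.eq_of_le hle Q.ne_top))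

include hF in
/-- Weak approximation: there is a function with a pole at `P` and zeros at finitely many other
given places. -/
theorem exists_one_lt_and_lt_one (s : Finset (Place k F)) (hs : P ∉ s) :
    ∃ z, 1 < P.ring.valuation z ∧ ∀ Q ∈ s, Q.ring.valuation z < 1 := by
  classical
  induction s using Finset.induction_on with
  | empty =>
    obtain ⟨π, hπ⟩ := P.exists_uniformizer hF
    exact ⟨π⁻¹, by
      rw [map_inv₀]; exact (one_lt_inv₀ (zero_lt_iff.mpr hπ.ne_zero')).mpr hπ.lt_one, by simp⟩
  | insert Q s hQs ih =>
    rw [Finset.mem_insert, not_or] at hs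
    obtain ⟨z, hz1, hz2⟩ := ih hs.2
    obtain ⟨w, hw1, hw2⟩ : ∃ w, 1 < P.ring.valuation w ∧ Q.ring.valuation w < 1 := by
      obtain ⟨a, haQ, haP⟩ := SetLike.not_le_iff_exists.mp (not_le_of_ne hF (Ne.symm hs.1))
      obtain ⟨b, hbP, hbQ⟩ := SetLike.not_le_iff_exists.mp (not_le_of_ne hF hs.1)
      rw [← ValuationSubring.valuation_le_one_iff] at haQ haP hbP hbQ
      rw [not_le] at haP hbQ
      refine ⟨a / b, ?_, ?_⟩
      · rw [map_div₀]
        have hb0 : P.ring.valuation b ≠ 0 := by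
          rw [Valuation.ne_zero_iff]; rintro rfl; simp at hbQ
        exact (one_lt_div₀ (zero_lt_iff.mpr hb0)).mpr (hbP.trans_lt haP)
      · rw [map_div₀]
        exact (div_lt_one₀ (zero_lt_one.trans hbQ)).mpr (haQ.trans_lt hbQ)
    choose! N hN using fun R (hR : R ∈ s) => R.exists_pow_mul_lt hF (hz2 R hR) w
    let n := s.sup N + 1
    have hn : ∀ R ∈ s, R.ring.valuation (z ^ n * w) < 1 := fun R hR =>
      hN R hR n ((Finset.le_sup hR).trans (Nat.le_succ _))
    by_cases hzQ : Q.ring.valuation z ≤ 1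
    · refine ⟨z ^ n * w, ?_, fun R hR => ?_⟩
      · rw [map_mul, map_pow]
        exact one_lt_mul_of_le_of_lt (one_le_pow_of_one_le' hz1.le n) hw1
      · rcases Finset.mem_insert.mp hR with rfl | hR
        · rw [map_mul, map_pow]
          exact mul_lt_one_of_nonneg_of_lt_one_right (pow_le_one' hzQ n) zero_le hw2
        · exact hn R hR
    · rw [not_le] at hzQ
      -- Here `z` has a pole at `Q`. The factor `z ^ n / (1 + z ^ n)` has value `1` at the poles of
      -- `z`, so it does not affect `w` at `P` and `Q`; at the zeros of `z` it has the value of `z ^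
      -- n`, which makes the product small on `s`.
      have hbig : ∀ R : Place k F, 1 < R.ring.valuation z →
          R.ring.valuation (z ^ n / (1 + z ^ n)) = 1 := by
        intro R hR
        have h1 : 1 < R.ring.valuation (z ^ n) := by
          rw [map_pow]; exact one_lt_pow₀ hR (Nat.succ_ne_zero _)
        rw [map_div₀, Valuation.map_add_eq_of_lt_right _ (by rwa [map_one]),
          div_self (zero_lt_one.trans h1).ne']
      refine ⟨z ^ n / (1 + z ^ n) * w, ?_, fun R hR => ?_⟩
      · rwa [map_mul, hbig P hz1, one_mul]
      · rcases Finset.mem_insert.mp hR with rfl | hR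
        · rwa [map_mul, hbig _ hzQ, one_mul]
        · have h1 : R.ring.valuation (1 + z ^ n) = 1 := by
            rw [Valuation.map_add_eq_of_lt_left, map_one]
            rw [map_one, map_pow]
            exact pow_lt_one₀ zero_le (hz2 R hR) (Nat.succ_ne_zero _)
          rw [div_mul_eq_mul_div, map_div₀, h1, div_one]
          exact hn R hR

include hF in
-- There are at most `[F : k(y⁻¹)]` poles. For finitely many of them, weak approximation gives
-- functions `e Q` of value `1` at `Q` and smaller at the other ones; these are independent over `k`
-- modulo `y⁻¹ R`, with `R` the ring of functions regular at the chosen poles.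
theorem finite_poles {y : F} (hy : Transcendental k y) :
    {Q : Place k F | 1 < Q.ring.valuation y}.Finite := by
  classical
  have hut : Transcendental k y⁻¹ := fun h => hy (by simpa using h.inv)
  have hfd := hF.finiteDimensional hut
  by_contra hinf
  obtain ⟨t, ht, hcard⟩ := Set.Infinite.exists_subset_card_eq hinf
    (Module.finrank (IntermediateField.adjoin k {y⁻¹}) F + 1)
  have hex : ∀ Q : t, ∃ e, Q.1.ring.valuation e = 1 ∧
      ∀ R : t, R ≠ Q → R.1.ring.valuation e < 1 := by
    intro Q
    obtain ⟨z, hz1, hz2⟩ := Q.1.exists_one_lt_and_lt_one hF (t.erase Q.1) (Finset.notMem_erase _ _)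
    refine ⟨z / (1 + z), ?_, fun R hR => ?_⟩
    · rw [map_div₀, Valuation.map_add_eq_of_lt_right _ (by rwa [map_one]),
        div_self (zero_lt_one.trans hz1).ne']
    · have hzR := hz2 R.1 (Finset.mem_erase.mpr ⟨fun h => hR (Subtype.ext h), R.2⟩)
      have h1 : R.1.ring.valuation (1 + z) = 1 := by
        rw [Valuation.map_add_eq_of_lt_left, map_one]
        rwa [map_one]
      rwa [map_div₀, h1, div_one]
  choose e he1 he2 using hex
  let R : Subring F := ⨅ Q : t, Q.1.ring.toSubring
  have hR : ∀ x, x ∈ R ↔ ∀ Q : t, Q.1.ring.valuation x ≤ 1 := fun x => by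
    simp only [R, Subring.mem_iInf, ValuationSubring.mem_toSubring,
      ValuationSubring.valuation_le_one_iff]
  have hyinv : ∀ Q : t, Q.1.ring.valuation y⁻¹ < 1 := fun Q => by
    rw [map_inv₀]; exact inv_lt_one_of_one_lt₀ (ht Q.2)
  have hli := IsFunctionFieldOfCurve.linearIndependent_of_mod hut (R := R) (e := e)
    (fun c => (hR _).mpr fun Q => Q.1.valuation_algebraMap_le c)
    ((hR _).mpr fun Q => (hyinv Q).le)
    (fun Q => (hR _).mpr fun Q' => by
      by_cases h : Q' = Q
      · rw [h, he1]
      · exact (he2 Q Q' h).le) (by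
      rintro c ⟨r, hr, hc⟩
      funext j
      by_contra hcj
      rw [← Finset.add_sum_erase _ _ (Finset.mem_univ j), ← eq_sub_iff_add_eq] at hc
      have h1 : j.1.ring.valuation (c j • e j) = 1 := by
        rw [Algebra.smul_def, map_mul, he1, Place.valuation_algebraMap _ hcj, one_mul]
      have h2 : j.1.ring.valuation (y⁻¹ * r - ∑ x ∈ Finset.univ.erase j, c x • e x) < 1 := by
        refine Valuation.map_sub_lt _ ?_ (Valuation.map_sum_lt _ one_ne_zero fun i hi => ?_)
        · rw [map_mul]
          exact mul_lt_one_of_nonneg_of_lt_one_left zero_le (hyinv j) ((hR r).mp hr j)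
        · rw [Algebra.smul_def, map_mul]
          exact mul_lt_one_of_nonneg_of_lt_one_right (Place.valuation_algebraMap_le _ _)
            zero_le (he2 i j (Finset.ne_of_mem_erase hi).symm)
      rw [← hc] at h2
      exact h2.ne h1)
  have := hli.fintype_card_le_finrank
  rw [Fintype.card_coe] at this
  omega

end Place

/-! ### Functions regular away from one place: constants, poles, discreteness, cocompactness. -/

namespace Place

variable {k F : Type*} [Field k] [Field F] [Algebra k F] (P : Place k F)

/-- At a pole of `y` the value of a nonzero polynomial in `y` depends only on its degree, and the
remainder has the smaller degree. -/
theorem valuation_mod_div_le {y : F} (hy : 1 < P.ring.valuation y) (p q : Polynomial k) :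
    P.ring.valuation (Polynomial.aeval y (p % q) / Polynomial.aeval y q) ≤ 1 := by
  by_cases hq : q = 0
  · rw [hq, map_zero, div_zero, map_zero]; exact zero_le
  by_cases hm : p % q = 0
  · rw [hm, map_zero, zero_div, map_zero]; exact zero_le
  have hy0 := zero_lt_one.trans hy
  rw [map_div₀, P.valuation_aeval_of_one_lt hy hq, P.valuation_aeval_of_one_lt hy hm,
    div_le_one₀ (pow_pos hy0 _)]
  refine pow_le_pow_right₀ hy.le (Polynomial.natDegree_le_natDegree ?_)
  exact (EuclideanDomain.mod_lt p hq).le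

theorem valuation_le_of_isIntegral {y f : F} (hy : P.ring.valuation y ≤ 1)
    (hf : IsIntegral (Algebra.adjoin k {y}) f) : P.ring.valuation f ≤ 1 := by
  rw [ValuationSubring.valuation_le_one_iff] at *
  have hle : ∀ x ∈ Algebra.adjoin k {y}, x ∈ P.ring := fun x hx => by
    rw [Algebra.adjoin_singleton_eq_range_aeval] at hx
    obtain ⟨p, rfl⟩ := hx
    rw [← ValuationSubring.valuation_le_one_iff]
    exact P.valuation_aeval_le ((P.ring.valuation_le_one_iff _).mpr hy) p
  let i : Algebra.adjoin k {y} →+* P.ring :=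
    ((Algebra.adjoin k {y}).val.toRingHom).codRestrict P.ring fun x => hle x x.2
  have h2 : IsIntegral P.ring f := by
    obtain ⟨p, hp, hpf⟩ := hf
    refine ⟨p.map i, hp.map i, ?_⟩
    rw [Polynomial.eval₂_map]
    exact hpf
  obtain ⟨g, hg⟩ := (IsIntegrallyClosed.isIntegral_iff (R := P.ring)).mp h2
  rw [← hg]
  exact g.2

variable (hF : IsFunctionFieldOfCurve k F)

include hF in
-- Scale a basis of `F` over `k(y)` to be integral over `k[y]`, and split each coefficient into a
-- polynomial and a proper fraction. This writes `f` as a function regular wherever `y` is, plus one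
-- whose size at the poles of `y` is bounded in terms of the basis alone. It replaces the theorem of
-- Riemann and Roch.
theorem exists_integral_basis {y : F} (hy : Transcendental k y) :
    ∃ (n : ℕ) (b : Fin n → F), (∀ (Q : Place k F) (i), Q.ring.valuation y ≤ 1 →
      Q.ring.valuation (b i) ≤ 1) ∧
      ∀ f : F, ∃ (p : Fin n → Polynomial k) (s : Fin n → F),
        f = ∑ i, Polynomial.aeval y (p i) * b i + ∑ i, s i * b i ∧
        ∀ (Q : Place k F) (i), 1 < Q.ring.valuation y → Q.ring.valuation (s i) ≤ 1 := by
  classical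
  have hfd := hF.finiteDimensional hy
  let L := IntermediateField.adjoin k {y}
  let b0 := Module.finBasis L F
  open scoped IntermediateField.algebraAdjoinAdjoin in
  have halg : ∀ f : F, IsAlgebraic (Algebra.adjoin k {y}) f := fun f =>
    (IsFractionRing.isAlgebraic_iff (Algebra.adjoin k {y}) L F).mpr
      (Algebra.IsAlgebraic.isAlgebraic f)
  choose d hd0 hd using fun i => (halg (b0 i)).exists_integral_multiple
  refine ⟨_, fun i => d i • b0 i, fun Q i hQ => Q.valuation_le_of_isIntegral hQ (hd i),
    fun f => ?_⟩
  have hex : ∀ i, ∃ p q : Polynomial k, (b0.repr f i : F) / (d i : F) =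
      Polynomial.aeval y p / Polynomial.aeval y q := fun i => by
    have h1 : (b0.repr f i : F) / (d i : F) ∈ L :=
      div_mem (b0.repr f i).2 (IntermediateField.algebra_adjoin_le_adjoin k {y} (d i).2)
    exact (IntermediateField.mem_adjoin_simple_iff k _).mp h1
  choose p q hpq using hex
  have hdF : ∀ i, (d i : F) ≠ 0 := fun i h => hd0 i (Subtype.ext h)
  -- If `q i = 0`, the coefficient is zero by the convention for division by zero, and so are both
  -- of its parts.
  refine ⟨fun i => if q i = 0 then 0 else p i / q i,
    fun i => Polynomial.aeval y (p i % q i) / Polynomial.aeval y (q i), ?_,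
    fun Q i hQ => Q.valuation_mod_div_le hQ _ _⟩
  rw [← Finset.sum_add_distrib]
  conv_lhs => rw [← b0.sum_repr f]
  refine Finset.sum_congr rfl fun i _ => ?_
  have h1 : (b0.repr f i : F) =
      (Polynomial.aeval y (p i) / Polynomial.aeval y (q i)) * (d i : F) := by
    rw [← hpq, div_mul_cancel₀ _ (hdF i)]
  have h2 : b0.repr f i • b0 i = (b0.repr f i : F) * b0 i := rfl
  have h3 : d i • b0 i = (d i : F) * b0 i := rfl
  simp only [h2, h3]
  rw [h1]
  by_cases hq : q i = 0
  · simp [hq]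
  have hq' : Polynomial.aeval y (q i) ≠ 0 := fun h =>
    hq (by_contra fun h0 => hy ⟨q i, h0, h⟩)
  rw [if_neg hq]
  conv_lhs => rw [← EuclideanDomain.div_add_mod (p i) (q i)]
  rw [map_add, map_mul]
  field_simp

variable [Finite k]

include hF in
theorem exists_finite_residues_of_le (c : F) :
    ∃ s : Set F, s.Finite ∧ ∀ x, P.ring.valuation x ≤ P.ring.valuation c →
      ∃ y ∈ s, P.ring.valuation (x - y) ≤ 1 := by
  by_cases hc : P.ring.valuation c ≤ 1
  · exact ⟨{0}, Set.finite_singleton _, fun x hx => ⟨0, rfl, by rw [sub_zero]; exact hx.trans hc⟩⟩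
  rw [not_le] at hc
  have hc0 : c ≠ 0 := by rintro rfl; simp at hc
  have hvc : 0 < P.ring.valuation c := zero_lt_one.trans hc
  obtain ⟨s, hs, hsx⟩ := P.exists_finite_residues hF (inv_ne_zero hc0) (by
    rw [map_inv₀]; exact inv_lt_one_of_one_lt₀ hc)
  refine ⟨(fun y => c * y) '' s, hs.image _, fun x hx => ?_⟩
  obtain ⟨y, hy, hxy⟩ := hsx (x / c) (by rw [map_div₀, div_le_one₀ hvc]; exact hx)
  refine ⟨_, ⟨y, hy, rfl⟩, ?_⟩
  have h1 : x - c * y = c * (x / c - y) := by field_simp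
  rw [h1, map_mul]
  rw [map_inv₀] at hxy
  calc _ ≤ P.ring.valuation c * (P.ring.valuation c)⁻¹ := by gcongr
    _ = 1 := mul_inv_cancel₀ hvc.ne'

omit [Finite k] in
theorem exists_valuation_ge {n : ℕ} (b : Fin n → F) :
    ∃ c : F, 1 ≤ P.ring.valuation c ∧ ∀ i, P.ring.valuation (b i) ≤ P.ring.valuation c := by
  obtain ⟨c, hc⟩ := P.ring.valuation_surjective
    ((Finset.univ.sup' ⟨none, Finset.mem_univ _⟩ fun i : Option (Fin n) =>
      i.elim 1 fun i => P.ring.valuation (b i)))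
  refine ⟨c, ?_, fun i => ?_⟩ <;> rw [hc]
  · exact Finset.le_sup' (fun i : Option (Fin n) => i.elim 1 fun i => P.ring.valuation (b i))
      (Finset.mem_univ none)
  · exact Finset.le_sup' (fun i : Option (Fin n) => i.elim 1 fun i => P.ring.valuation (b i))
      (Finset.mem_univ (some i))

omit [Finite k] in
theorem valuation_sum_mul_le {n : ℕ} {s b : Fin n → F} {c : F}
    (hs : ∀ i, P.ring.valuation (s i) ≤ 1)
    (hb : ∀ i, P.ring.valuation (b i) ≤ P.ring.valuation c) :
    P.ring.valuation (∑ i, s i * b i) ≤ P.ring.valuation c := by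
  refine Valuation.map_sum_le _ fun i _ => ?_
  rw [map_mul]
  exact (mul_le_of_le_one_left' (hs i)).trans (hb i)

include hF in
/-- There is a function whose only pole is `P`. -/
theorem exists_pole : ∃ x, 1 < P.ring.valuation x ∧
    ∀ Q : Place k F, Q ≠ P → Q.ring.valuation x ≤ 1 := by
  classical
  obtain ⟨y, hy⟩ : ∃ y, 1 < P.ring.valuation y := by
    obtain ⟨y, hy, -⟩ := P.exists_one_lt_and_lt_one hF ∅ (Finset.notMem_empty _)
    exact ⟨y, hy⟩
  have hyt := P.transcendental_of_one_lt hF hy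
  have hS := finite_poles hF hyt
  let S := hS.toFinset.erase P
  have hSm : ∀ Q : Place k F, Q ∈ S ↔ Q ≠ P ∧ 1 < Q.ring.valuation y := fun Q => by
    simp [S]
  obtain ⟨z, hz1, hz2⟩ := P.exists_one_lt_and_lt_one hF S (Finset.notMem_erase _ _)
  obtain ⟨n, b, hb, hdec⟩ := exists_integral_basis hF hyt
  choose p s hps hs using fun N : ℕ => hdec (z ^ N)
  -- The function `z` has a pole at `P` and zeros at the other poles of `y`. The polynomial part `a
  -- N` of `z ^ N` is regular where `y` is, is bounded independently of `N` at the other poles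
  -- except `P`, and for large `N` has at `P` the same value as `z ^ N`. By the pigeonhole principle
  -- two of the `a N` agree modulo regular functions at all those other poles; their difference has
  -- its only pole at `P`.
  let a : ℕ → F := fun N => ∑ i, Polynomial.aeval y (p N i) * b i
  choose c hc1 hc using fun Q : Place k F => Q.exists_valuation_ge b
  have ha : ∀ N, a N = z ^ N - ∑ i, s N i * b i := fun N => eq_sub_of_add_eq (hps N).symm
  have hr : ∀ (Q : Place k F) N, 1 < Q.ring.valuation y →
      Q.ring.valuation (∑ i, s N i * b i) ≤ Q.ring.valuation (c Q) := fun Q N hQ =>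
    Q.valuation_sum_mul_le (fun i => hs N Q i hQ) (hc Q)
  have ha1 : ∀ (Q : Place k F) N, Q.ring.valuation y ≤ 1 → Q.ring.valuation (a N) ≤ 1 := by
    intro Q N hQ
    refine Valuation.map_sum_le _ fun i _ => ?_
    rw [map_mul]
    exact mul_le_one' (Q.valuation_aeval_le hQ _) (hb Q i hQ)
  have ha2 : ∀ Q ∈ S, ∀ N, Q.ring.valuation (a N) ≤ Q.ring.valuation (c Q) := by
    intro Q hQ N
    rw [ha]
    refine Valuation.map_sub_le _ ?_ (hr Q N ((hSm Q).mp hQ).2)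
    rw [map_pow]
    exact (pow_le_one₀ zero_le (hz2 Q hQ).le).trans (hc1 Q)
  obtain ⟨N0, hN0⟩ := P.exists_pow_mul_lt hF (z := z⁻¹) (by
    rw [map_inv₀]; exact inv_lt_one_of_one_lt₀ hz1) (c P)
  have hz0 : z ≠ 0 := by rintro rfl; simp at hz1
  have ha3 : ∀ N, N0 ≤ N → P.ring.valuation (a N) = P.ring.valuation z ^ N := by
    intro N hN
    rw [ha, Valuation.map_sub_eq_of_lt_left, map_pow]
    refine (hr P N hy).trans_lt ?_
    have := hN0 N hN
    rwa [map_mul, inv_pow, map_inv₀, inv_mul_lt_one₀ (by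
      rw [map_pow]; exact pow_pos (zero_lt_one.trans hz1) _)] at this
  choose t ht htx using fun Q : Place k F => Q.exists_finite_residues_of_le hF (c Q)
  have hex : ∀ (N : ℕ) (Q : S), ∃ w : t Q.1, Q.1.ring.valuation (a N - w) ≤ 1 := fun N Q => by
    obtain ⟨w, hw, hw2⟩ := htx Q.1 _ (ha2 Q.1 Q.2 N)
    exact ⟨⟨w, hw⟩, hw2⟩
  choose w hw using hex
  have : ∀ Q : S, Finite (t Q.1) := fun Q => (ht Q.1).to_subtype
  obtain ⟨m, m', hmm, heq⟩ := Finite.exists_ne_map_eq_of_infinite fun N : ℕ => w (N0 + N)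
  wlog hlt : m < m' generalizing m m'
  · exact this m' m hmm.symm heq.symm (by omega)
  refine ⟨a (N0 + m') - a (N0 + m), ?_, fun Q hQ => ?_⟩
  · rw [Valuation.map_sub_eq_of_lt_left, ha3 _ (by omega)]
    · exact one_lt_pow₀ hz1 (by omega)
    · rw [ha3 _ (by omega), ha3 _ (by omega)]
      exact pow_lt_pow_right₀ hz1 (by omega)
  · by_cases hQy : Q.ring.valuation y ≤ 1
    · exact Valuation.map_sub_le _ (ha1 Q _ hQy) (ha1 Q _ hQy)
    · have hQS : Q ∈ S := (hSm Q).mpr ⟨hQ, not_le.mp hQy⟩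
      have h1 := hw (N0 + m) ⟨Q, hQS⟩
      have h2 := hw (N0 + m') ⟨Q, hQS⟩
      have heq2 : w (N0 + m) = w (N0 + m') := heq
      rw [← heq2] at h2
      have := Valuation.map_sub_le _ h2 h1
      rwa [sub_sub_sub_cancel_right] at this

omit [Finite k] in
theorem mem_regularAway {x : F} :
    x ∈ P.regularAway ↔ ∀ Q : Place k F, Q ≠ P → Q.ring.valuation x ≤ 1 := by
  simp only [regularAway, Subring.mem_iInf, ValuationSubring.mem_toSubring,
    ValuationSubring.valuation_le_one_iff, Subtype.forall]

include hF in
omit [Finite k] in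
/-- A function regular everywhere is constant. -/
theorem mem_range_of_forall_le {x : F} (hx : ∀ Q : Place k F, Q.ring.valuation x ≤ 1) :
    x ∈ Set.range (algebraMap k F) := by
  refine hF.constants x ?_
  -- The valuation rings that contain the constants intersect in the integral closure of the
  -- constants.
  have h1 : x ∈ (integralClosure (Subring.closure (Set.range (algebraMap k F))) F).toSubring := by
    rw [← iInf_valuationSubring_superset, Subring.mem_iInf]
    rintro ⟨V, hV⟩
    by_cases hVt : V = ⊤
    · subst hVt; exact trivial
    · exact ((⟨V, fun c => hV ⟨c, rfl⟩, hVt⟩ : Place k F).ring.valuation_le_one_iff _).mp (hx _)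
  have h2 : IsIntegral (Subring.closure (Set.range (algebraMap k F))) x := h1
  have hcl : Subring.closure (Set.range (algebraMap k F)) = (algebraMap k F).range := by
    rw [← RingHom.coe_range, Subring.closure_eq]
  rw [hcl] at h2
  obtain ⟨p, hp, hpx⟩ := h2
  have hsurj : Function.Surjective (algebraMap k F).rangeRestrict :=
    (algebraMap k F).rangeRestrict_surjective
  have hbij : Function.Bijective (algebraMap k F).rangeRestrict :=
    ⟨RingHom.injective _, hsurj⟩
  obtain ⟨q, rfl⟩ := Polynomial.map_surjective _ hsurj p
  refine IsIntegral.isAlgebraic (R := k) ⟨q, ?_, ?_⟩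
  · exact Polynomial.monic_of_injective hbij.1 hp
  · rw [Polynomial.eval₂_map] at hpx
    exact hpx

include hF in
omit [Finite k] in
theorem mem_range_of_mem_regularAway {x : F} (hx : x ∈ P.regularAway)
    (hxP : P.ring.valuation x ≤ 1) : x ∈ Set.range (algebraMap k F) :=
  mem_range_of_forall_le hF fun Q => by
    by_cases h : Q = P
    · rw [h]; exact hxP
    · exact P.mem_regularAway.mp hx Q h

include hF in
omit [Finite k] in
-- Discreteness of `A`: nonzero elements have value at least `1` at `P`, because those of value at
-- most `1` are constants.
theorem eq_zero_of_mem_regularAway {x : F} (hx : x ∈ P.regularAway)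
    (hxP : P.ring.valuation x < 1) : x = 0 := by
  obtain ⟨c, rfl⟩ := P.mem_range_of_mem_regularAway hF hx hxP.le
  by_contra h
  exact hxP.ne (P.valuation_algebraMap (by rintro rfl; exact h (map_zero _)))

include hF in
/-- Every function is the sum of a function regular away from `P` and a function whose pole
at `P` is bounded. -/
theorem exists_sub_le : ∃ c : F, ∀ f : F, ∃ a ∈ P.regularAway,
    P.ring.valuation (f - a) ≤ P.ring.valuation c := by
  obtain ⟨x, hx1, hx2⟩ := P.exists_pole hF
  obtain ⟨n, b, hb, hdec⟩ := exists_integral_basis hF (P.transcendental_of_one_lt hF hx1)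
  obtain ⟨c, -, hc⟩ := P.exists_valuation_ge b
  refine ⟨c, fun f => ?_⟩
  obtain ⟨p, s, hf, hs⟩ := hdec f
  -- Since `P` is the only pole of `x`, the part of `f` that is polynomial in `x` is regular away
  -- from `P`, and the remaining part is bounded at `P`.
  refine ⟨∑ i, Polynomial.aeval x (p i) * b i, P.mem_regularAway.mpr fun Q hQ => ?_, ?_⟩
  · refine Valuation.map_sum_le _ fun i _ => ?_
    rw [map_mul]
    exact mul_le_one' (Q.valuation_aeval_le (hx2 Q hQ) _) (hb Q i (hx2 Q hQ))
  · rw [hf, add_sub_cancel_left]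
    exact P.valuation_sum_mul_le (fun i => hs P i hx1) hc

include hF in
-- For `x` with `P` as its only pole, `k[x]` lies in `A`, and some nonzero multiple of `f` by an
-- element of `k[x]` is integral over `k[x]`.
theorem exists_mul_mem_regularAway (f : F) : ∃ a ∈ P.regularAway, a ≠ 0 ∧ a * f ∈ P.regularAway := by
  obtain ⟨x, hx1, hx2⟩ := P.exists_pole hF
  have hxt := P.transcendental_of_one_lt hF hx1
  have hfd := hF.finiteDimensional hxt
  open scoped IntermediateField.algebraAdjoinAdjoin in
  have halg : IsAlgebraic (Algebra.adjoin k {x}) f :=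
    (IsFractionRing.isAlgebraic_iff (Algebra.adjoin k {x}) (IntermediateField.adjoin k {x}) F).mpr
      (Algebra.IsAlgebraic.isAlgebraic f)
  obtain ⟨d, hd0, hd⟩ := halg.exists_integral_multiple
  refine ⟨d, P.mem_regularAway.mpr fun Q hQ => ?_, fun h => hd0 (Subtype.ext h),
    P.mem_regularAway.mpr fun Q hQ => Q.valuation_le_of_isIntegral (hx2 Q hQ) hd⟩
  exact Q.valuation_le_of_isIntegral (hx2 Q hQ) (isIntegral_algebraMap (x := d))

omit [Finite k] in
theorem mem_regularAway_of_isIntegral {f : F} (hf : IsIntegral P.regularAway f) :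
    f ∈ P.regularAway := by
  refine P.mem_regularAway.mpr fun Q hQ => ?_
  rw [ValuationSubring.valuation_le_one_iff]
  let i : P.regularAway →+* Q.ring := P.regularAway.subtype.codRestrict Q.ring fun x =>
    (Q.ring.valuation_le_one_iff _).mp (P.mem_regularAway.mp x.2 Q hQ)
  have h2 : IsIntegral Q.ring f := by
    obtain ⟨p, hp, hpf⟩ := hf
    refine ⟨p.map i, hp.map i, ?_⟩
    rw [Polynomial.eval₂_map]
    exact hpf
  obtain ⟨g, hg⟩ := (IsIntegrallyClosed.isIntegral_iff (R := Q.ring)).mp h2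
  rw [← hg]
  exact g.2

include hF in
/-- Functions regular away from `P` with bounded pole at `P` are finite in number. -/
theorem finite_regularAway_le (c : F) :
    {x | x ∈ P.regularAway ∧ P.ring.valuation x ≤ P.ring.valuation c}.Finite := by
  obtain ⟨s, hs, hsx⟩ := P.exists_finite_residues_of_le hF c
  have hk : (Set.range (algebraMap k F)).Finite := Set.finite_range _
  -- Two such functions in the same class modulo the ring of `P` differ by a function without poles,
  -- that is, by one of finitely many constants.
  choose! g hg1 hg2 using hsx
  refine Set.Finite.of_finite_fibers (f := g) ?_ ?_
  · exact hs.subset (by rintro _ ⟨x, hx, rfl⟩; exact hg1 x hx.2)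
  · rintro y -
    by_cases hne : ∃ x0, (x0 ∈ P.regularAway ∧ P.ring.valuation x0 ≤ P.ring.valuation c) ∧ g x0 = y
    · obtain ⟨x0, hx0, rfl⟩ := hne
      refine (hk.image fun z => z + x0).subset ?_
      rintro x ⟨hx, hxy⟩
      refine ⟨x - x0, P.mem_range_of_mem_regularAway hF (sub_mem hx.1 hx0.1) ?_,
        sub_add_cancel _ _⟩
      have h1 := hg2 x hx.2
      have h2 := hg2 x0 hx0.2
      rw [hxy] at h1
      have := Valuation.map_sub_le _ h1 h2
      rwa [sub_sub_sub_cancel_right] at this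
    · convert Set.finite_empty
      ext x
      simp only [Set.mem_inter_iff, Set.mem_ofPred_eq, Set.mem_preimage, Set.mem_singleton_iff, Set.mem_empty_iff_false, iff_false, not_and]
      exact fun h1 h2 => hne ⟨x, h1, h2⟩

end Place

/-! ## Lattices over a discrete valuation ring -/

namespace BruhatTits

variable {K : Type*} [Field K] (O : ValuationSubring K)

theorem coe_inv_fin_two (g : GL (Fin 2) K) :
    (g⁻¹).1 = g.1.det⁻¹ • !![g.1 1 1, -g.1 0 1; -g.1 1 0, g.1 0 0] := by
  rw [Matrix.coe_units_inv, Matrix.inv_def, Matrix.adjugate_fin_two, Ring.inverse_eq_inv']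

/-- The group `GL₂(O)` inside `GL₂(K)`. -/
def integralGL : Subgroup (GL (Fin 2) K) where
  carrier := {g | (∀ i j, g.1 i j ∈ O) ∧ ∀ i j, (g⁻¹).1 i j ∈ O}
  one_mem' := by
    have : ∀ i j, (1 : Matrix (Fin 2) (Fin 2) K) i j ∈ O := fun i j => by
      rw [Matrix.one_apply]; split_ifs
      · exact O.one_mem
      · exact O.zero_mem
    exact ⟨this, by rwa [inv_one]⟩
  mul_mem' := by
    have key : ∀ g h : Matrix (Fin 2) (Fin 2) K, (∀ i j, g i j ∈ O) → (∀ i j, h i j ∈ O) →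
        ∀ i j, (g * h) i j ∈ O := fun g h hg hh i j => by
      rw [Matrix.mul_apply]
      exact sum_mem fun l _ => mul_mem (hg i l) (hh l j)
    rintro g h ⟨hg1, hg2⟩ ⟨hh1, hh2⟩
    refine ⟨key _ _ hg1 hh1, ?_⟩
    rw [mul_inv_rev]
    exact key _ _ hh2 hg2
  inv_mem' := by
    rintro g ⟨hg1, hg2⟩
    exact ⟨hg2, by rwa [inv_inv]⟩

theorem mem_integralGL_iff {g : GL (Fin 2) K} :
    g ∈ integralGL O ↔ (∀ i j, g.1 i j ∈ O) ∧ O.valuation g.1.det = 1 := by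
  have hdet : ∀ h : Matrix (Fin 2) (Fin 2) K, (∀ i j, h i j ∈ O) → h.det ∈ O := fun h hh => by
    rw [Matrix.det_fin_two]
    exact sub_mem (mul_mem (hh _ _) (hh _ _)) (mul_mem (hh _ _) (hh _ _))
  constructor
  · rintro ⟨h1, h2⟩
    refine ⟨h1, le_antisymm ((O.valuation_le_one_iff _).mpr (hdet _ h1)) ?_⟩
    have h3 := (O.valuation_le_one_iff _).mpr (hdet _ h2)
    have h4 : g.1.det * (g⁻¹).1.det = 1 := by
      rw [← Matrix.det_mul, ← Units.val_mul, mul_inv_cancel, Units.val_one, Matrix.det_one]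
    have h5 := congrArg O.valuation h4
    rw [map_mul, map_one] at h5
    rw [← h5]
    exact mul_le_of_le_one_right' h3
  · rintro ⟨h1, h2⟩
    refine ⟨h1, fun i j => ?_⟩
    have hd : g.1.det⁻¹ ∈ O := by
      rw [← ValuationSubring.valuation_le_one_iff, map_inv₀, h2, inv_one]
    rw [coe_inv_fin_two, Matrix.smul_apply, smul_eq_mul]
    refine mul_mem hd ?_
    fin_cases i <;> fin_cases j <;> simp [h1]

/-- The Iwahori subgroup: integral matrices that are upper triangular modulo the maximal ideal. -/
def iwahori : Subgroup (GL (Fin 2) K) where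
  carrier := {g | g ∈ integralGL O ∧ O.valuation (g.1 1 0) < 1}
  one_mem' := ⟨one_mem _, by simp⟩
  mul_mem' := by
    rintro g h ⟨hg1, hg2⟩ ⟨hh1, hh2⟩
    refine ⟨mul_mem hg1 hh1, ?_⟩
    rw [Units.val_mul, Matrix.mul_apply, Fin.sum_univ_two]
    refine Valuation.map_add_lt _ ?_ ?_ <;> rw [map_mul]
    · exact mul_lt_one_of_nonneg_of_lt_one_left zero_le hg2
        ((O.valuation_le_one_iff _).mpr (hh1.1 _ _))
    · exact mul_lt_one_of_nonneg_of_lt_one_right ((O.valuation_le_one_iff _).mpr (hg1.1 _ _))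
        zero_le hh2
  inv_mem' := by
    rintro g ⟨hg1, hg2⟩
    refine ⟨inv_mem hg1, ?_⟩
    rw [coe_inv_fin_two, Matrix.smul_apply, smul_eq_mul, map_mul, map_inv₀,
      ((mem_integralGL_iff O).mp hg1).2]
    simpa using hg2

theorem mem_iwahori_iff {g : GL (Fin 2) K} :
    g ∈ iwahori O ↔ g ∈ integralGL O ∧ O.valuation (g.1 1 0) < 1 := Iff.rfl

/-- The scalar matrices. -/
abbrev scalarGL (c : Kˣ) : GL (Fin 2) K := Matrix.GeneralLinearGroup.scalar (Fin 2) c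

theorem scalarGL_mulVec (c : Kˣ) (x : Fin 2 → K) :
    Matrix.mulVec (scalarGL c).1 x = (c : K) • x := by
  rw [Matrix.GeneralLinearGroup.coe_scalar, Matrix.scalar_apply, ← Matrix.smul_one_eq_diagonal,
    Matrix.smul_mulVec, Matrix.one_mulVec]

theorem det_scalarGL_mul (c : Kˣ) (g : GL (Fin 2) K) :
    (scalarGL c * g).1.det = (c : K) ^ 2 * g.1.det := by
  rw [Units.val_mul, Matrix.det_mul]
  congr 1
  rw [Matrix.GeneralLinearGroup.coe_scalar, Matrix.scalar_apply, Matrix.det_diagonal,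
    Fin.prod_univ_two, sq]

theorem scalarGL_mul_apply (c : Kˣ) (g : GL (Fin 2) K) (i j : Fin 2) :
    (scalarGL c * g).1 i j = c * g.1 i j := by
  rw [Units.val_mul, Matrix.GeneralLinearGroup.coe_scalar, Matrix.scalar_apply,
    Matrix.diagonal_mul]

/-- The standard lattice `O²`. -/
def stdLattice : Lattice O :=
  ⟨{ carrier := {x | ∀ i, x i ∈ O}
     zero_mem' := fun _ => O.zero_mem
     add_mem' := fun ha hb i => add_mem (ha i) (hb i)
     smul_mem' := fun c x hx i => mul_mem c.2 (hx i) }, by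
    constructor
    · classical
      refine ⟨Finset.univ.image fun i => Pi.single i 1, le_antisymm (Submodule.span_le.mpr ?_) ?_⟩
      · intro x hx j
        simp only [Finset.coe_image, Finset.coe_univ, Set.image_univ, Set.mem_range] at hx
        obtain ⟨i, rfl⟩ := hx
        rw [Pi.single_apply]; split_ifs
        · exact O.one_mem
        · exact O.zero_mem
      · intro x hx
        have h1 : x = ∑ i, (⟨x i, hx i⟩ : O) • Pi.single (M := fun _ => K) i 1 := by
          ext j
          simp [Pi.single_apply, Algebra.smul_def]
        rw [h1]
        exact Submodule.sum_mem _ fun i _ => Submodule.smul_mem _ _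
          (Submodule.subset_span (by simp))
    · rw [eq_top_iff]
      intro x _
      have h1 : x = ∑ i, x i • Pi.single (M := fun _ => K) i 1 := by
        ext j
        simp [Pi.single_apply]
      rw [h1]
      refine Submodule.sum_mem _ fun i _ => Submodule.smul_mem _ _ (Submodule.subset_span ?_)
      intro j
      rw [Pi.single_apply]; split_ifs
      · exact O.one_mem
      · exact O.zero_mem⟩

theorem mem_smul_stdLattice {g : GL (Fin 2) K} {x : Fin 2 → K} :
    x ∈ (g • stdLattice O).1 ↔ ∀ i, Matrix.mulVec (g⁻¹).1 x i ∈ O :=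
  mem_smul O g _ x

theorem smul_stdLattice_le_iff {g : GL (Fin 2) K} :
    (g • stdLattice O).1 ≤ (stdLattice O).1 ↔ ∀ i j, g.1 i j ∈ O := by
  constructor
  · intro h i j
    have h1 : Matrix.mulVec g.1 (Pi.single j 1) ∈ (g • stdLattice O).1 := by
      refine Submodule.mem_map_of_mem (f := mulVecO O g) ?_
      intro i
      rw [Pi.single_apply]; split_ifs
      · exact O.one_mem
      · exact O.zero_mem
    have := h h1 i
    rwa [Matrix.mulVec_single_one] at this
  · rintro h _ ⟨x, hx, rfl⟩ i
    change Matrix.mulVec g.1 x i ∈ O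
    rw [Matrix.mulVec, dotProduct]
    exact sum_mem fun j _ => mul_mem (h i j) (hx j)

theorem smul_stdLattice_eq_iff {g : GL (Fin 2) K} :
    g • stdLattice O = stdLattice O ↔ g ∈ integralGL O := by
  constructor
  · intro h
    refine ⟨(smul_stdLattice_le_iff O).mp (by rw [h]), (smul_stdLattice_le_iff O).mp ?_⟩
    rw [inv_smul_eq_iff.mpr h.symm]
  · rintro ⟨h1, h2⟩
    refine Subtype.ext (le_antisymm ((smul_stdLattice_le_iff O).mpr h1) ?_)
    intro x hx
    rw [mem_smul]
    exact ((smul_stdLattice_le_iff O).mpr h2) (Submodule.mem_map_of_mem (f := mulVecO O g⁻¹) hx)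

theorem mk_eq_mk_iff {L M : Lattice O} :
    Vertex.mk O L = Vertex.mk O M ↔ ∃ c : Kˣ, M = scalarGL c • L := by
  refine Quotient.eq.trans ⟨?_, ?_⟩
  · rintro ⟨c, hc, h⟩
    refine ⟨Units.mk0 c hc, Subtype.ext (Submodule.ext fun x => ?_)⟩
    rw [mem_smul, ← h, ← map_inv, scalarGL_mulVec, smul_smul, Units.val_inv_eq_inv_val,
      Units.val_mk0, mul_inv_cancel₀ hc, one_smul]
  · rintro ⟨c, rfl⟩
    refine ⟨c, c.ne_zero, fun x => ?_⟩
    rw [mem_smul, ← map_inv, scalarGL_mulVec, smul_smul, ← Units.val_mul, inv_mul_cancel,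
      Units.val_one, one_smul]

theorem smul_mk_eq_of_scalar (c : Kˣ) (v : Vertex O) : scalarGL c • v = v := by
  induction v using Quotient.inductionOn with
  | _ L => exact ((mk_eq_mk_iff O).mpr ⟨c, rfl⟩).symm

/-- The base vertex of the tree. -/
def baseVertex : Vertex O := Vertex.mk O (stdLattice O)

theorem smul_baseVertex_eq_iff {g : GL (Fin 2) K} :
    g • baseVertex O = baseVertex O ↔ ∃ c : Kˣ, scalarGL c * g ∈ integralGL O := by
  rw [baseVertex, smul_mk, mk_eq_mk_iff]
  refine exists_congr fun c => ?_
  rw [← mul_smul, eq_comm, smul_stdLattice_eq_iff]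

variable {O} {ϖ : K} (hϖ : O.IsUniformizer ϖ)

include hϖ

theorem isPrincipalIdealRing_of_isUniformizer : IsPrincipalIdealRing O := by
  have hϖO : ϖ ∈ O := (O.valuation_le_one_iff _).mp hϖ.lt_one.le
  have hpow : ∀ x : O, x ≠ 0 → ∃ n : ℕ, O.valuation x = O.valuation ϖ ^ n := fun x hx => by
    obtain ⟨n, hn⟩ := hϖ.exists_zpow x (fun h => hx (Subtype.ext h))
    have := O.valuation_le_one x
    rw [hn, ← zpow_zero (O.valuation ϖ), hϖ.zpow_le_zpow_iff] at this
    lift n to ℕ using this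
    exact ⟨n, by rw [hn, zpow_natCast]⟩
  have hdvd : ∀ x y : O, O.valuation x ≤ O.valuation (y : K) → y ∣ x := fun x y h => by
    obtain ⟨a, ha⟩ := (O.valuation_le_iff _ _).mp h
    exact ⟨a, Subtype.ext (by rw [← ha, mul_comm]; rfl)⟩
  refine ⟨fun I => ?_⟩
  by_cases hI : I = ⊥
  · rw [hI]; exact bot_isPrincipal
  obtain ⟨x, hxI, hx0⟩ := Submodule.exists_mem_ne_zero_of_ne_bot hI
  let w : O := ⟨ϖ, hϖO⟩
  have hw : ∀ n : ℕ, O.valuation ((w ^ n : O) : K) = O.valuation ϖ ^ n := fun n => by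
    rw [SubmonoidClass.coe_pow, map_pow]
  have hex : ∃ n, w ^ n ∈ I := by
    obtain ⟨n, hn⟩ := hpow x hx0
    obtain ⟨a, ha⟩ := hdvd (w ^ n) x (by rw [hw, hn])
    exact ⟨n, ha ▸ I.mul_mem_right _ hxI⟩
  classical
  refine ⟨w ^ Nat.find hex, le_antisymm (fun y hy => ?_) ?_⟩
  · by_cases hy0 : y = 0
    · rw [hy0]; exact Submodule.zero_mem _
    obtain ⟨m, hm⟩ := hpow y hy0
    obtain ⟨a, ha⟩ := hdvd (w ^ m) y (by rw [hw, hm])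
    have hle : Nat.find hex ≤ m := Nat.find_min' hex (ha ▸ I.mul_mem_right _ hy)
    refine Ideal.mem_span_singleton.mpr (hdvd _ _ ?_)
    rw [hw, hm]
    exact pow_le_pow_of_le_one zero_le hϖ.lt_one.le hle
  · exact (Ideal.span_singleton_le_iff_mem I).mpr (Nat.find_spec hex)

/-- Over a principal ideal ring the lattice is free, and the columns of `g` are a basis of it. -/
theorem exists_eq_smul_stdLattice (L : Lattice O) : ∃ g : GL (Fin 2) K, L = g • stdLattice O := by
  have := isPrincipalIdealRing_of_isUniformizer hϖ
  have hL : L.1.IsLattice K := L.2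
  have hfree : Module.Free O L.1 := Submodule.IsLattice.free K L.1
  have hfin : Module.Finite O L.1 := Module.Finite.iff_fg.mpr hL.fg
  have hrank : Module.finrank O L.1 = 2 := by
    rw [Submodule.IsLattice.finrank_of_pi K L.1, Fintype.card_fin]
  let b : Module.Basis (Fin 2) O L.1 := Module.finBasisOfFinrankEq O L.1 hrank
  let bK : Module.Basis (Fin 2) K (Fin 2 → K) := b.extendOfIsLattice K
  let e := Pi.basisFun K (Fin 2)
  have hunit : IsUnit (e.toMatrix bK).det := by
    rw [← e.det_apply]
    exact e.isUnit_det bK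
  let g := Matrix.GeneralLinearGroup.mk'' (e.toMatrix bK) hunit
  have hg : ∀ x : Fin 2 → K, Matrix.mulVec g.1 x = ∑ i, x i • (b i : Fin 2 → K) := fun x => by
    ext j
    change Matrix.mulVec (e.toMatrix bK) x j = _
    rw [Matrix.mulVec, dotProduct, Finset.sum_apply]
    refine Finset.sum_congr rfl fun i _ => ?_
    rw [Module.Basis.toMatrix_apply, Pi.smul_apply, smul_eq_mul, mul_comm]
    simp [e, bK]
  refine ⟨g, Subtype.ext (le_antisymm (fun x hx => ?_) ?_)⟩
  · have h1 := b.sum_repr ⟨x, hx⟩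
    refine ⟨fun i => (b.repr ⟨x, hx⟩ i : K), fun i => (b.repr ⟨x, hx⟩ i).2, ?_⟩
    refine (hg fun i => (b.repr ⟨x, hx⟩ i : K)).trans ?_
    have h2 := congrArg Subtype.val h1
    rw [Submodule.coe_sum] at h2
    exact h2
  · rintro _ ⟨x, hx, rfl⟩
    change Matrix.mulVec g.1 x ∈ L.1
    rw [hg]
    exact sum_mem fun i _ => L.1.smul_mem ⟨x i, hx i⟩ (b i).2

omit hϖ

variable (hϖ0 : ϖ ≠ 0)

/-- The diagonal matrix with entries `1` and `ϖ`. -/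
def diagGL : GL (Fin 2) K :=
  Matrix.GeneralLinearGroup.mkOfDetNeZero !![1, 0; 0, ϖ] (by simpa using hϖ0)

theorem coe_diagGL : (diagGL hϖ0).1 = !![1, 0; 0, ϖ] := rfl

variable (K) in
/-- The matrix exchanging the two coordinates. -/
def swapGL : GL (Fin 2) K :=
  Matrix.GeneralLinearGroup.mkOfDetNeZero !![0, 1; 1, 0] (by simp)

variable (K) in
theorem coe_swapGL : (swapGL K).1 = !![0, 1; 1, 0] := rfl

/-- The matrix with rows `(c, 1)` and `(1, 0)`. -/
def flipGL (c : K) : GL (Fin 2) K :=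
  Matrix.GeneralLinearGroup.mkOfDetNeZero !![c, 1; 1, 0] (by simp)

theorem coe_flipGL (c : K) : (flipGL c).1 = !![c, 1; 1, 0] := rfl

theorem swapGL_mem : swapGL K ∈ integralGL O := by
  rw [mem_integralGL_iff]
  refine ⟨fun i j => ?_, ?_⟩
  · rw [coe_swapGL]
    fin_cases i <;> fin_cases j <;> simp [O.zero_mem, O.one_mem]
  · rw [coe_swapGL]; simp

theorem flipGL_mem {c : K} (hc : c ∈ O) : flipGL c ∈ integralGL O := by
  rw [mem_integralGL_iff]
  refine ⟨fun i j => ?_, ?_⟩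
  · rw [coe_flipGL]
    fin_cases i <;> fin_cases j <;> simp [O.zero_mem, O.one_mem, hc]
  · rw [coe_flipGL]; simp

/-- An element of `GL₂(O)` is an Iwahori element, up to left multiplication by one of the
standard representatives. -/
theorem exists_integralGL_eq {s : GL (Fin 2) K} (hs : s ∈ integralGL O) {c : K} (hc : c ∈ O) (hsc : O.valuation (s.1 0 0 - c * s.1 1 0) < 1) :
    (flipGL c)⁻¹ * s ∈ iwahori O := by
  refine ⟨mul_mem (inv_mem (flipGL_mem hc)) hs, ?_⟩
  rw [Units.val_mul, coe_inv_fin_two, coe_flipGL, Matrix.mul_apply, Fin.sum_univ_two]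
  convert hsc using 2
  simp
  ring

end BruhatTits

/-! ## The neighbours of a vertex of the tree -/

namespace BruhatTits

variable {K : Type*} [Field K] {O : ValuationSubring K} {ϖ : K} (hϖ : O.IsUniformizer ϖ)

include hϖ

theorem diag_smul_le_std : (diagGL hϖ.ne_zero • stdLattice O).1 ≤ (stdLattice O).1 := by
  rw [smul_stdLattice_le_iff]
  intro i j
  have hϖO : ϖ ∈ O := (O.valuation_le_one_iff _).mp hϖ.lt_one.le
  rw [coe_diagGL]
  fin_cases i <;> fin_cases j <;> simp [O.zero_mem, O.one_mem, hϖO]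

theorem mem_diag_smul_std {x : Fin 2 → K} :
    x ∈ (diagGL hϖ.ne_zero • stdLattice O).1 ↔ x 0 ∈ O ∧ x 1 / ϖ ∈ O := by
  rw [mem_smul_stdLattice]
  have hx : Matrix.mulVec ((diagGL hϖ.ne_zero)⁻¹).1 x = ![x 0, x 1 / ϖ] := by
    rw [coe_inv_fin_two, coe_diagGL]
    ext i
    fin_cases i <;>
      simp [Matrix.mulVec, dotProduct, Fin.sum_univ_two, Matrix.det_fin_two, hϖ.ne_zero,
        div_eq_inv_mul]
  rw [hx, Fin.forall_fin_two]
  rfl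

theorem div_mem_iff {x : K} : x / ϖ ∈ O ↔ O.valuation x < 1 := by
  rw [← ValuationSubring.valuation_le_one_iff, map_div₀,
    div_le_one₀ (zero_lt_iff.mpr hϖ.ne_zero')]
  by_cases hx : x = 0
  · simp [hx]
  obtain ⟨n, hn⟩ := hϖ.exists_zpow x hx
  have h1 : O.valuation ϖ = O.valuation ϖ ^ (1 : ℤ) := (zpow_one _).symm
  rw [hn, ← zpow_zero (O.valuation ϖ), hϖ.zpow_lt_zpow_iff]
  conv_lhs => rw [h1]
  rw [← zpow_mul, one_mul, hϖ.zpow_le_zpow_iff]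
  omega

theorem mem_diag_smul_std' {x : Fin 2 → K} :
    x ∈ (diagGL hϖ.ne_zero • stdLattice O).1 ↔ x 0 ∈ O ∧ O.valuation (x 1) < 1 := by
  rw [mem_diag_smul_std hϖ, div_mem_iff hϖ]

/-- A vector of `O²` outside the sublattice has a unit as second coordinate, so together with the
sublattice it spans `O²`. -/
theorem diag_smul_covBy_std : (diagGL hϖ.ne_zero • stdLattice O).1 ⋖ (stdLattice O).1 := by
  refine ⟨lt_of_le_of_ne (diag_smul_le_std hϖ) fun h => ?_, fun N hN1 hN2 => ?_⟩
  · have h1 : (![0, 1] : Fin 2 → K) ∈ (stdLattice O).1 := by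
      intro i; fin_cases i
      · exact O.zero_mem
      · exact O.one_mem
    rw [← h, mem_diag_smul_std' hϖ] at h1
    simpa using h1.2
  · obtain ⟨hle, x, hxN, hx⟩ := SetLike.lt_iff_le_and_exists.mp hN1
    refine hN2.not_ge fun y hy => ?_
    have hxs := hN2.le hxN
    have hx1 : O.valuation (x 1) = 1 := by
      refine le_antisymm ((O.valuation_le_one_iff _).mpr (hxs 1)) (not_lt.mp fun h => hx ?_)
      exact (mem_diag_smul_std' hϖ).mpr ⟨hxs 0, h⟩
    have hx0 : x 1 ≠ 0 := fun h => by simp [h] at hx1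
    have hc : y 1 / x 1 ∈ O := by
      rw [← ValuationSubring.valuation_le_one_iff, map_div₀, hx1, div_one]
      exact (O.valuation_le_one_iff _).mpr (hy 1)
    have h1 : y - (⟨y 1 / x 1, hc⟩ : O) • x ∈ N := hle ((mem_diag_smul_std' hϖ).mpr (by
      have h2 : ((⟨y 1 / x 1, hc⟩ : O) • x) = (y 1 / x 1) • x := rfl
      rw [h2]
      refine ⟨sub_mem (hy 0) (mul_mem hc (hxs 0)), ?_⟩
      rw [Pi.sub_apply, Pi.smul_apply, smul_eq_mul, div_mul_cancel₀ _ hx0, sub_self, map_zero]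
      exact zero_lt_one))
    have := N.add_mem h1 (N.smul_mem ⟨y 1 / x 1, hc⟩ hxN)
    rwa [sub_add_cancel] at this

/-- A maximal sublattice of the standard lattice is conjugate to the diagonal one. -/
theorem exists_of_covBy_std {L : Lattice O} (h : L.1 ⋖ (stdLattice O).1) :
    ∃ s ∈ integralGL O, L = (s * diagGL hϖ.ne_zero) • stdLattice O := by
  suffices hs : ∃ s ∈ integralGL O, (s • diagGL hϖ.ne_zero • stdLattice O).1 ≤ L.1 by
    obtain ⟨s, hs, hle⟩ := hs
    refine ⟨s, hs, ?_⟩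
    have hcov := smul_covBy O s (diag_smul_covBy_std hϖ)
    rw [(smul_stdLattice_eq_iff O).mpr hs] at hcov
    rw [mul_smul]
    refine Subtype.ext (le_antisymm (not_lt_iff_le_imp_ge.mp (fun hlt => hcov.2 hlt h.lt) hle) hle)
  obtain ⟨g, rfl⟩ := exists_eq_smul_stdLattice hϖ L
  have hgO := (smul_stdLattice_le_iff O).mp h.le
  by_contra hcon
  -- the sublattice must contain a vector with a unit coordinate
  have key : ∀ x ∈ (g • stdLattice O).1, O.valuation (x 0) < 1 ∧ O.valuation (x 1) < 1 := by
    intro x hx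
    by_contra hx2
    rw [not_and_or, not_lt, not_lt] at hx2
    have hxO := h.le hx
    -- multiples of `ϖ` are contained in the sublattice
    obtain ⟨t, ht, htx⟩ : ∃ t ∈ integralGL O, Matrix.mulVec t.1 ![1, 0] = x := by
      rcases hx2 with hx0 | hx1
      · have h1 : O.valuation (x 0) = 1 :=
          le_antisymm ((O.valuation_le_one_iff _).mpr (hxO 0)) hx0
        have h0 : x 0 ≠ 0 := fun h => by simp [h] at h1
        refine ⟨Matrix.GeneralLinearGroup.mkOfDetNeZero !![x 0, 0; x 1, 1] (by simpa using h0),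
          (mem_integralGL_iff O).mpr ⟨fun i j => ?_, ?_⟩, ?_⟩
        · change (!![x 0, 0; x 1, 1] : Matrix (Fin 2) (Fin 2) K) i j ∈ O
          fin_cases i <;> fin_cases j <;> simp [O.zero_mem, O.one_mem, hxO 0, hxO 1]
        · change O.valuation (!![x 0, 0; x 1, 1] : Matrix (Fin 2) (Fin 2) K).det = 1
          simpa using h1
        · change Matrix.mulVec (!![x 0, 0; x 1, 1] : Matrix (Fin 2) (Fin 2) K) _ = x
          ext i
          fin_cases i <;> simp
      · have h1 : O.valuation (x 1) = 1 :=
          le_antisymm ((O.valuation_le_one_iff _).mpr (hxO 1)) hx1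
        have h0 : x 1 ≠ 0 := fun h => by simp [h] at h1
        refine ⟨Matrix.GeneralLinearGroup.mkOfDetNeZero !![x 0, 1; x 1, 0] (by simpa using h0),
          (mem_integralGL_iff O).mpr ⟨fun i j => ?_, ?_⟩, ?_⟩
        · change (!![x 0, 1; x 1, 0] : Matrix (Fin 2) (Fin 2) K) i j ∈ O
          fin_cases i <;> fin_cases j <;> simp [O.zero_mem, O.one_mem, hxO 0, hxO 1]
        · change O.valuation (!![x 0, 1; x 1, 0] : Matrix (Fin 2) (Fin 2) K).det = 1
          rw [Matrix.det_fin_two]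
          simpa using h1
        · change Matrix.mulVec (!![x 0, 1; x 1, 0] : Matrix (Fin 2) (Fin 2) K) _ = x
          ext i
          fin_cases i <;> simp
    -- after a change of basis, the sublattice contains the first basis vector
    have hcov := smul_covBy O t⁻¹ h
    rw [(smul_stdLattice_eq_iff O).mpr (inv_mem ht)] at hcov
    have he1 : (![1, 0] : Fin 2 → K) ∈ (t⁻¹ • g • stdLattice O).1 := by
      rw [mem_smul, inv_inv, htx]; exact hx
    have hle : (t⁻¹ • g • stdLattice O).1 ≤ (diagGL hϖ.ne_zero • stdLattice O).1 := by
      intro y hy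
      have hyO := hcov.le hy
      refine (mem_diag_smul_std' hϖ).mpr ⟨hyO 0, ?_⟩
      by_contra hy1
      have hy1 : O.valuation (y 1) = 1 :=
        le_antisymm ((O.valuation_le_one_iff _).mpr (hyO 1)) (not_lt.mp hy1)
      have hy0 : y 1 ≠ 0 := fun h => by simp [h] at hy1
      refine hcov.lt.not_ge fun z hz => ?_
      have hc : z 1 / y 1 ∈ O := by
        rw [← ValuationSubring.valuation_le_one_iff, map_div₀, hy1, div_one]
        exact (O.valuation_le_one_iff _).mpr (hz 1)
      have hz2 : z = (⟨z 1 / y 1, hc⟩ : O) • y +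
          (⟨z 0 - z 1 / y 1 * y 0, sub_mem (hz 0) (mul_mem hc (hyO 0))⟩ : O) • ![1, 0] := by
        change z = (z 1 / y 1) • y + (z 0 - z 1 / y 1 * y 0) • ![1, 0]
        ext i
        fin_cases i
        · simp
        · simp [hy0]
      rw [hz2]
      exact Submodule.add_mem _ (Submodule.smul_mem _ _ hy) (Submodule.smul_mem _ _ he1)
    have heq := not_lt_iff_le_imp_ge.mp
      (fun hlt => hcov.2 hlt (diag_smul_covBy_std hϖ).lt) hle
    refine hcon ⟨t, ht, ?_⟩
    rintro _ ⟨y, hy, rfl⟩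
    have := heq hy
    rw [mem_smul, inv_inv] at this
    exact this
  -- If no vector of the sublattice has a unit coordinate, the sublattice is strictly contained in
  -- the diagonal one (which contains the first basis vector), against maximality.
  have hlt2 := (diag_smul_covBy_std hϖ).lt
  refine h.2 (lt_of_le_of_ne (fun x hx => (mem_diag_smul_std' hϖ).mpr
    ⟨h.le hx 0, (key x hx).2⟩) fun heq => ?_) hlt2
  have h1 : (![1, 0] : Fin 2 → K) ∈ (diagGL hϖ.ne_zero • stdLattice O).1 := by
    rw [mem_diag_smul_std' hϖ]
    simp [O.one_mem]
  rw [← heq] at h1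
  simpa using (key _ h1).1

/-- Scalars change the exponent of the determinant by an even number, while that of the diagonal
matrix is one. -/
theorem diag_smul_base_ne : diagGL hϖ.ne_zero • baseVertex O ≠ baseVertex O := by
  intro h
  obtain ⟨c, hc⟩ := (smul_baseVertex_eq_iff O).mp h
  have h1 := ((mem_integralGL_iff O).mp hc).2
  rw [det_scalarGL_mul, coe_diagGL] at h1
  obtain ⟨n, hn⟩ := hϖ.exists_zpow c c.ne_zero
  have h2 : O.valuation ϖ ^ (2 * n + 1) = 1 := by
    rw [zpow_add₀ hϖ.ne_zero', zpow_one, mul_comm 2 n, zpow_mul, ← hn]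
    simpa using h1
  have h3 : O.valuation ϖ ^ (2 * n + 1) = O.valuation ϖ ^ (0 : ℤ) := by rw [h2, zpow_zero]
  have h4 := hϖ.zpow_le_zpow_iff.mp h3.le
  have h5 := hϖ.zpow_le_zpow_iff.mp h3.ge
  omega

/-- The matrix `diagGL * swapGL` reverses the base edge; accordingly its square acts trivially on
the tree. -/
theorem diag_mul_swap_mul_diag_mul_swap :
    diagGL hϖ.ne_zero * swapGL K * diagGL hϖ.ne_zero * swapGL K =
      scalarGL (Units.mk0 ϖ hϖ.ne_zero) := by
  apply Units.ext
  rw [Units.val_mul, Units.val_mul, Units.val_mul, coe_diagGL, coe_swapGL,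
    Matrix.GeneralLinearGroup.coe_scalar]
  ext i j
  fin_cases i <;> fin_cases j <;> simp [Matrix.mul_apply, Fin.sum_univ_two]

omit hϖ in
theorem swap_smul_base : swapGL K • baseVertex O = baseVertex O := by
  rw [baseVertex, smul_mk, (smul_stdLattice_eq_iff O).mpr swapGL_mem]

/-- Adjacency allows the neighbour to be a minimal superlattice as well. Up to homothety this is
again a maximal sublattice, by the identity for `diagGL * swapGL`. -/
theorem base_adj_iff {w : Vertex O} : (tree O).Adj (baseVertex O) w ↔
    ∃ s ∈ integralGL O, w = (s * diagGL hϖ.ne_zero) • baseVertex O := by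
  constructor
  · intro h
    rw [tree, SimpleGraph.fromRel_adj] at h
    rcases h.2 with ⟨L, M, hL, rfl, hLM⟩ | ⟨L, M, rfl, hM, hLM⟩
    · obtain ⟨c, hc⟩ := (mk_eq_mk_iff O).mp hL
      obtain ⟨g, hg⟩ := exists_eq_smul_stdLattice hϖ (scalarGL c • M)
      have h1 := smul_covBy O (g⁻¹ * scalarGL c) hLM
      rw [mul_smul, mul_smul, ← hc, hg, inv_smul_smul] at h1
      obtain ⟨s, hs, hs2⟩ := exists_of_covBy_std hϖ h1
      have ht : g * (s * diagGL hϖ.ne_zero) ∈ integralGL O := by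
        rw [← smul_stdLattice_eq_iff, mul_smul, ← hs2, smul_inv_smul]
      refine ⟨g * (s * diagGL hϖ.ne_zero) * swapGL K, mul_mem ht swapGL_mem, ?_⟩
      have h2 : Vertex.mk O M = g • baseVertex O := by
        rw [baseVertex, smul_mk, ← hg, ← smul_mk, smul_mk_eq_of_scalar]
      rw [h2]
      have h3 : g * (s * diagGL hϖ.ne_zero) * swapGL K * diagGL hϖ.ne_zero =
          g * (s * scalarGL (Units.mk0 ϖ hϖ.ne_zero)) * (swapGL K)⁻¹ := by
        rw [← diag_mul_swap_mul_diag_mul_swap hϖ]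
        group
      rw [h3, mul_smul, inv_smul_eq_iff.mpr swap_smul_base.symm, mul_smul, mul_smul,
        smul_mk_eq_of_scalar]
      congr 1
      rw [baseVertex, smul_mk, (smul_stdLattice_eq_iff O).mpr hs]
    · obtain ⟨c, hc⟩ := (mk_eq_mk_iff O).mp hM
      have h1 := smul_covBy O (scalarGL c) hLM
      rw [← hc] at h1
      obtain ⟨s, hs, hs2⟩ := exists_of_covBy_std hϖ h1
      refine ⟨s, hs, ?_⟩
      rw [baseVertex, smul_mk, ← hs2, ← smul_mk, smul_mk_eq_of_scalar]
  · rintro ⟨s, hs, rfl⟩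
    have hsb : s • baseVertex O = baseVertex O := by
      rw [baseVertex, smul_mk, (smul_stdLattice_eq_iff O).mpr hs]
    rw [mul_smul]
    conv => enter [2]; rw [← hsb]
    refine smul_adj O s ?_
    rw [tree, SimpleGraph.fromRel_adj]
    exact ⟨(diag_smul_base_ne hϖ).symm, Or.inr ⟨_, _, rfl, rfl, diag_smul_covBy_std hϖ⟩⟩

/-- The base edge of the tree. -/
def baseEdge : Edge O :=
  ⟨(baseVertex O, diagGL hϖ.ne_zero • baseVertex O),
    (base_adj_iff hϖ).mpr ⟨1, one_mem _, by rw [one_mul]⟩⟩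

omit hϖ in
theorem fst_smul (g : GL (Fin 2) K) (e : Edge O) : (g • e).fst = g • e.fst := rfl

omit hϖ in
theorem smul_symm (g : GL (Fin 2) K) (e : Edge O) : (g • e).symm = g • e.symm := rfl

omit hϖ in
theorem edge_ext {e e' : Edge O} (h1 : e.fst = e'.fst) (h2 : e.snd = e'.snd) : e = e' :=
  SimpleGraph.Dart.ext _ _ (Prod.ext h1 h2)

theorem fst_eq_base_iff {e : Edge O} :
    e.fst = baseVertex O ↔ ∃ s ∈ integralGL O, e = s • baseEdge hϖ := by
  have hsb : ∀ s ∈ integralGL O, s • baseVertex O = baseVertex O := fun s hs => by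
    rw [baseVertex, smul_mk, (smul_stdLattice_eq_iff O).mpr hs]
  constructor
  · intro h
    have hadj := e.adj
    rw [h] at hadj
    obtain ⟨s, hs, hs2⟩ := (base_adj_iff hϖ).mp hadj
    refine ⟨s, hs, edge_ext ?_ ?_⟩
    · rw [h]; exact (hsb s hs).symm
    · rw [hs2, mul_smul]; rfl
  · rintro ⟨s, hs, rfl⟩
    exact hsb s hs

/-- Conjugation by `diagGL` divides the lower left entry by `ϖ`, so fixing the second vertex forces
this entry into the maximal ideal. The determinant shows that the scalars allowed at the two
vertices differ by a unit. -/
theorem smul_baseEdge_eq_iff {g : GL (Fin 2) K} :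
    g • baseEdge hϖ = baseEdge hϖ ↔ ∃ c : Kˣ, scalarGL c * g ∈ iwahori O := by
  have hconj : ∀ (s : GL (Fin 2) K) (i j : Fin 2),
      ((diagGL hϖ.ne_zero)⁻¹ * s * diagGL hϖ.ne_zero).1 i j =
        !![s.1 0 0, ϖ * s.1 0 1; s.1 1 0 / ϖ, s.1 1 1] i j := fun s i j => by
    rw [Units.val_mul, Units.val_mul, coe_inv_fin_two, coe_diagGL]
    have := hϖ.ne_zero
    generalize s.1 = M
    rw [Matrix.eta_fin_two M]
    fin_cases i <;> fin_cases j <;>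
      simp [Matrix.mul_apply, Fin.sum_univ_two, Matrix.det_fin_two] <;> field_simp
  have hdetc : ∀ s : GL (Fin 2) K,
      ((diagGL hϖ.ne_zero)⁻¹ * s * diagGL hϖ.ne_zero).1.det = s.1.det := fun s => by
    rw [Units.val_mul, Matrix.det_mul, Units.val_mul, Matrix.det_mul, mul_comm, ← mul_assoc,
      ← Matrix.det_mul, ← Units.val_mul, mul_inv_cancel, Units.val_one, Matrix.det_one, one_mul]
  constructor
  · intro h
    obtain ⟨c, hc⟩ := (smul_baseVertex_eq_iff O).mp (congrArg (fun e => e.fst) h)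
    refine ⟨c, hc, ?_⟩
    have h2 : (scalarGL c * g) • diagGL hϖ.ne_zero • baseVertex O =
        diagGL hϖ.ne_zero • baseVertex O := by
      rw [mul_smul, smul_mk_eq_of_scalar]
      exact congrArg (fun e => e.snd) h
    rw [← inv_smul_eq_iff, ← mul_smul, ← mul_smul, ← mul_assoc, mul_assoc _ (scalarGL c),
      smul_baseVertex_eq_iff] at h2
    obtain ⟨b, hb⟩ := h2
    rw [mem_integralGL_iff] at hb hc
    have hd := hb.2
    rw [det_scalarGL_mul, hdetc, map_mul, hc.2, mul_one, map_pow] at hd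
    have hb1 : O.valuation (b : K) = 1 := by
      rcases lt_trichotomy (O.valuation (b : K)) 1 with h | h | h
      · exact absurd hd (pow_lt_one₀ zero_le h two_ne_zero).ne
      · exact h
      · exact absurd hd (one_lt_pow₀ h two_ne_zero).ne'
    have h10 := hb.1 1 0
    rw [scalarGL_mul_apply, hconj, ← ValuationSubring.valuation_le_one_iff, map_mul, hb1,
      one_mul] at h10
    exact (div_mem_iff hϖ).mp ((O.valuation_le_one_iff _).mp h10)
  · rintro ⟨c, hc, hc2⟩
    refine edge_ext ((smul_baseVertex_eq_iff O).mpr ⟨c, hc⟩) ?_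
    change g • diagGL hϖ.ne_zero • baseVertex O = diagGL hϖ.ne_zero • baseVertex O
    rw [← smul_mk_eq_of_scalar O c (g • _), ← mul_smul, ← inv_smul_eq_iff, ← mul_smul, ← mul_smul,
      ← mul_assoc, mul_assoc _ (scalarGL c), smul_baseVertex_eq_iff]
    refine ⟨1, ?_⟩
    have h1 : scalarGL (1 : Kˣ) = 1 := map_one _
    rw [h1, one_mul, mem_integralGL_iff]
    rw [mem_integralGL_iff] at hc
    refine ⟨fun i j => ?_, by rw [hdetc]; exact hc.2⟩
    rw [hconj]
    have hϖO : ϖ ∈ O := (O.valuation_le_one_iff _).mp hϖ.lt_one.le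
    fin_cases i <;> fin_cases j
    · exact hc.1 0 0
    · exact mul_mem hϖO (hc.1 0 1)
    · exact (div_mem_iff hϖ).mpr hc2
    · exact hc.1 1 1

theorem symm_baseEdge : (baseEdge hϖ).symm = (diagGL hϖ.ne_zero * swapGL K) • baseEdge hϖ := by
  refine edge_ext ?_ ?_
  · change diagGL hϖ.ne_zero • baseVertex O = (diagGL hϖ.ne_zero * swapGL K) • baseVertex O
    rw [mul_smul, swap_smul_base]
  · change baseVertex O = (diagGL hϖ.ne_zero * swapGL K) • diagGL hϖ.ne_zero • baseVertex O
    conv_rhs => rw [← swap_smul_base]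
    rw [← mul_smul, ← mul_smul, diag_mul_swap_mul_diag_mul_swap hϖ, smul_mk_eq_of_scalar]

end BruhatTits

/-! ## The action of `GL₂(F)` on the tree of the completion -/

namespace Place

open BruhatTits

variable {k F : Type*} [Field k] [Field F] [Algebra k F] (P : Place k F)

theorem valued_toCompletion (x : F) :
    (Valued.v : Valuation P.Completion P.ring.ValueGroup) (P.toCompletion x) =
      P.ring.valuation x :=
  Valued.valuedCompletion_apply (K := WithVal P.ring.valuation)
    ((WithVal.equiv P.ring.valuation).symm x)

theorem valued_isEquiv :
    (Valued.v : Valuation P.Completion P.ring.ValueGroup).IsEquiv P.integers.valuation :=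
  Valuation.isEquiv_valuation_valuationSubring _

theorem toCompletion_le_iff {x y : F} :
    P.integers.valuation (P.toCompletion x) ≤ P.integers.valuation (P.toCompletion y) ↔
      P.ring.valuation x ≤ P.ring.valuation y := by
  rw [← P.valued_isEquiv.le_iff_le, valued_toCompletion, valued_toCompletion]

theorem toCompletion_lt_iff {x y : F} :
    P.integers.valuation (P.toCompletion x) < P.integers.valuation (P.toCompletion y) ↔
      P.ring.valuation x < P.ring.valuation y := by
  rw [← not_le, ← not_le, toCompletion_le_iff]

theorem toCompletion_lt_one_iff {x : F} :
    P.integers.valuation (P.toCompletion x) < 1 ↔ P.ring.valuation x < 1 := by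
  have := P.toCompletion_lt_iff (x := x) (y := 1)
  rwa [map_one, map_one, map_one] at this

theorem toCompletion_mem_iff {x : F} : P.toCompletion x ∈ P.integers ↔ x ∈ P.ring := by
  rw [← ValuationSubring.valuation_le_one_iff, ← ValuationSubring.valuation_le_one_iff]
  have := P.toCompletion_le_iff (x := x) (y := 1)
  rwa [map_one, map_one, map_one] at this

theorem toCompletion_eq_one_iff {x : F} :
    P.integers.valuation (P.toCompletion x) = 1 ↔ P.ring.valuation x = 1 := by
  rw [eq_iff_le_not_lt, eq_iff_le_not_lt, toCompletion_lt_one_iff,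
    ValuationSubring.valuation_le_one_iff, ValuationSubring.valuation_le_one_iff,
    toCompletion_mem_iff]

/-- The function field is dense in its completion. -/
theorem exists_sub_toCompletion_lt (x : P.Completion) {y : F} (hy : y ≠ 0) :
    ∃ f, P.integers.valuation (x - P.toCompletion f) <
      P.integers.valuation (P.toCompletion y) := by
  let γ : P.ring.ValueGroup := P.ring.valuation y
  have hy0 : P.toCompletion y ≠ 0 := by simpa using hy
  have hopen : IsOpen {z : P.Completion | Valued.v (x - z) < Valued.v (P.toCompletion y)} := by
    have h1 : IsOpen {z : P.Completion | Valued.v z < Valued.v (P.toCompletion y)} := by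
      have := Valued.isOpen_ball P.Completion (Valued.v.restrict (P.toCompletion y))
      simpa only [Valuation.restrict_lt_iff] using this
    exact h1.preimage (continuous_const.sub continuous_id)
  obtain ⟨z, hz⟩ := (UniformSpace.Completion.denseRange_coe
    (α := WithVal P.ring.valuation)).exists_mem_open hopen ⟨x, by
      change Valued.v (x - x) < _
      rw [sub_self, map_zero]
      exact zero_lt_iff.mpr ((map_ne_zero _).mpr hy0)⟩
  refine ⟨WithVal.equiv P.ring.valuation z, ?_⟩
  rw [← P.valued_isEquiv.lt_iff_lt]
  exact hz

/-- The matrices over the function field, as matrices over the completion. -/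
noncomputable abbrev glMap : GL (Fin 2) F →* GL (Fin 2) P.Completion :=
  Matrix.GeneralLinearGroup.map P.toCompletion

theorem glMap_injective : Function.Injective P.glMap := fun g h hgh => by
  refine Matrix.GeneralLinearGroup.ext fun i j => P.toCompletion.injective ?_
  exact congrArg (fun m : GL (Fin 2) P.Completion => m.1 i j) hgh

theorem det_glMap (g : GL (Fin 2) F) : (P.glMap g).1.det = P.toCompletion g.1.det :=
  (RingHom.map_det P.toCompletion g.1).symm

theorem glMap_mem_integralGL_iff {g : GL (Fin 2) F} :
    P.glMap g ∈ integralGL P.integers ↔ g ∈ integralGL P.ring := by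
  rw [mem_integralGL_iff, mem_integralGL_iff, det_glMap, toCompletion_eq_one_iff]
  refine and_congr_left fun _ => forall_congr' fun i => forall_congr' fun j => ?_
  exact P.toCompletion_mem_iff

theorem glMap_mem_iwahori_iff {g : GL (Fin 2) F} :
    P.glMap g ∈ iwahori P.integers ↔ g ∈ iwahori P.ring := by
  rw [mem_iwahori_iff, mem_iwahori_iff, glMap_mem_integralGL_iff]
  exact and_congr_right fun _ => P.toCompletion_lt_one_iff

variable {P} {π : F} (hπ : P.ring.IsUniformizer π)

include hπ

theorem isUniformizer_toCompletion : P.integers.IsUniformizer (P.toCompletion π) := by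
  refine ⟨by simpa using hπ.ne_zero, P.toCompletion_lt_one_iff.mpr hπ.lt_one, fun x hx => ?_⟩
  obtain ⟨r, hr⟩ := Valued.exists_coe_eq_v (K := WithVal P.ring.valuation) x
  set f : F := WithVal.equiv P.ring.valuation r
  have hxf : P.integers.valuation x = P.integers.valuation (P.toCompletion f) := by
    refine (P.valued_isEquiv.eq_iff).mp ?_
    exact hr.trans (P.valued_toCompletion f).symm
  have hf0 : f ≠ 0 := by
    intro h
    rw [h, map_zero, map_zero, map_eq_zero] at hxf
    exact hx hxf
  obtain ⟨n, hn⟩ := hπ.exists_zpow f hf0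
  refine ⟨n, ?_⟩
  rw [hxf, ← map_zpow₀, ← map_zpow₀]
  rw [← map_zpow₀] at hn
  exact le_antisymm (P.toCompletion_le_iff.mpr hn.le) (P.toCompletion_le_iff.mpr hn.ge)

/-- Matrices over the completion can be approximated by matrices over the function field. -/
theorem exists_inv_mul_glMap_mem (g : GL (Fin 2) P.Completion) :
    ∃ h : GL (Fin 2) F, g⁻¹ * P.glMap h ∈ iwahori P.integers := by
  have hϖ := isUniformizer_toCompletion hπ
  obtain ⟨n, hn⟩ : ∃ n : ℤ, ∀ i j,
      P.integers.valuation ((g⁻¹).1 i j) ≤ P.integers.valuation (P.toCompletion π) ^ n := by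
    have h1 : ∀ x : P.Completion, ∃ n : ℤ, ∀ m ≤ n,
        P.integers.valuation x ≤ P.integers.valuation (P.toCompletion π) ^ m := fun x => by
      by_cases hx : x = 0
      · exact ⟨0, fun m _ => by rw [hx, map_zero]; exact zero_le⟩
      · obtain ⟨n, hn⟩ := hϖ.exists_zpow x hx
        exact ⟨n, fun m hm => by rw [hn, hϖ.zpow_le_zpow_iff]; exact hm⟩
    choose N hN using h1
    refine ⟨min (min (N ((g⁻¹).1 0 0)) (N ((g⁻¹).1 0 1)))
      (min (N ((g⁻¹).1 1 0)) (N ((g⁻¹).1 1 1))), fun i j => hN _ _ ?_⟩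
    fin_cases i <;> fin_cases j <;> simp
  -- The entries of `g⁻¹` are bounded by the value of `π ^ n`, so an approximation of `g` with
  -- errors smaller than `π ^ (-n)` makes `g⁻¹ h` congruent to the identity.
  choose f hf using fun i j => P.exists_sub_toCompletion_lt (g.1 i j)
    (y := π ^ (-n)) (zpow_ne_zero _ hπ.ne_zero)
  have hM : ∀ i j, P.integers.valuation
      (((g⁻¹).1 * (Matrix.of f).map P.toCompletion - 1) i j) < 1 := by
    intro i j
    have h1 : (g⁻¹).1 * (Matrix.of f).map P.toCompletion - 1 =
        (g⁻¹).1 * ((Matrix.of f).map P.toCompletion - g.1) := by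
      rw [mul_sub, ← Units.val_mul, inv_mul_cancel, Units.val_one]
    rw [h1, Matrix.mul_apply]
    refine Valuation.map_sum_lt _ one_ne_zero fun l _ => ?_
    have h2 := hf l j
    rw [map_zpow₀, map_zpow₀] at h2
    rw [map_mul, Matrix.sub_apply, Valuation.map_sub_swap]
    have hpos := zpow_pos (zero_lt_iff.mpr hϖ.ne_zero') n
    calc _ ≤ P.integers.valuation (P.toCompletion π) ^ n * _ := mul_le_mul_left (hn i l) _
      _ < P.integers.valuation (P.toCompletion π) ^ n *
          P.integers.valuation (P.toCompletion π) ^ (-n) := by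
        exact (mul_lt_mul_iff_right₀ hpos).mpr h2
      _ = 1 := by rw [← zpow_add₀ hϖ.ne_zero', add_neg_cancel, zpow_zero]
  generalize hMdef : (g⁻¹).1 * (Matrix.of f).map P.toCompletion = M at hM
  have hdet : P.integers.valuation M.det = 1 := by
    have h1 : M.det = 1 + ((M - 1) 0 0 + (M - 1) 1 1 + (M - 1) 0 0 * (M - 1) 1 1 -
        (M - 1) 0 1 * (M - 1) 1 0) := by
      rw [Matrix.det_fin_two]
      simp
      ring
    rw [h1]
    have hmul : ∀ i j i' j', P.integers.valuation ((M - 1) i j * (M - 1) i' j') < 1 :=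
      fun i j i' j' => by
        rw [map_mul]
        exact mul_lt_one_of_nonneg_of_lt_one_left zero_le (hM i j) (hM i' j').le
    exact Valuation.map_one_add_of_lt _ (Valuation.map_sub_lt _ (Valuation.map_add_lt _
      (Valuation.map_add_lt _ (hM 0 0) (hM 1 1)) (hmul 0 0 1 1)) (hmul 0 1 1 0))
  have hf0 : (Matrix.of f).det ≠ 0 := by
    intro h
    have h2 : ((Matrix.of f).map P.toCompletion).det = 0 := by
      have := RingHom.map_det P.toCompletion (Matrix.of f)
      rw [h, map_zero] at this
      exact this.symm
    rw [← hMdef, Matrix.det_mul, h2, mul_zero, map_zero] at hdet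
    exact zero_ne_one hdet
  refine ⟨Matrix.GeneralLinearGroup.mkOfDetNeZero (Matrix.of f) hf0, ?_⟩
  have hval : (g⁻¹ * P.glMap (Matrix.GeneralLinearGroup.mkOfDetNeZero (Matrix.of f) hf0)).1 = M :=
    hMdef
  have hMle : ∀ i j, M i j ∈ P.integers := fun i j => by
    have h1 : M i j = (M - 1) i j + (1 : Matrix (Fin 2) (Fin 2) P.Completion) i j := by simp
    rw [h1]
    refine add_mem ((P.integers.valuation_le_one_iff _).mp (hM i j).le) ?_
    rw [Matrix.one_apply]; split_ifs
    · exact one_mem _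
    · exact zero_mem _
  rw [mem_iwahori_iff, mem_integralGL_iff, hval]
  refine ⟨⟨hMle, hdet⟩, ?_⟩
  have := hM 1 0
  simpa using this

/-- The vertex of the tree given by a matrix. -/
noncomputable def vertexOf (P : Place k F) (g : GL (Fin 2) F) : Vertex P.integers :=
  P.glMap g • baseVertex P.integers

/-- The edge of the tree given by a matrix. -/
noncomputable def edgeOf (g : GL (Fin 2) F) : P.TEdge :=
  P.glMap g • baseEdge (isUniformizer_toCompletion hπ)

theorem glMap_smul_edgeOf (g h : GL (Fin 2) F) :
    P.glMap g • edgeOf hπ h = edgeOf hπ (g * h) := by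
  rw [edgeOf, edgeOf, map_mul, mul_smul]

omit hπ in
theorem glMap_smul_vertexOf (g h : GL (Fin 2) F) :
    P.glMap g • P.vertexOf h = P.vertexOf (g * h) := by
  rw [vertexOf, vertexOf, map_mul, mul_smul]

theorem smul_baseEdge_of_mem {s : GL (Fin 2) P.Completion} (hs : s ∈ iwahori P.integers) :
    s • baseEdge (isUniformizer_toCompletion hπ) = baseEdge (isUniformizer_toCompletion hπ) := by
  refine (smul_baseEdge_eq_iff _).mpr ⟨1, ?_⟩
  have h1 : scalarGL (1 : P.Completionˣ) = 1 := map_one _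
  rwa [h1, one_mul]

/-- Because the Iwahori group is open and `F` is dense, matrices over `F` already reach every edge
of the tree. From here on all computations take place in `F`. -/
theorem exists_edgeOf_eq_smul (g : GL (Fin 2) P.Completion) :
    ∃ h, edgeOf hπ h = g • baseEdge (isUniformizer_toCompletion hπ) := by
  obtain ⟨h, hh⟩ := exists_inv_mul_glMap_mem hπ g
  refine ⟨h, ?_⟩
  rw [edgeOf, ← inv_smul_eq_iff, ← mul_smul, smul_baseEdge_of_mem hπ hh]

theorem exists_eq_edgeOf (e : P.TEdge) : ∃ g, e = edgeOf hπ g := by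
  have hϖ := isUniformizer_toCompletion hπ
  obtain ⟨L, hL⟩ := Quotient.exists_rep e.fst
  obtain ⟨g, rfl⟩ := exists_eq_smul_stdLattice hϖ L
  have h1 : (g⁻¹ • e).fst = baseVertex P.integers := by
    rw [fst_smul, ← hL]
    exact inv_smul_eq_iff.mpr rfl
  obtain ⟨s, -, hs⟩ := (fst_eq_base_iff hϖ).mp h1
  rw [inv_smul_eq_iff, ← mul_smul] at hs
  obtain ⟨h, hh⟩ := exists_edgeOf_eq_smul hπ (g * s)
  exact ⟨h, hs.trans hh.symm⟩

theorem exists_eq_vertexOf (v : Vertex P.integers) : ∃ g, v = P.vertexOf g := by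
  have hϖ := isUniformizer_toCompletion hπ
  obtain ⟨L, rfl⟩ := Quotient.exists_rep v
  obtain ⟨g, rfl⟩ := exists_eq_smul_stdLattice hϖ L
  obtain ⟨h, hh⟩ := exists_edgeOf_eq_smul hπ g
  exact ⟨h, (congrArg (fun e => e.fst) hh).symm⟩

theorem edgeOf_eq_edgeOf_of_mem {g h : GL (Fin 2) F} (hgh : g⁻¹ * h ∈ iwahori P.ring) :
    edgeOf hπ g = edgeOf hπ h := by
  rw [← glMap_mem_iwahori_iff] at hgh
  have h1 := smul_baseEdge_of_mem hπ hgh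
  rw [map_mul, map_inv, mul_smul, inv_smul_eq_iff] at h1
  exact h1.symm

omit hπ in
theorem valuation_eq_one_of_scalarGL_mul {c : P.Completionˣ} {g : GL (Fin 2) F}
    (hd : P.ring.valuation g.1.det = 1)
    (hc : scalarGL c * P.glMap g ∈ integralGL P.integers) : P.integers.valuation (c : P.Completion) = 1 := by
  have h1 := ((mem_integralGL_iff _).mp hc).2
  rw [det_scalarGL_mul, det_glMap, map_mul, P.toCompletion_eq_one_iff.mpr hd, mul_one, map_pow] at h1
  rcases lt_trichotomy (P.integers.valuation (c : P.Completion)) 1 with h | h | h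
  · exact absurd h1 (pow_lt_one₀ zero_le h two_ne_zero).ne
  · exact h
  · exact absurd h1 (one_lt_pow₀ h two_ne_zero).ne'

omit hπ in
theorem scalarGL_mem_iwahori {c : P.Completionˣ}
    (hc : P.integers.valuation (c : P.Completion) = 1) : scalarGL c ∈ iwahori P.integers := by
  rw [mem_iwahori_iff, mem_integralGL_iff, Matrix.GeneralLinearGroup.coe_scalar,
    Matrix.scalar_apply, Matrix.det_diagonal]
  refine ⟨⟨fun i j => ?_, by simp [hc]⟩, by simp⟩
  rw [Matrix.diagonal_apply]; split_ifs
  · exact (P.integers.valuation_le_one_iff _).mp hc.le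
  · exact zero_mem _

/-- The stabilizer of an edge also contains scalars; the condition on the determinant forces the
scalar to be a unit, hence in the Iwahori group. -/
theorem edgeOf_eq_edgeOf_iff {g h : GL (Fin 2) F}
    (hd : P.ring.valuation (g⁻¹ * h).1.det = 1) :
    edgeOf hπ g = edgeOf hπ h ↔ g⁻¹ * h ∈ iwahori P.ring := by
  refine ⟨fun heq => ?_, edgeOf_eq_edgeOf_of_mem hπ⟩
  have h1 : P.glMap (g⁻¹ * h) • baseEdge (isUniformizer_toCompletion hπ) =
      baseEdge (isUniformizer_toCompletion hπ) := by
    rw [map_mul, map_inv, mul_smul, inv_smul_eq_iff]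
    exact heq.symm
  obtain ⟨c, hc⟩ := (smul_baseEdge_eq_iff _).mp h1
  have h2 := mul_mem (inv_mem (scalarGL_mem_iwahori
    (valuation_eq_one_of_scalarGL_mul hd hc.1))) hc
  rwa [inv_mul_cancel_left, glMap_mem_iwahori_iff] at h2

omit hπ in
theorem vertexOf_eq_vertexOf_of_mem {g h : GL (Fin 2) F} {c : Fˣ}
    (hgh : scalarGL c * (g⁻¹ * h) ∈ integralGL P.ring) :
    P.vertexOf g = P.vertexOf h := by
  rw [← glMap_mem_integralGL_iff, map_mul, Matrix.GeneralLinearGroup.map_scalar] at hgh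
  have h1 := (smul_baseVertex_eq_iff P.integers).mpr ⟨_, hgh⟩
  rw [map_mul, map_inv, mul_smul, inv_smul_eq_iff] at h1
  exact h1.symm

omit hπ in
theorem vertexOf_eq_vertexOf_iff {g h : GL (Fin 2) F}
    (hd : P.ring.valuation (g⁻¹ * h).1.det = 1) :
    P.vertexOf g = P.vertexOf h ↔ g⁻¹ * h ∈ integralGL P.ring := by
  have h0 : scalarGL (1 : Fˣ) = 1 := map_one _
  refine ⟨fun heq => ?_, fun h => vertexOf_eq_vertexOf_of_mem (c := 1) (by rwa [h0, one_mul])⟩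
  have h1 : P.glMap (g⁻¹ * h) • baseVertex P.integers = baseVertex P.integers := by
    rw [map_mul, map_inv, mul_smul, inv_smul_eq_iff]
    exact heq.symm
  obtain ⟨c, hc⟩ := (smul_baseVertex_eq_iff _).mp h1
  have h2 := mul_mem (inv_mem (scalarGL_mem_iwahori
    (valuation_eq_one_of_scalarGL_mul hd hc)).1) hc
  rwa [inv_mul_cancel_left, glMap_mem_integralGL_iff] at h2

theorem symm_edgeOf (g : GL (Fin 2) F) :
    (edgeOf hπ g).symm = edgeOf hπ (g * (diagGL hπ.ne_zero * swapGL F)) := by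
  have h1 : P.glMap (diagGL hπ.ne_zero * swapGL F) =
      diagGL (isUniformizer_toCompletion hπ).ne_zero * swapGL P.Completion := by
    rw [map_mul]
    congr 1
    · refine Matrix.GeneralLinearGroup.ext fun i j => ?_
      change P.toCompletion ((diagGL hπ.ne_zero).1 i j) = _
      rw [coe_diagGL, coe_diagGL]
      fin_cases i <;> fin_cases j <;> simp
    · refine Matrix.GeneralLinearGroup.ext fun i j => ?_
      change P.toCompletion ((swapGL F).1 i j) = _
      rw [coe_swapGL, coe_swapGL]
      fin_cases i <;> fin_cases j <;> simp
  rw [edgeOf, edgeOf, smul_symm, symm_baseEdge, map_mul, h1, mul_smul _ (_ * _)]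

omit hπ in
/-- A representative in the valuation ring of an element of the residue field. -/
noncomputable def residueRep (P : Place k F) (r : IsLocalRing.ResidueField P.ring) : F :=
  (Function.surjInv IsLocalRing.residue_surjective r : P.ring)

omit hπ in
theorem residueRep_mem (r : IsLocalRing.ResidueField P.ring) : P.residueRep r ∈ P.ring :=
  (Function.surjInv IsLocalRing.residue_surjective r : P.ring).2

omit hπ in
theorem valuation_sub_lt_one_iff {x y : F} (hx : x ∈ P.ring) (hy : y ∈ P.ring) :
    P.ring.valuation (x - y) < 1 ↔
      IsLocalRing.residue P.ring ⟨x, hx⟩ = IsLocalRing.residue P.ring ⟨y, hy⟩ := by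
  rw [← sub_eq_zero, ← map_sub, IsLocalRing.residue_eq_zero_iff,
    ValuationSubring.valuation_lt_one_iff]
  rfl

omit hπ in
theorem residue_residueRep (r : IsLocalRing.ResidueField P.ring) :
    IsLocalRing.residue P.ring ⟨P.residueRep r, residueRep_mem r⟩ = r :=
  Function.surjInv_eq IsLocalRing.residue_surjective r

/-- The edges with origin `vertexOf g`. -/
noncomputable def starEdge (g : GL (Fin 2) F) : Option (IsLocalRing.ResidueField P.ring) → P.TEdge
  | none => edgeOf hπ g
  | some r => edgeOf hπ (g * flipGL (P.residueRep r))

omit hπ in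
theorem inv_flipGL_mul_flipGL (c c' : F) (i j : Fin 2) :
    ((flipGL c)⁻¹ * flipGL c').1 i j = !![1, 0; c' - c, 1] i j := by
  rw [Units.val_mul, coe_inv_fin_two, coe_flipGL, coe_flipGL]
  fin_cases i <;> fin_cases j <;> simp [Matrix.mul_apply, Fin.sum_univ_two, Matrix.det_fin_two]
  ring

theorem starEdge_injective (g : GL (Fin 2) F) : Function.Injective (starEdge hπ g) := by
  have h1 : ∀ r, edgeOf hπ g ≠ edgeOf hπ (g * flipGL (P.residueRep r)) := by
    intro r h
    rw [edgeOf_eq_edgeOf_iff hπ (by rw [inv_mul_cancel_left, coe_flipGL]; simp),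
      inv_mul_cancel_left] at h
    have := h.2
    rw [coe_flipGL] at this
    simp at this
  rintro (_ | r) (_ | r') h
  · rfl
  · exact absurd h (h1 r')
  · exact absurd h.symm (h1 r)
  · have h2 : (g * flipGL (P.residueRep r))⁻¹ * (g * flipGL (P.residueRep r')) =
        (flipGL (P.residueRep r))⁻¹ * flipGL (P.residueRep r') := by group
    have h3 := (edgeOf_eq_edgeOf_iff hπ (by
      rw [h2, Matrix.det_fin_two]; simp only [inv_flipGL_mul_flipGL]; simp)).mp h
    rw [h2] at h3
    have h4 := h3.2
    rw [inv_flipGL_mul_flipGL] at h4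
    have h5 := (valuation_sub_lt_one_iff (residueRep_mem r') (residueRep_mem r)).mp h4
    rw [residue_residueRep, residue_residueRep] at h5
    rw [h5]

/-- The star is the projective line over the residue field. If `s` is not an Iwahori element, its
lower left entry is a unit, and the class of `s₀₀ / s₁₀` is the affine coordinate of the edge. -/
theorem range_starEdge (g : GL (Fin 2) F) :
    Set.range (starEdge hπ g) = {e | e.fst = P.vertexOf g} := by
  have hϖ := isUniformizer_toCompletion hπ
  ext e
  constructor
  · have hb : ∀ s ∈ integralGL P.ring, P.vertexOf (g * s) = P.vertexOf g := fun s hs =>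
      (vertexOf_eq_vertexOf_iff (by
        rw [inv_mul_cancel_left]; exact ((mem_integralGL_iff _).mp hs).2)).mpr
        (by rwa [inv_mul_cancel_left]) |>.symm
    rintro ⟨_ | r, rfl⟩
    · rfl
    · exact hb _ (flipGL_mem (residueRep_mem r))
  · intro he
    have h1 : ((P.glMap g)⁻¹ • e).fst = baseVertex P.integers := by
      rw [fst_smul, inv_smul_eq_iff]; exact he
    obtain ⟨s, hs, hs2⟩ := (fst_eq_base_iff hϖ).mp h1
    rw [inv_smul_eq_iff] at hs2
    by_cases hsi : s ∈ iwahori P.integers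
    · exact ⟨none, by rw [hs2, smul_baseEdge_of_mem hπ hsi]; rfl⟩
    · have h10 : P.integers.valuation (s.1 1 0) = 1 :=
        le_antisymm ((P.integers.valuation_le_one_iff _).mpr (hs.1 1 0))
          (not_lt.mp fun h => hsi ⟨hs, h⟩)
      have h0 : s.1 1 0 ≠ 0 := fun h => by simp [h] at h10
      have hc : s.1 0 0 / s.1 1 0 ∈ P.integers := by
        rw [← ValuationSubring.valuation_le_one_iff, map_div₀, h10, div_one]
        exact (P.integers.valuation_le_one_iff _).mpr (hs.1 0 0)
      obtain ⟨f, hf⟩ := P.exists_sub_toCompletion_lt (s.1 0 0 / s.1 1 0) one_ne_zero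
      rw [map_one, map_one] at hf
      have hfO : f ∈ P.ring := by
        rw [← toCompletion_mem_iff]
        have := sub_mem hc ((P.integers.valuation_le_one_iff _).mp hf.le)
        rwa [sub_sub_cancel] at this
      let r := IsLocalRing.residue P.ring ⟨f, hfO⟩
      have hfr : P.ring.valuation (f - P.residueRep r) < 1 :=
        (valuation_sub_lt_one_iff hfO (residueRep_mem r)).mpr (residue_residueRep r).symm
      have hfr2 : P.integers.valuation (s.1 0 0 / s.1 1 0 - P.toCompletion (P.residueRep r)) < 1 := by
        rw [← P.toCompletion_lt_one_iff, map_sub] at hfr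
        have := Valuation.map_add_lt _ hf hfr
        rwa [sub_add_sub_cancel] at this
      refine ⟨some r, ?_⟩
      have hflip : P.glMap (flipGL (P.residueRep r)) =
          flipGL (P.toCompletion (P.residueRep r)) := by
        refine Matrix.GeneralLinearGroup.ext fun i j => ?_
        change P.toCompletion ((flipGL (P.residueRep r)).1 i j) = _
        rw [coe_flipGL, coe_flipGL]
        fin_cases i <;> fin_cases j <;> simp
      have hmem := exists_integralGL_eq hs (c := P.toCompletion (P.residueRep r))
        (P.toCompletion_mem_iff.mpr (residueRep_mem r)) (by
          have h2 : s.1 0 0 - P.toCompletion (P.residueRep r) * s.1 1 0 =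
              (s.1 0 0 / s.1 1 0 - P.toCompletion (P.residueRep r)) * s.1 1 0 := by
            field_simp
          rw [h2, map_mul, h10, mul_one]
          exact hfr2)
      have := smul_baseEdge_of_mem hπ hmem
      rw [mul_smul, inv_smul_eq_iff] at this
      rw [hs2, this]
      change edgeOf hπ (g * flipGL (P.residueRep r)) = _
      rw [← glMap_smul_edgeOf, edgeOf, hflip]

/-- The matrix with rows `(π ^ n, c)` and `(0, 1)`. -/
noncomputable def ballGL {π : F} (hπ : π ≠ 0) (c : F) (n : ℤ) : GL (Fin 2) F :=
  Matrix.GeneralLinearGroup.mkOfDetNeZero !![π ^ n, c; 0, 1]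
    (by simpa using zpow_ne_zero n hπ)

omit hπ in
theorem coe_ballGL {π : F} (hπ : π ≠ 0) (c : F) (n : ℤ) :
    (ballGL hπ c n).1 = !![π ^ n, c; 0, 1] := rfl

omit hπ in
theorem ballGL_mul {π : F} (hπ : π ≠ 0) (c c' : F) (n m : ℤ) :
    ballGL hπ c n * ballGL hπ c' m = ballGL hπ (c + π ^ n * c') (n + m) := by
  refine Units.ext ?_
  rw [Units.val_mul, coe_ballGL, coe_ballGL, coe_ballGL]
  ext i j
  fin_cases i <;> fin_cases j <;> simp [zpow_add₀ hπ, add_comm]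

/-- The edge of `g * ballGL c n` stands for the ball with centre `c` and radius that of `π ^ n`, and
points to the next larger ball. Reversing all edges of a star but the one of `g` thus gives the
balls into which the ball of `g` decomposes. -/
theorem symm_edgeOf_flip (g : GL (Fin 2) F) (c : F) :
    (edgeOf hπ (g * flipGL c)).symm = edgeOf hπ (g * ballGL hπ.ne_zero c 1) := by
  rw [symm_edgeOf, mul_assoc]
  congr 2
  refine Units.ext ?_
  rw [Units.val_mul, Units.val_mul, coe_flipGL, coe_diagGL, coe_swapGL, coe_ballGL]
  ext i j
  fin_cases i <;> fin_cases j <;> simp [Matrix.mul_apply, Fin.sum_univ_two]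

theorem finite_star [Finite k] (hF : IsFunctionFieldOfCurve k F) (v : Vertex P.integers) :
    {e : P.TEdge | e.fst = v}.Finite := by
  have := P.finite_residueField hF
  obtain ⟨g, rfl⟩ := exists_eq_vertexOf hπ v
  rw [← range_starEdge hπ]
  exact Set.finite_range _

/-- The harmonicity condition in terms of matrices. -/
theorem IsHarmonic.apply_edgeOf [Fintype (IsLocalRing.ResidueField P.ring)] {φ : P.TEdge → ℤ}
    (hφ : (treeGraph P.integers).IsHarmonic φ) (g : GL (Fin 2) F) :
    φ (edgeOf hπ g) =
      ∑ r, φ (edgeOf hπ (g * ballGL hπ.ne_zero (P.residueRep r) 1)) := by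
  -- Move all edges of the star except the one of `g` to the other side, with reversed orientation:
  -- the value on a ball is the sum of the values on its `Q` parts.
  have h1 := (hφ.2 (P.vertexOf g)).2
  have h2 : (∑ᶠ (e : P.TEdge) (_ : e ∈ {e : P.TEdge | e.fst = P.vertexOf g}), φ e) = 0 := h1
  rw [← range_starEdge hπ, finsum_mem_range (starEdge_injective hπ g), finsum_eq_sum_of_fintype,
    Fintype.sum_option] at h2
  change φ (edgeOf hπ g) + ∑ r, φ (edgeOf hπ (g * flipGL (P.residueRep r))) = 0 at h2
  rw [eq_neg_of_add_eq_zero_left h2, ← Finset.sum_neg_distrib]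
  refine Finset.sum_congr rfl fun r _ => ?_
  have h3 := hφ.1 (edgeOf hπ (g * flipGL (P.residueRep r)))
  change _ + φ (edgeOf hπ (g * flipGL (P.residueRep r))).symm = 0 at h3
  rw [symm_edgeOf_flip] at h3
  change - φ (edgeOf hπ (g * flipGL (P.residueRep r))) = _
  linarith

end Place

/-! ## Lattices over the ring of functions regular away from a place -/

section CrossDet

variable {K : Type*} [Field K]

/-- The determinant of a pair of vectors. -/
def crossDet (x y : Fin 2 → K) : K := x 0 * y 1 - x 1 * y 0

theorem crossDet_add_right (x y z : Fin 2 → K) :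
    crossDet x (y + z) = crossDet x y + crossDet x z := by
  simp only [crossDet, Pi.add_apply]; ring

theorem crossDet_smul_right (c : K) (x y : Fin 2 → K) :
    crossDet x (c • y) = c * crossDet x y := by
  simp only [crossDet, Pi.smul_apply, smul_eq_mul]; ring

theorem crossDet_smul_left (c : K) (x y : Fin 2 → K) :
    crossDet (c • x) y = c * crossDet x y := by
  simp only [crossDet, Pi.smul_apply, smul_eq_mul]; ring

theorem crossDet_self (x : Fin 2 → K) : crossDet x x = 0 := by
  simp only [crossDet]; ring

theorem crossDet_comm (x y : Fin 2 → K) : crossDet x y = -crossDet y x := by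
  simp only [crossDet]; ring

theorem crossDet_mulVec (M : Matrix (Fin 2) (Fin 2) K) (x y : Fin 2 → K) :
    crossDet (M.mulVec x) (M.mulVec y) = M.det * crossDet x y := by
  simp only [crossDet, Matrix.mulVec, dotProduct, Fin.sum_univ_two, Matrix.det_fin_two]; ring

/-- Cramer's rule. -/
theorem crossDet_smul_eq (x y z : Fin 2 → K) :
    crossDet x y • z = crossDet z y • x + crossDet x z • y := by
  ext i
  fin_cases i <;> simp [crossDet] <;> ring

theorem exists_crossDet_ne_zero {x : Fin 2 → K} (hx : x ≠ 0) : ∃ y, crossDet x y ≠ 0 := by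
  by_contra! h
  refine hx (funext fun i => ?_)
  have h0 := h ![1, 0]
  have h1 := h ![0, 1]
  simp only [crossDet, Matrix.cons_val_zero, Matrix.cons_val_one, mul_zero, mul_one, zero_sub,
    sub_zero, neg_eq_zero] at h0 h1
  fin_cases i
  · exact h1
  · exact h0

theorem exists_smul_of_crossDet_eq_zero {x y : Fin 2 → K} (hx : x ≠ 0) (h : crossDet x y = 0) :
    ∃ c : K, y = c • x := by
  obtain ⟨z, hz⟩ := exists_crossDet_ne_zero hx
  have := crossDet_smul_eq x z y
  rw [h, zero_smul, add_zero] at this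
  exact ⟨(crossDet x z)⁻¹ * crossDet y z, by rw [mul_smul, ← this, inv_smul_smul₀ hz]⟩

theorem linearIndependent_pair_crossDet {x y : Fin 2 → K} (h : LinearIndependent K ![x, y]) :
    crossDet x y ≠ 0 := by
  intro h0
  have hx : x ≠ 0 := h.ne_zero 0
  obtain ⟨c, hc⟩ := exists_smul_of_crossDet_eq_zero hx h0
  have := LinearIndependent.pair_iff.mp h c (-1) (by rw [hc]; module)
  simp at this

/-- The matrix with given columns. -/
def colGL (x y : Fin 2 → K) (h : crossDet x y ≠ 0) : GL (Fin 2) K :=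
  Matrix.GeneralLinearGroup.mkOfDetNeZero !![x 0, y 0; x 1, y 1] (by
    rw [Matrix.det_fin_two_of]
    convert h using 1
    rw [crossDet]; ring)

theorem coe_colGL (x y : Fin 2 → K) (h : crossDet x y ≠ 0) :
    (colGL x y h).1 = !![x 0, y 0; x 1, y 1] := rfl

theorem det_colGL (x y : Fin 2 → K) (h : crossDet x y ≠ 0) :
    (colGL x y h).1.det = crossDet x y := by
  rw [coe_colGL, Matrix.det_fin_two_of, crossDet]; ring

theorem colGL_mulVec (x y : Fin 2 → K) (h : crossDet x y ≠ 0) (z : Fin 2 → K) :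
    (colGL x y h).1.mulVec z = z 0 • x + z 1 • y := by
  ext i
  fin_cases i <;> simp [coe_colGL, Matrix.mulVec, dotProduct, Fin.sum_univ_two] <;> ring

theorem mulVec_eq_iff {M N : Matrix (Fin 2) (Fin 2) K} {x y : Fin 2 → K} (h : crossDet x y ≠ 0)
    (hx : M.mulVec x = N.mulVec x) (hy : M.mulVec y = N.mulVec y) : M = N := by
  have h1 : M * (colGL x y h).1 = N * (colGL x y h).1 := by
    ext i j
    have hx' := congrFun hx i
    have hy' := congrFun hy i
    simp only [Matrix.mulVec, dotProduct, Fin.sum_univ_two] at hx' hy'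
    rw [coe_colGL, Matrix.mul_apply, Matrix.mul_apply, Fin.sum_univ_two, Fin.sum_univ_two]
    fin_cases j
    · simpa using hx'
    · simpa using hy'
  have h2 := congrArg (· * ((colGL x y h)⁻¹).1) h1
  simpa only [mul_assoc, Units.mul_inv, mul_one] using h2

end CrossDet

/-! ### `A`-lattices: finite generation, determinants, discreteness, transvections. -/

namespace Place

open BruhatTits

variable {k F : Type*} [Field k] [Finite k] [Field F] [Algebra k F] {P : Place k F}
  (hF : IsFunctionFieldOfCurve k F)

include hF

theorem isFractionRing_regularAway : IsFractionRing P.regularAway F := by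
  refine IsFractionRing.of_field _ _ fun z => ?_
  obtain ⟨a, ha, ha0, haz⟩ := P.exists_mul_mem_regularAway hF z
  exact ⟨⟨_, haz⟩, ⟨a, ha⟩, (mul_div_cancel_left₀ z ha0).symm⟩

theorem exists_mul_mem_of_finite {S : Set F} (hS : S.Finite) :
    ∃ a ∈ P.regularAway, a ≠ 0 ∧ ∀ f ∈ S, a * f ∈ P.regularAway := by
  induction S, hS using Set.Finite.induction_on with
  | empty => exact ⟨1, one_mem _, one_ne_zero, fun _ h => h.elim⟩
  | @insert f S _ _ ih =>
    obtain ⟨a, ha, ha0, haS⟩ := ih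
    obtain ⟨b, hb, hb0, hbf⟩ := P.exists_mul_mem_regularAway hF f
    refine ⟨a * b, mul_mem ha hb, mul_ne_zero ha0 hb0, ?_⟩
    rintro g (rfl | hg)
    · rw [mul_assoc]; exact mul_mem ha hbf
    · rw [mul_comm a, mul_assoc]; exact mul_mem hb (haS g hg)

variable {Y : Submodule P.regularAway (Fin 2 → F)} (hY : P.IsALattice Y)

include hY

theorem IsALattice.exists_crossDet_ne_zero : ∃ y ∈ Y, ∃ y' ∈ Y, crossDet y y' ≠ 0 := by
  have := isFractionRing_regularAway (P := P) hF
  obtain ⟨f, hf⟩ := exists_linearIndependent_of_le_finrank (R := P.regularAway) (M := Y) hY.2.ge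
  have h1 : LinearIndependent P.regularAway (fun i => (f i : Fin 2 → F)) :=
    hf.map' Y.subtype (Submodule.ker_subtype _)
  rw [LinearIndependent.iff_fractionRing P.regularAway F] at h1
  refine ⟨f 0, (f 0).2, f 1, (f 1).2, linearIndependent_pair_crossDet ?_⟩
  have h2 : ![(f 0 : Fin 2 → F), (f 1 : Fin 2 → F)] = fun i => (f i : Fin 2 → F) := by
    ext i
    fin_cases i <;> rfl
  rw [h2]
  exact h1

/-- A splitting of the free cover embeds `Y` into a free module. Each `z` in `Y` has a nonzero
multiple in the span of `y` and `y'`, so the support of its image lies in the union of the finite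
supports for `y` and `y'`. Hence finitely many of the generators suffice. -/
theorem IsALattice.fg : Y.FG := by
  classical
  obtain ⟨y, hy, y', hy', hyy⟩ := hY.exists_crossDet_ne_zero hF
  obtain ⟨s, hs⟩ := Module.projective_def'.mp hY.1
  have hsum : ∀ z : Y, z = (s z).sum fun w a => a • w := fun z => by
    have := LinearMap.congr_fun hs z
    exact this.symm
  let S := (s ⟨y, hy⟩).support ∪ (s ⟨y', hy'⟩).support
  have hsupp : ∀ z : Y, (s z).support ⊆ S := by
    intro z
    obtain ⟨a, ha, ha0, haS⟩ := exists_mul_mem_of_finite (P := P) hF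
      (Set.toFinite {crossDet z.1 y' / crossDet y y', crossDet y z.1 / crossDet y y'})
    have e1 := haS (crossDet z.1 y' / crossDet y y') (by simp)
    have e2 := haS (crossDet y z.1 / crossDet y y') (by simp)
    have hz : (⟨a, ha⟩ : P.regularAway) • z =
        (⟨_, e1⟩ : P.regularAway) • (⟨y, hy⟩ : Y) + (⟨_, e2⟩ : P.regularAway) • (⟨y', hy'⟩ : Y) := by
      refine Subtype.ext ?_
      change a • z.1 = (a * _) • y + (a * _) • y'
      rw [mul_smul, mul_smul, ← smul_add]
      congr 1
      rw [div_eq_inv_mul, div_eq_inv_mul, mul_smul, mul_smul, ← smul_add, ← crossDet_smul_eq,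
        inv_smul_smul₀ hyy]
    intro w hw
    by_contra hwS
    simp only [S, Finset.mem_union, Finsupp.mem_support_iff, not_or, not_not] at hwS
    have := DFunLike.congr_fun (congrArg s hz) w
    simp only [map_add, map_smul, Finsupp.add_apply, Finsupp.smul_apply, hwS, smul_eq_mul] at this
    have h1 := congrArg Subtype.val this
    change a * (s z w).1 = _ * 0 + _ * 0 at h1
    rw [mul_zero, mul_zero, add_zero] at h1
    exact Finsupp.mem_support_iff.mp hw
      (Subtype.ext ((mul_eq_zero.mp h1).resolve_left ha0))
  refine ⟨S.image Subtype.val, le_antisymm (Submodule.span_le.mpr fun x hx => ?_) fun x hx => ?_⟩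
  · obtain ⟨w, -, rfl⟩ := Finset.mem_image.mp hx
    exact w.2
  · have h1 := congrArg Subtype.val (hsum ⟨x, hx⟩)
    rw [Finsupp.sum, AddSubmonoidClass.coe_finsetSum] at h1
    change x = _ at h1
    rw [h1]
    refine Submodule.sum_mem _ fun w hw => ?_
    exact Submodule.smul_mem _ _ (Submodule.subset_span
      (Finset.mem_image_of_mem _ (hsupp _ hw)))

/-- A lattice is contained in a multiple of the standard lattice. -/
theorem IsALattice.exists_mul_mem : ∃ a ∈ P.regularAway, a ≠ 0 ∧ ∀ y ∈ Y, ∀ i,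
    a * y i ∈ P.regularAway := by
  obtain ⟨S, hS⟩ := hY.fg hF
  obtain ⟨a, ha, ha0, haS⟩ := exists_mul_mem_of_finite (P := P) hF
    (S := ⋃ y ∈ S, Set.range y) (S.finite_toSet.biUnion fun y _ => Set.finite_range y)
  refine ⟨a, ha, ha0, fun y hy i => ?_⟩
  rw [← hS] at hy
  induction hy using Submodule.span_induction with
  | mem y hy => exact haS _ (Set.mem_biUnion hy ⟨i, rfl⟩)
  | zero => simp
  | add y z _ _ h1 h2 => rw [Pi.add_apply, mul_add]; exact add_mem h1 h2
  | smul b y _ h =>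
    change a * (b.1 * y i) ∈ _
    rw [mul_left_comm]; exact mul_mem b.2 h

/-- A scalar multiple of a given vector lies in the lattice. -/
theorem IsALattice.exists_smul_mem (x : Fin 2 → F) :
    ∃ a ∈ P.regularAway, a ≠ 0 ∧ a • x ∈ Y := by
  obtain ⟨y, hy, y', hy', hyy⟩ := hY.exists_crossDet_ne_zero hF
  obtain ⟨a, ha, ha0, haS⟩ := exists_mul_mem_of_finite (P := P) hF
    (Set.toFinite {crossDet x y' / crossDet y y', crossDet y x / crossDet y y'})
  have e1 := haS (crossDet x y' / crossDet y y') (by simp)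
  have e2 := haS (crossDet y x / crossDet y y') (by simp)
  refine ⟨a, ha, ha0, ?_⟩
  have : a • x = (⟨_, e1⟩ : P.regularAway) • y + (⟨_, e2⟩ : P.regularAway) • y' := by
    change a • x = (a * _) • y + (a * _) • y'
    rw [mul_smul, mul_smul, ← smul_add]
    congr 1
    rw [div_eq_inv_mul, div_eq_inv_mul, mul_smul, mul_smul, ← smul_add, ← crossDet_smul_eq,
      inv_smul_smul₀ hyy]
  rw [this]
  exact add_mem (Y.smul_mem _ hy) (Y.smul_mem _ hy')

/-- The determinant of an endomorphism of a lattice is regular away from the place. -/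
theorem IsALattice.det_mem {M : Matrix (Fin 2) (Fin 2) F} (hM : ∀ y ∈ Y, M.mulVec y ∈ Y) :
    M.det ∈ P.regularAway := by
  refine P.mem_regularAway_of_isIntegral ?_
  obtain ⟨S, hS⟩ := hY.fg hF
  let B : (Fin 2 → F) →ₗ[P.regularAway] (Fin 2 → F) →ₗ[P.regularAway] F :=
    LinearMap.mk₂ _ crossDet (fun x y z => by simp only [crossDet, Pi.add_apply]; ring)
      (fun c x y => crossDet_smul_left c.1 x y) crossDet_add_right
      (fun c x y => crossDet_smul_right c.1 x y)
  -- The module spanned by the determinants of pairs from `Y` is finitely generated, nonzero and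
  -- stable under multiplication by `det M`. So `det M` is integral over `A`, which is integrally
  -- closed.
  let D := Submodule.map₂ B Y Y
  have hD : D.FG := Submodule.FG.map₂ B ⟨S, hS⟩ ⟨S, hS⟩
  refine isIntegral_of_smul_mem_submodule D ?_ hD _ fun d hd => ?_
  · obtain ⟨y, hy, y', hy', hyy⟩ := hY.exists_crossDet_ne_zero hF
    intro h0
    have : B y y' ∈ D := Submodule.apply_mem_map₂ _ hy hy'
    rw [h0] at this
    exact hyy this
  · refine Submodule.map₂_le (p := Y) (q := Y) (f := B)
      (r := D.comap (LinearMap.mulLeft P.regularAway M.det)) |>.mpr ?_ hd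
    intro y hy y' hy'
    change M.det * crossDet y y' ∈ D
    rw [← crossDet_mulVec]
    exact Submodule.apply_mem_map₂ B (hM y hy) (hM y' hy')

theorem IsALattice.trace_mem {M : Matrix (Fin 2) (Fin 2) F} (hM : ∀ y ∈ Y, M.mulVec y ∈ Y) :
    M.trace ∈ P.regularAway := by
  have h1 := hY.det_mem hF hM
  have h2 := hY.det_mem hF (M := 1 + M) fun y hy => by
    rw [Matrix.add_mulVec, Matrix.one_mulVec]; exact add_mem hy (hM y hy)
  have h3 : M.trace = (1 + M).det - 1 - M.det := by
    rw [Matrix.trace_fin_two, Matrix.det_fin_two, Matrix.det_fin_two]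
    simp
    ring
  rw [h3]
  exact sub_mem (sub_mem h2 (one_mem _)) h1

/-- The determinant is a unit of `A`. If it had a pole at `P`, its inverse would be an element of
`A` vanishing at `P`, hence zero. -/
theorem IsALattice.det_mem_range {γ : GL (Fin 2) F} (hγ : γ ∈ P.stabLattice Y) :
    γ.1.det ∈ Set.range (algebraMap k F) := by
  have h1 := hY.det_mem hF (M := γ.1) fun y hy => (hγ y).mpr hy
  have h2 := hY.det_mem hF (M := (γ⁻¹).1) fun y hy => (inv_mem hγ y).mpr hy
  have h3 : γ.1.det * (γ⁻¹).1.det = 1 := by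
    rw [← Matrix.det_mul, ← Units.val_mul, mul_inv_cancel, Units.val_one, Matrix.det_one]
  refine P.mem_range_of_mem_regularAway hF h1 (not_lt.mp fun h => ?_)
  have h4 : P.ring.valuation (γ⁻¹).1.det < 1 := by
    have := congrArg P.ring.valuation h3
    rw [map_mul, map_one] at this
    by_contra hcon
    exact (one_lt_mul_of_lt_of_le h (not_lt.mp hcon)).ne' this
  rw [P.eq_zero_of_mem_regularAway hF h2 h4, mul_zero] at h3
  exact zero_ne_one h3

theorem IsALattice.valuation_det {γ : GL (Fin 2) F} (hγ : γ ∈ P.stabLattice Y) :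
    P.ring.valuation γ.1.det = 1 := by
  obtain ⟨c, hc⟩ := hY.det_mem_range hF hγ
  rw [← hc]
  refine P.valuation_algebraMap fun h => ?_
  rw [h, map_zero] at hc
  exact γ.det_ne_zero hc.symm

/-- A lattice meets bounded sets in finite sets. -/
theorem IsALattice.finite_inter (g : GL (Fin 2) F) :
    {y | y ∈ Y ∧ ∀ i, (g⁻¹).1.mulVec y i ∈ P.ring}.Finite := by
  obtain ⟨a, ha, ha0, haY⟩ := hY.exists_mul_mem hF
  obtain ⟨c, hc1, hc⟩ := P.exists_valuation_ge (n := 4)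
    ![a * g.1 0 0, a * g.1 0 1, a * g.1 1 0, a * g.1 1 1]
  have hfin := P.finite_regularAway_le hF c
  have hc' : ∀ i j, P.ring.valuation (a * g.1 i j) ≤ P.ring.valuation c := fun i j => by
    have h0 := hc 0
    have h1 := hc 1
    have h2 := hc 2
    have h3 := hc 3
    fin_cases i <;> fin_cases j <;> assumption
  refine Set.Finite.of_finite_image (f := fun y : Fin 2 → F => a • y)
    ((Set.Finite.pi' fun _ : Fin 2 => hfin).subset ?_) (fun x _ y _ h => ?_)
  · rintro _ ⟨y, ⟨hy, hyg⟩, rfl⟩ i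
    refine ⟨haY y hy i, ?_⟩
    have h1 : y = g.1.mulVec ((g⁻¹).1.mulVec y) := by
      rw [Matrix.mulVec_mulVec, ← Units.val_mul, mul_inv_cancel, Units.val_one, Matrix.one_mulVec]
    change P.ring.valuation (a * y i) ≤ _
    rw [h1]
    have h2 : a * g.1.mulVec ((g⁻¹).1.mulVec y) i =
        a * g.1 i 0 * (g⁻¹).1.mulVec y 0 + a * g.1 i 1 * (g⁻¹).1.mulVec y 1 := by
      rw [Matrix.mulVec, dotProduct, Fin.sum_univ_two]; ring
    rw [h2]
    refine Valuation.map_add_le _ ?_ ?_ <;>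
    · rw [map_mul]
      exact mul_le_of_le_of_le_one (hc' _ _) ((P.ring.valuation_le_one_iff _).mpr (hyg _))
  · exact smul_right_injective _ ha0 h

/-- The stabilizer of a vertex in an arithmetic group is finite. -/
theorem IsALattice.finite_stabilizer (g : GL (Fin 2) F) :
    {γ : GL (Fin 2) F | γ ∈ P.stabLattice Y ∧ g⁻¹ * γ * g ∈ integralGL P.ring}.Finite := by
  obtain ⟨π, hπ⟩ := P.exists_uniformizer hF
  obtain ⟨y, hy, y', hy', hyy⟩ := hY.exists_crossDet_ne_zero hF
  -- An element of the stabilizer is determined by the images of `y` and `y'`. These images are in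
  -- `Y` and in the multiple of the `g`-lattice that contains `y` and `y'`, so there are finitely
  -- many candidates.
  have hbound : ∃ c : F, c ≠ 0 ∧ (∀ i, (g⁻¹).1.mulVec y i * c ∈ P.ring) ∧
      ∀ i, (g⁻¹).1.mulVec y' i * c ∈ P.ring := by
    obtain ⟨c, hc1, hc⟩ := P.exists_valuation_ge (n := 4)
      ![(g⁻¹).1.mulVec y 0, (g⁻¹).1.mulVec y 1, (g⁻¹).1.mulVec y' 0, (g⁻¹).1.mulVec y' 1]
    have hc0 : c ≠ 0 := by rintro rfl; simp at hc1
    have key : ∀ x : F, P.ring.valuation x ≤ P.ring.valuation c → x * c⁻¹ ∈ P.ring := fun x hx => by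
      rw [← ValuationSubring.valuation_le_one_iff, map_mul, map_inv₀]
      exact mul_inv_le_one_of_le₀ hx zero_le
    have h0 := hc 0
    have h1 := hc 1
    have h2 := hc 2
    have h3 := hc 3
    refine ⟨c⁻¹, inv_ne_zero hc0, fun i => key _ ?_, fun i => key _ ?_⟩ <;>
    fin_cases i <;> assumption
  obtain ⟨c, hc0, hc, hc'⟩ := hbound
  let g' := g * (scalarGL (Units.mk0 c hc0))⁻¹
  have hfin := hY.finite_inter hF g'
  have hg' : ∀ x : Fin 2 → F, (g'⁻¹).1.mulVec x = c • (g⁻¹).1.mulVec x := fun x => by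
    rw [mul_inv_rev, inv_inv, Units.val_mul, ← Matrix.mulVec_mulVec, scalarGL_mulVec]; rfl
  have key : ∀ γ : GL (Fin 2) F, g⁻¹ * γ * g ∈ integralGL P.ring → ∀ x : Fin 2 → F,
      (∀ i, (g⁻¹).1.mulVec x i * c ∈ P.ring) → ∀ i, (g'⁻¹).1.mulVec (γ.1.mulVec x) i ∈ P.ring := by
    intro γ hγ x hx i
    have h1 : (g⁻¹).1.mulVec (γ.1.mulVec x) = (g⁻¹ * γ * g).1.mulVec ((g⁻¹).1.mulVec x) := by
      rw [Matrix.mulVec_mulVec, Matrix.mulVec_mulVec, ← Units.val_mul, ← Units.val_mul,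
        mul_inv_cancel_right]
    rw [hg', h1, ← Matrix.mulVec_smul, Matrix.mulVec, dotProduct, Fin.sum_univ_two]
    refine add_mem (mul_mem (hγ.1 _ _) ?_) (mul_mem (hγ.1 _ _) ?_) <;>
    · rw [Pi.smul_apply, smul_eq_mul, mul_comm]; exact hx _
  refine Set.Finite.of_finite_image (f := fun γ : GL (Fin 2) F => (γ.1.mulVec y, γ.1.mulVec y'))
    ((hfin.prod hfin).subset ?_) ?_
  · rintro _ ⟨γ, ⟨hγ1, hγ2⟩, rfl⟩
    exact ⟨⟨(hγ1 y).mpr hy, key γ hγ2 y hc⟩, ⟨(hγ1 y').mpr hy', key γ hγ2 y' hc'⟩⟩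
  · intro γ _ γ' _ h
    exact Units.ext (mulVec_eq_iff hyy (congrArg Prod.fst h) (congrArg Prod.snd h))

omit hY in
omit [Finite k] hF in
/-- The transvection `v ↦ v + b det(x, v) x`. -/
theorem exists_transvection (b : F) (x : Fin 2 → F) :
    ∃ u : GL (Fin 2) F, ∀ v, u.1.mulVec v = v + (b * crossDet x v) • x := by
  refine ⟨Matrix.GeneralLinearGroup.mkOfDetNeZero
    !![1 - b * x 0 * x 1, b * x 0 * x 0; - b * x 1 * x 1, 1 + b * x 0 * x 1] ?_, fun v => ?_⟩
  · rw [Matrix.det_fin_two_of]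
    ring_nf
    exact one_ne_zero
  · change Matrix.mulVec !![_, _; _, _] v = _
    ext i
    fin_cases i <;> simp [crossDet, Matrix.mulVec, dotProduct, Fin.sum_univ_two] <;> ring

omit hY in
omit [Finite k] hF in
theorem transvection_mem {𝔞 : Ideal P.regularAway} {b : F} {x : Fin 2 → F} {u : GL (Fin 2) F}
    (hu : ∀ v, u.1.mulVec v = v + (b * crossDet x v) • x)
    (hb : ∀ y ∈ Y, (b * crossDet x y) • x ∈ 𝔞 • Y) : u ∈ P.congruenceSubgroup Y 𝔞 := by
  have hle : 𝔞 • Y ≤ Y := Submodule.smul_le_right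
  refine ⟨fun y => ⟨fun h => ?_, fun h => ?_⟩, fun y hy => ?_⟩
  · have h1 := hb _ h
    rw [hu, crossDet_add_right, crossDet_smul_right, crossDet_self, mul_zero, add_zero] at h1
    have h2 := sub_mem h (hle h1)
    rwa [hu, add_sub_cancel_right] at h2
  · rw [hu]; exact add_mem h (hle (hb y h))
  · rw [hu, add_sub_cancel_left]; exact hb y hy

/-- Arithmetic groups contain transvections in all directions. -/
theorem IsALattice.exists_transvection_mem {𝔞 : Ideal P.regularAway} (h𝔞 : 𝔞 ≠ ⊥)
    (x : Fin 2 → F) :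
    ∃ b : F, b ≠ 0 ∧ ∃ u ∈ P.congruenceSubgroup Y 𝔞,
      ∀ v, u.1.mulVec v = v + (b * crossDet x v) • x := by
  obtain ⟨a, ha, ha0, haY⟩ := hY.exists_mul_mem hF
  obtain ⟨d, hd, hd0, hdx⟩ := hY.exists_smul_mem hF x
  obtain ⟨f, hf, hf0, hfx⟩ := exists_mul_mem_of_finite (P := P) hF (Set.finite_range x)
  obtain ⟨e, he, he0⟩ := Submodule.exists_mem_ne_zero_of_ne_bot h𝔞
  -- The factors of the parameter: `e` lies in `𝔞`, `d` moves `x` into `Y`, while `f` and `a` clear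
  -- the denominators of `x` and of the vectors of `Y`.
  obtain ⟨u, hu⟩ := exists_transvection (e.1 * (d * (f * a))) x
  refine ⟨_, mul_ne_zero (fun h => he0 (Subtype.ext h)) (mul_ne_zero hd0 (mul_ne_zero hf0 ha0)), u,
    transvection_mem hu fun y hy => ?_, hu⟩
  have h1 : f * a * crossDet x y ∈ P.regularAway := by
    have : f * a * crossDet x y = (f * x 0) * (a * y 1) - (f * x 1) * (a * y 0) := by
      rw [crossDet]; ring
    rw [this]
    exact sub_mem (mul_mem (hfx _ ⟨0, rfl⟩) (haY y hy 1)) (mul_mem (hfx _ ⟨1, rfl⟩) (haY y hy 0))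
  have h2 : (e.1 * (d * (f * a)) * crossDet x y) • x =
      e • ((⟨_, h1⟩ : P.regularAway) • (d • x)) := by
    change _ = e.1 • ((f * a * crossDet x y) • (d • x))
    rw [smul_smul, smul_smul]
    congr 1
    ring
  rw [h2]
  exact Submodule.smul_mem_smul he (Y.smul_mem _ hdx)

/-- The elements of an arithmetic group commuting with the group are the scalars. -/
theorem IsALattice.exists_eq_scalarGL {𝔞 : Ideal P.regularAway} (h𝔞 : 𝔞 ≠ ⊥)
    {γ : GL (Fin 2) F} (hγ : ∀ u ∈ P.congruenceSubgroup Y 𝔞, u * γ = γ * u) :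
    ∃ c : Fˣ, γ = scalarGL c := by
  -- What commutes with a nontrivial transvection along `x` preserves the line of `x`. A matrix that
  -- preserves all lines is scalar.
  have key : ∀ x : Fin 2 → F, x ≠ 0 → ∃ c : F, γ.1.mulVec x = c • x := by
    intro x hx
    obtain ⟨b, hb0, u, hu, hux⟩ := hY.exists_transvection_mem hF h𝔞 x
    obtain ⟨v, hv⟩ := _root_.exists_crossDet_ne_zero hx
    have h1 : u.1.mulVec (γ.1.mulVec v) = γ.1.mulVec (u.1.mulVec v) := by
      rw [Matrix.mulVec_mulVec, Matrix.mulVec_mulVec, ← Units.val_mul, ← Units.val_mul, hγ u hu]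
    rw [hux, hux, Matrix.mulVec_add, add_right_inj, Matrix.mulVec_smul] at h1
    refine ⟨(b * crossDet x v)⁻¹ * (b * crossDet x (γ.1.mulVec v)), ?_⟩
    rw [mul_smul, h1, inv_smul_smul₀ (mul_ne_zero hb0 hv)]
  obtain ⟨c0, h0⟩ := key ![1, 0] (by intro h; simpa using congrFun h 0)
  obtain ⟨c1, h1⟩ := key ![0, 1] (by intro h; simpa using congrFun h 1)
  obtain ⟨c2, h2⟩ := key ![1, 1] (by intro h; simpa using congrFun h 0)
  have e0 := congrFun h0 0
  have e1 := congrFun h0 1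
  have e2 := congrFun h1 0
  have e3 := congrFun h1 1
  have e4 := congrFun h2 0
  have e5 := congrFun h2 1
  simp [Matrix.mulVec, dotProduct, Fin.sum_univ_two] at e0 e1 e2 e3 e4 e5
  rw [e2, add_zero] at e4
  rw [e1, zero_add] at e5
  have hd : γ.1.det ≠ 0 := γ.det_ne_zero
  rw [Matrix.det_fin_two, e1, mul_zero, sub_zero] at hd
  refine ⟨Units.mk0 (γ.1 0 0) (left_ne_zero_of_mul hd), Units.ext ?_⟩
  rw [Matrix.GeneralLinearGroup.coe_scalar, Matrix.scalar_apply]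
  ext i j
  fin_cases i <;> fin_cases j
  · rfl
  · simpa using e2
  · simpa using e1
  · simpa using e5.trans e4.symm

end Place

/-! ## Orders of edge stabilizers -/

section GroupTheory

/-- On `Z` the character `c` is injective, and it takes there all of its values on `f.ker`; so `Z`
and `f.ker ⊓ c.ker` are complements in `f.ker`. -/
theorem Subgroup.card_eq_of_ker_inf_ker {H L M : Type*} [Group H] [Group L] [Group M]
    (f : H →* L) (c : H →* M) (Z : Subgroup H) (hZ : Z ≤ f.ker)
    (hc : ∀ z ∈ Z, c z = 1 → z = 1) (hcZ : ∀ h ∈ f.ker, ∃ z ∈ Z, c z = c h) :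
    Nat.card H = Nat.card f.range * Nat.card Z * Nat.card (f.ker ⊓ c.ker : Subgroup H) := by
  have h1 : Nat.card f.ker = Nat.card Z * Nat.card (f.ker ⊓ c.ker : Subgroup H) := by
    rw [← Nat.card_prod]
    refine (Nat.card_congr (Equiv.ofBijective
      (fun x : Z × (f.ker ⊓ c.ker : Subgroup H) => (⟨x.1.1 * x.2.1,
        mul_mem (hZ x.1.2) x.2.2.1⟩ : f.ker)) ⟨?_, ?_⟩)).symm
    · rintro ⟨⟨z, hz⟩, ⟨u, hu⟩⟩ ⟨⟨z', hz'⟩, ⟨u', hu'⟩⟩ h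
      have h0 : z * u = z' * u' := congrArg Subtype.val h
      have hcz : c z = c z' := by
        have := congrArg c h0
        rwa [map_mul, map_mul, MonoidHom.mem_ker.mp hu.2, MonoidHom.mem_ker.mp hu'.2, mul_one,
          mul_one] at this
      have hzz : z = z' := by
        rw [← inv_mul_eq_one]
        refine hc _ (mul_mem (inv_mem hz) hz') ?_
        rw [map_mul, map_inv, hcz, inv_mul_cancel]
      subst hzz
      rw [mul_right_inj] at h0
      subst h0
      rfl
    · rintro ⟨h, hh⟩
      obtain ⟨z, hz, hzh⟩ := hcZ h hh
      refine ⟨⟨⟨z, hz⟩, ⟨z⁻¹ * h, f.ker.mul_mem (inv_mem (hZ hz)) hh, ?_⟩⟩, Subtype.ext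
        (mul_inv_cancel_left z h)⟩
      change c (z⁻¹ * h) = 1
      rw [map_mul, map_inv, hzh, inv_mul_cancel]
  rw [← f.ker.card_mul_index, Subgroup.index_ker, h1]
  ring

/-- The function is constant on the cosets of `H`, so the sum is `|H|` times a sum, over the cosets,
of multiples of `m`. -/
theorem AddSubgroup.mul_card_dvd_sum {κ : Type*} [AddGroup κ] [Fintype κ] (H : AddSubgroup κ)
    (f : κ → ℤ) (m : ℤ) (hf : ∀ r, ∀ h ∈ H, f (r + h) = f r) (hm : ∀ r, m ∣ f r) :
    m * Nat.card H ∣ ∑ r, f r := by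
  classical
  have := Fintype.ofFinite (κ ⧸ H)
  have := Fintype.ofFinite H
  have hfib : ∀ q : κ ⧸ H, ∀ h : H, f (AddSubgroup.addGroupEquivQuotientProdAddSubgroup.symm
      (q, h)) = f (AddSubgroup.addGroupEquivQuotientProdAddSubgroup.symm (q, (0 : H))) := by
    intro q h
    set e := AddSubgroup.addGroupEquivQuotientProdAddSubgroup (s := H)
    have hmk : ∀ x : H, ((e.symm (q, x) : κ) : κ ⧸ H) = q := fun x => by
      have h1 : (e (e.symm (q, x))).1 = ((e.symm (q, x) : κ) : κ ⧸ H) := rfl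
      rw [← h1, Equiv.apply_symm_apply]
    have h2 := QuotientAddGroup.eq.mp ((hmk 0).trans (hmk h).symm)
    have := hf (e.symm (q, (0 : H))) _ h2
    rwa [add_neg_cancel_left] at this
  rw [← Equiv.sum_comp (AddSubgroup.addGroupEquivQuotientProdAddSubgroup (s := H)).symm f,
    Fintype.sum_prod_type]
  refine Finset.dvd_sum fun q _ => ?_
  rw [Finset.sum_congr rfl fun h _ => hfib q h, Finset.sum_const, Finset.card_univ,
    ← Nat.card_eq_fintype_card, nsmul_eq_mul, mul_comm m]
  exact mul_dvd_mul_left _ (hm _)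

end GroupTheory

section ResidueField

namespace BruhatTits

variable {K : Type*} [Field K] (O : ValuationSubring K)

/-- The diagonal entries modulo the maximal ideal of the elements of the Iwahori subgroup. -/
noncomputable def iwahoriDiag (i : Fin 2) : iwahori O →* IsLocalRing.ResidueField O where
  toFun s := IsLocalRing.residue O ⟨s.1.1 i i, s.2.1.1 i i⟩
  map_one' := by
    rw [← map_one (IsLocalRing.residue O)]
    refine congrArg _ (Subtype.ext ?_)
    simp
  map_mul' s t := by
    rw [← map_mul, ← sub_eq_zero, ← map_sub, IsLocalRing.residue_eq_zero_iff,
      ValuationSubring.valuation_lt_one_iff]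
    change O.valuation ((s.1 * t.1).1 i i - s.1.1 i i * t.1.1 i i) < 1
    rw [Units.val_mul, Matrix.mul_apply, Fin.sum_univ_two]
    have hs := (O.valuation_le_one_iff _).mpr (s.2.1.1 0 1)
    have ht := (O.valuation_le_one_iff _).mpr (t.2.1.1 0 1)
    fin_cases i
    · change O.valuation (s.1.1 0 0 * t.1.1 0 0 + s.1.1 0 1 * t.1.1 1 0 - s.1.1 0 0 * t.1.1 0 0) < 1
      rw [add_sub_cancel_left, map_mul]
      exact mul_lt_one_of_nonneg_of_lt_one_right hs zero_le t.2.2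
    · change O.valuation (s.1.1 1 0 * t.1.1 0 1 + s.1.1 1 1 * t.1.1 1 1 - s.1.1 1 1 * t.1.1 1 1) < 1
      rw [add_sub_cancel_right, map_mul]
      exact mul_lt_one_of_nonneg_of_lt_one_left zero_le s.2.2 ht

end BruhatTits

end ResidueField

/-- A quadratic polynomial over a finite field that has a double root in an extension is a square. -/
theorem exists_double_root {k κ : Type*} [Field k] [Finite k] [Field κ] (i : k →+* κ) {t d : k}
    {α : κ} (ht : i t = 2 * α) (hd : i d = α ^ 2) : ∃ a, i a = α ∧ t = 2 * a ∧ d = a ^ 2 := by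
  have key : ∀ a, i a = α → t = 2 * a ∧ d = a ^ 2 := by
    rintro a rfl
    exact ⟨i.injective (by rw [ht, map_mul, map_ofNat]), i.injective (by rw [hd, map_pow])⟩
  -- In characteristic two the trace carries no information, but every element of a finite field is
  -- then a square; otherwise the root is half the trace.
  by_cases h2 : ringChar k = 2
  · obtain ⟨a, ha⟩ := FiniteField.isSquare_of_char_two h2 d
    have : CharP k 2 := ringChar.of_eq h2
    have : CharP κ 2 := charP_of_injective_ringHom i.injective 2
    have h : i a = α := by
      have h1 : (i a - α) ^ 2 = 0 := by
        rw [sub_sq, mul_assoc, CharTwo.two_eq_zero (R := κ), zero_mul, sub_zero, ← map_pow, sq a,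
          ← ha, hd, CharTwo.add_self_eq_zero]
      exact sub_eq_zero.mp (pow_eq_zero_iff two_ne_zero |>.mp h1)
    exact ⟨a, h, key a h⟩
  · have h20 : (2 : k) ≠ 0 := Ring.two_ne_zero h2
    have h : i (t / 2) = α := by
      rw [map_div₀, ht, map_ofNat, mul_div_cancel_left₀]
      rw [← map_ofNat i]
      exact (map_ne_zero i).mpr h20
    exact ⟨t / 2, h, key _ h⟩

/-- Powers of a matrix with a double eigenvalue. -/
theorem Matrix.pow_eq_of_double_root {F : Type*} [Field F] {M : Matrix (Fin 2) (Fin 2) F} {a : F}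
    (ht : M.trace = 2 * a) (hd : M.det = a ^ 2) (n : ℕ) :
    a • M ^ n = a ^ (n + 1) • (1 : Matrix (Fin 2) (Fin 2) F) + (n * a ^ n) • (M - a • 1) := by
  -- Cayley–Hamilton: `M - a` has square zero. The additional factor `a` in the formula avoids the
  -- exponent `n - 1`.
  have hsq : (M - a • (1 : Matrix (Fin 2) (Fin 2) F)) * M = a • (M - a • 1) := by
    rw [Matrix.trace_fin_two] at ht
    rw [Matrix.det_fin_two] at hd
    have h3 : M 1 1 = 2 * a - M 0 0 := by rw [← ht]; ring
    rw [h3] at hd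
    have h4 : M 0 1 * M 1 0 = -(M 0 0 - a) ^ 2 := by linear_combination -hd
    ext i j
    rw [Matrix.mul_apply, Fin.sum_univ_two]
    fin_cases i <;> fin_cases j <;> simp [h3]
    · linear_combination h4
    · ring
    · ring
    · linear_combination h4
  induction n with
  | zero => simp
  | succ n ih =>
    rw [pow_succ, ← Matrix.smul_mul, ih, add_mul, Matrix.smul_mul, Matrix.smul_mul, hsq, one_mul]
    have h5 : M = a • (1 : Matrix (Fin 2) (Fin 2) F) + (M - a • 1) := by abel
    conv_lhs => rw [h5]
    rw [add_sub_cancel_left]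
    push_cast
    module

/-! ### Edge stabilizers as products of a toral, a scalar and a unipotent contribution. -/

namespace Place

open BruhatTits

variable {k F : Type*} [Field k] [Field F] [Algebra k F] {P : Place k F}

/-- The stabilizer in `Γ` of the edge given by a matrix. -/
def edgeSubgroup (P : Place k F) (Γ : Subgroup (GL (Fin 2) F)) (g : GL (Fin 2) F) :
    Subgroup (GL (Fin 2) F) :=
  Γ ⊓ (iwahori P.ring).comap (MulAut.conj g⁻¹).toMonoidHom

theorem mem_edgeSubgroup {Γ : Subgroup (GL (Fin 2) F)} {g γ : GL (Fin 2) F} :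
    γ ∈ P.edgeSubgroup Γ g ↔ γ ∈ Γ ∧ g⁻¹ * γ * g ∈ iwahori P.ring := by
  rw [edgeSubgroup, Subgroup.mem_inf, Subgroup.mem_comap]
  simp [mul_assoc]

theorem glMap_smul_edgeOf_eq_iff {π : F} (hπ : P.ring.IsUniformizer π) {γ g : GL (Fin 2) F}
    (hγ : P.ring.valuation γ.1.det = 1) :
    P.glMap γ • edgeOf hπ g = edgeOf hπ g ↔ g⁻¹ * γ * g ∈ iwahori P.ring := by
  rw [glMap_smul_edgeOf, eq_comm, edgeOf_eq_edgeOf_iff, mul_assoc]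
  rw [← mul_assoc, Units.val_mul, Units.val_mul, Matrix.det_mul, Matrix.det_mul, mul_right_comm,
    ← Matrix.det_mul, ← Units.val_mul, inv_mul_cancel, Units.val_one, Matrix.det_one, one_mul, hγ]

/-- The stabilizer of an edge in terms of matrices over the function field. -/
noncomputable def edgeStabilizerEquiv {π : F} (hπ : P.ring.IsUniformizer π)
    {Γ : Subgroup (GL (Fin 2) F)} (hΓ : ∀ γ ∈ Γ, P.ring.valuation γ.1.det = 1)
    (g : GL (Fin 2) F) :
    P.edgeSubgroup Γ g ≃ P.edgeStabilizer Γ (edgeOf hπ g) :=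
  Equiv.ofBijective (fun γ => ⟨⟨P.glMap γ.1, γ.1, (mem_edgeSubgroup.mp γ.2).1, rfl⟩,
    (glMap_smul_edgeOf_eq_iff hπ (hΓ _ (mem_edgeSubgroup.mp γ.2).1)).mpr
      (mem_edgeSubgroup.mp γ.2).2⟩) (by
    constructor
    · intro γ γ' h
      exact Subtype.ext (P.glMap_injective (congrArg (fun x => x.1.1) h))
    · rintro ⟨⟨_, γ, hγ, rfl⟩, h⟩
      exact ⟨⟨γ, mem_edgeSubgroup.mpr ⟨hγ, (glMap_smul_edgeOf_eq_iff hπ (hΓ _ hγ)).mp h⟩⟩, rfl⟩)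

/-- The scalar matrices in a linear group. -/
def scalarSubgroup {K : Type*} [Field K] (Γ : Subgroup (GL (Fin 2) K)) : Subgroup (GL (Fin 2) K) :=
  Γ ⊓ (Matrix.GeneralLinearGroup.scalar (Fin 2)).range

variable [Finite k] (hF : IsFunctionFieldOfCurve k F)

include hF

variable {Y : Submodule P.regularAway (Fin 2 → F)} (hY : P.IsALattice Y)
  {Γ : Subgroup (GL (Fin 2) F)} (hΓ : Γ ≤ P.stabLattice Y)

include hY hΓ

omit hΓ in
-- Transvections in all directions leave only scalars in the centre.
theorem card_center {𝔞 : Ideal P.regularAway} (h𝔞 : 𝔞 ≠ ⊥) (hΓ' : P.congruenceSubgroup Y 𝔞 ≤ Γ) :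
    Nat.card (Subgroup.center Γ) = Nat.card (scalarSubgroup Γ) := by
  rw [← Subgroup.card_map_of_injective (K := Subgroup.center Γ) Γ.subtype_injective]
  congr 2
  ext γ
  constructor
  · rintro ⟨⟨γ, hγ⟩, hγc, rfl⟩
    refine ⟨hγ, ?_⟩
    obtain ⟨c, hc⟩ := hY.exists_eq_scalarGL hF h𝔞 (γ := γ) fun u hu =>
      congrArg Subtype.val (Subgroup.mem_center_iff.mp hγc ⟨u, hΓ' hu⟩)
    exact ⟨c, hc.symm⟩
  · rintro ⟨hγ, c, rfl⟩
    refine ⟨⟨_, hγ⟩, Subgroup.mem_center_iff.mpr fun u => Subtype.ext ?_, rfl⟩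
    exact (Matrix.GeneralLinearGroup.scalar_commute c u.1).symm

theorem finite_edgeSubgroup (g : GL (Fin 2) F) : Finite (P.edgeSubgroup Γ g) :=
  ((hY.finite_stabilizer hF g).subset fun _ hγ =>
    ⟨hΓ (mem_edgeSubgroup.mp hγ).1, (mem_edgeSubgroup.mp hγ).2.1⟩ : Set.Finite _)

/-- The elements of a scalar subgroup have entries among the constants. -/
theorem exists_eq_of_scalarGL_mem {c : Fˣ} (hc : scalarGL c ∈ Γ) :
    ∃ a : k, algebraMap k F a = c := by
  obtain ⟨d, hd⟩ := hY.det_mem_range hF (hΓ hc)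
  rw [Matrix.GeneralLinearGroup.coe_scalar, Matrix.scalar_apply, Matrix.det_diagonal,
    Fin.prod_univ_two] at hd
  refine hF.constants _ ⟨Polynomial.X ^ 2 - Polynomial.C d, ?_, ?_⟩
  · exact Polynomial.X_pow_sub_C_ne_zero two_pos d
  · simp [hd, sq]

theorem scalarSubgroup_le_edgeSubgroup (g : GL (Fin 2) F) :
    scalarSubgroup Γ ≤ P.edgeSubgroup Γ g := by
  rintro _ ⟨hγ, c, rfl⟩
  refine mem_edgeSubgroup.mpr ⟨hγ, ?_⟩
  rw [mul_assoc, Matrix.GeneralLinearGroup.scalar_commute c g,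
    inv_mul_cancel_left, mem_iwahori_iff, mem_integralGL_iff]
  refine ⟨⟨fun i j => ?_, hY.valuation_det hF (hΓ hγ)⟩, ?_⟩
  · obtain ⟨a, ha⟩ := exists_eq_of_scalarGL_mem hF hY hΓ hγ
    rw [Matrix.GeneralLinearGroup.coe_scalar, Matrix.scalar_apply, Matrix.diagonal_apply, ← ha]
    split_ifs
    · exact P.algebraMap_mem a
    · exact zero_mem _
  · rw [Matrix.GeneralLinearGroup.coe_scalar, Matrix.scalar_apply]
    simp

/-- The structure of the stabilizers of edges. -/
theorem exists_card_edgeSubgroup (g : GL (Fin 2) F) :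
    ∃ (U : Subgroup (GL (Fin 2) F)) (m : ℕ), U ≤ P.edgeSubgroup Γ g ∧
      (∀ u ∈ U, u.1.trace = 2 ∧ u.1.det = 1) ∧
      m ∣ Nat.card (IsLocalRing.ResidueField P.ring) - 1 ∧
      Nat.card (P.edgeSubgroup Γ g) = m * Nat.card (scalarSubgroup Γ) * Nat.card U := by
  set H := P.edgeSubgroup Γ g
  have := P.finite_residueField hF
  let i : k →+* IsLocalRing.ResidueField P.ring := P.residueHom
  let conj : H →* iwahori P.ring := ((MulAut.conj g⁻¹).toMonoidHom.comp H.subtype).codRestrict _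
    fun γ => γ.2.2
  have hconj : ∀ γ : H, (conj γ).1 = g⁻¹ * γ.1 * g := fun γ => by simp [conj]
  let χ : Fin 2 → H →* (IsLocalRing.ResidueField P.ring)ˣ := fun j =>
    ((iwahoriDiag P.ring j).comp conj).toHomUnits
  have hχ : ∀ j γ, ((χ j γ : (IsLocalRing.ResidueField P.ring)ˣ) : IsLocalRing.ResidueField P.ring)
    = IsLocalRing.residue P.ring ⟨(conj γ).1.1 j j, (conj γ).2.1.1 j j⟩ := fun j γ => rfl
  have hdet : ∀ γ : H, γ.1.1.det = (conj γ).1.1.det := fun γ => by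
    rw [hconj, Units.val_mul, Units.val_mul, Matrix.det_mul_right_comm, ← Units.val_mul,
      inv_mul_cancel, Units.val_one, Matrix.one_mul]
  have htr : ∀ γ : H, γ.1.1.trace = (conj γ).1.1.trace := fun γ => by
    rw [hconj, Units.val_mul, Matrix.trace_mul_comm, ← Units.val_mul, ← mul_assoc,
      mul_inv_cancel, one_mul]
  have hi : ∀ a : k, ∀ x (hx : x ∈ P.ring), algebraMap k F a = x →
      i a = IsLocalRing.residue P.ring ⟨x, hx⟩ := by
    rintro a x hx rfl; rfl
  -- Trace and determinant are in `A` and have no pole at `P`, so they are constants. Their residues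
  -- are `2α` and `α²`, where `α` is the common residue of the diagonal entries; since `k` is
  -- finite, this double root is in `k`.
  have hk : ∀ γ : H, χ 0 γ = χ 1 γ → ∃ a : k, i a = χ 0 γ ∧ γ.1.1.trace = 2 * algebraMap k F a ∧
      γ.1.1.det = (algebraMap k F a) ^ 2 := by
    intro γ hγ
    have hγY : γ.1 ∈ P.stabLattice Y := hΓ (mem_edgeSubgroup.mp γ.2).1
    obtain ⟨d, hd⟩ := hY.det_mem_range hF hγY
    have m00 := (conj γ).2.1.1 0 0
    have m01 := (conj γ).2.1.1 0 1
    have m10 := (conj γ).2.1.1 1 0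
    have m11 := (conj γ).2.1.1 1 1
    have htrO : (conj γ).1.1.trace ∈ P.ring := by
      rw [Matrix.trace_fin_two]; exact add_mem m00 m11
    obtain ⟨t, ht⟩ := P.mem_range_of_mem_regularAway hF
      (hY.trace_mem hF fun y hy => (hγY y).mpr hy)
      ((P.ring.valuation_le_one_iff _).mpr (by rwa [htr]))
    have h1 : i t = 2 * (χ 0 γ : IsLocalRing.ResidueField P.ring) := by
      rw [two_mul]
      nth_rewrite 2 [hγ]
      rw [hχ, hχ, ← map_add, hi t _ htrO (ht.trans (htr γ))]
      refine congrArg _ (Subtype.ext ?_)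
      exact Matrix.trace_fin_two _
    have h2 : i d = (χ 0 γ : IsLocalRing.ResidueField P.ring) ^ 2 := by
      rw [sq]
      nth_rewrite 2 [hγ]
      rw [hχ, hχ, ← map_mul, hi d _ (sub_mem (mul_mem m00 m11) (mul_mem m01 m10))
        (hd.trans ((hdet γ).trans (Matrix.det_fin_two _))), ← sub_eq_zero, ← map_sub,
        IsLocalRing.residue_eq_zero_iff, ValuationSubring.valuation_lt_one_iff]
      change P.ring.valuation ((conj γ).1.1 0 0 * (conj γ).1.1 1 1 -
        (conj γ).1.1 0 1 * (conj γ).1.1 1 0 - (conj γ).1.1 0 0 * (conj γ).1.1 1 1) < 1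
      rw [sub_right_comm, sub_self, zero_sub, Valuation.map_neg, map_mul]
      exact mul_lt_one_of_nonneg_of_lt_one_right ((P.ring.valuation_le_one_iff _).mpr m01)
        zero_le (conj γ).2.2
    obtain ⟨a, ha, hat, had⟩ := exists_double_root i h1 h2
    refine ⟨a, ha, ?_, ?_⟩
    · rw [← ht, hat, map_mul, map_ofNat]
    · rw [← hd, had, map_pow]
  let f : H →* (IsLocalRing.ResidueField P.ring)ˣ := χ 0 / χ 1
  have hf : ∀ γ, γ ∈ f.ker ↔ χ 0 γ = χ 1 γ := fun γ => by
    rw [MonoidHom.mem_ker]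
    exact div_eq_one
  let Z : Subgroup H := (scalarSubgroup Γ).subgroupOf H
  have hZc : ∀ z ∈ Z, ∃ a : k, z.1.1 = algebraMap k F a • 1 ∧ i a = χ 0 z ∧ i a = χ 1 z := by
    rintro ⟨z, hzH⟩ hz
    obtain ⟨hzΓ, c, hc⟩ := Subgroup.mem_subgroupOf.mp hz
    change scalarGL c = z at hc
    subst hc
    obtain ⟨a, ha⟩ := exists_eq_of_scalarGL_mem hF hY hΓ hzΓ
    have e0 : (conj ⟨scalarGL c, hzH⟩).1 = scalarGL c := by
      rw [hconj]
      change g⁻¹ * scalarGL c * g = _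
      rw [mul_assoc, Matrix.GeneralLinearGroup.scalar_commute c g,
        inv_mul_cancel_left]
    have e1 : (scalarGL c).1 = algebraMap k F a • (1 : Matrix (Fin 2) (Fin 2) F) := by
      rw [ha, Matrix.GeneralLinearGroup.coe_scalar, Matrix.scalar_apply,
        ← Matrix.smul_one_eq_diagonal]
    have e2 : ∀ j, algebraMap k F a = (conj ⟨scalarGL c, hzH⟩).1.1 j j := fun j => by
      rw [e0, e1]; simp
    exact ⟨a, e1, hi a _ _ (e2 0), hi a _ _ (e2 1)⟩
  -- The group `U` consists of the elements whose two diagonal residues are `1`, and `m` is the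
  -- order of the image of `χ 0 / χ 1`, a subgroup of the units of the residue field.
  refine ⟨(f.ker ⊓ (χ 0).ker).map H.subtype, Nat.card f.range, ?_, ?_, ?_, ?_⟩
  · rintro _ ⟨u, -, rfl⟩
    exact u.2
  · rintro _ ⟨u, ⟨hu1, hu2⟩, rfl⟩
    obtain ⟨a, ha, hat, had⟩ := hk u ((hf u).mp hu1)
    rw [MonoidHom.mem_ker.mp hu2, Units.val_one, ← map_one i] at ha
    rw [i.injective ha, map_one] at hat had
    exact ⟨hat.trans (mul_one 2), had.trans (one_pow 2)⟩
  · rw [← Nat.card_units]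
    exact Subgroup.card_subgroup_dvd_card _
  · have hZcard : Nat.card Z = Nat.card (scalarSubgroup Γ) :=
      Nat.card_congr (Subgroup.subgroupOfEquivOfLe
        (scalarSubgroup_le_edgeSubgroup hF hY hΓ g)).toEquiv
    rw [Subgroup.card_map_of_injective H.subtype_injective, ← hZcard]
    refine Subgroup.card_eq_of_ker_inf_ker f (χ 0) Z ?_ ?_ ?_
    · intro z hz
      obtain ⟨a, -, h1, h2⟩ := hZc z hz
      exact (hf z).mpr (Units.ext (h1.symm.trans h2))
    · intro z hz hz1
      obtain ⟨a, h0, h1, -⟩ := hZc z hz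
      rw [hz1, Units.val_one, ← map_one i] at h1
      rw [i.injective h1, map_one, one_smul] at h0
      exact Subtype.ext (Units.ext h0)
    · intro γ hγ
      obtain ⟨a, ha, hat, had⟩ := hk γ ((hf γ).mp hγ)
      have ha0 : algebraMap k F a ≠ 0 := by
        intro h
        rw [h, zero_pow two_ne_zero] at had
        exact γ.1.det_ne_zero had
      -- The `q`-th power kills the nilpotent part and fixes the constant `a`. So it is a scalar in
      -- `Γ` with the same residue as `γ`, which splits off the scalar part.
      have hpow : (γ.1 ^ Nat.card k).1 = algebraMap k F a • (1 : Matrix (Fin 2) (Fin 2) F) := by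
        have h1 := Matrix.pow_eq_of_double_root hat had (Nat.card k)
        have := Fintype.ofFinite k
        have h2 : ((Nat.card k : ℕ) : F) = 0 := by
          rw [← map_natCast (algebraMap k F), Nat.card_eq_fintype_card, FiniteField.cast_card_eq_zero,
            map_zero]
        have h3 : algebraMap k F a ^ Nat.card k = algebraMap k F a := by
          rw [← map_pow, Nat.card_eq_fintype_card, FiniteField.pow_card]
        rw [h2, zero_mul, zero_smul, add_zero, pow_succ, h3, mul_smul] at h1
        rw [Units.val_pow_eq_pow_val]
        exact smul_right_injective _ ha0 h1
      have hpow' : γ.1 ^ Nat.card k = scalarGL (Units.mk0 _ ha0) := by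
        refine Units.ext ?_
        rw [hpow, Matrix.GeneralLinearGroup.coe_scalar, Matrix.scalar_apply,
          ← Matrix.smul_one_eq_diagonal]
        rfl
      have hmem : γ ^ Nat.card k ∈ Z := by
        refine Subgroup.mem_subgroupOf.mpr ⟨pow_mem (mem_edgeSubgroup.mp γ.2).1 _, _, hpow'.symm⟩
      refine ⟨_, hmem, ?_⟩
      obtain ⟨a', h0, h1, -⟩ := hZc _ hmem
      have h4 : a' = a := by
        refine (algebraMap k F).injective ?_
        have := h0.symm.trans hpow
        have := congrFun (congrFun this 0) 0
        simpa using this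
      exact Units.ext (by rw [← h1, h4, ha])

end Place

/-! ## Divisibility of the values of harmonic cochains -/

namespace Matrix.GeneralLinearGroup

variable {F : Type*} [Field F]

/-- A group of unipotent matrices is conjugate to a group of upper triangular matrices. -/
theorem exists_conj_upper (U : Subgroup (GL (Fin 2) F))
    (hU : ∀ u ∈ U, u.1.trace = 2 ∧ u.1.det = 1) :
    ∃ b : GL (Fin 2) F, ∀ u ∈ U, ∃ β : F, u.1 * b.1 = b.1 * !![1, β; 0, 1] := by
  by_cases h : ∃ u ∈ U, u ≠ 1
  · obtain ⟨u, hu, hu1⟩ := h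
    obtain ⟨ht, hd⟩ := hU u hu
    obtain ⟨x, hx⟩ : ∃ x : Fin 2 → F, u.1.mulVec x - x ≠ 0 := by
      by_contra! hcon
      refine hu1 (Units.ext (Matrix.ext_of_mulVec_single fun i => ?_))
      rw [Units.val_one, Matrix.one_mulVec]
      exact sub_eq_zero.mp (hcon _)
    -- As `(u - 1)² = 0`, the vector `y` is fixed by `u`, and in the basis `y, x` the matrix of `u`
    -- is the standard unipotent one.
    set y := u.1.mulVec x - x with hy
    rw [Matrix.trace_fin_two] at ht
    rw [Matrix.det_fin_two] at hd
    have h11 : u.1 1 1 = 2 - u.1 0 0 := by rw [← ht]; ring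
    have e0 : y 0 = (u.1 0 0 - 1) * x 0 + u.1 0 1 * x 1 := by
      rw [hy, Pi.sub_apply, Matrix.mulVec, dotProduct, Fin.sum_univ_two]; ring
    have e1 : y 1 = u.1 1 0 * x 0 + (1 - u.1 0 0) * x 1 := by
      rw [hy, Pi.sub_apply, Matrix.mulVec, dotProduct, Fin.sum_univ_two, h11]; ring
    rw [h11] at hd
    have huy : u.1.mulVec y = y := by
      ext i
      fin_cases i <;> simp [Matrix.mulVec, dotProduct, Fin.sum_univ_two, h11, e0, e1]
      · linear_combination (-x 0) * hd
      · linear_combination (-x 1) * hd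
    have hyx : crossDet y x ≠ 0 := by
      intro h0
      obtain ⟨c, hc⟩ := exists_smul_of_crossDet_eq_zero hx h0
      have : y = c • y - c • y := by
        conv_lhs => rw [hy]
        rw [hc, Matrix.mulVec_smul, huy]
      rw [sub_self] at this
      exact hx this
    have hux : u.1.mulVec x = x + y := by rw [hy]; abel
    refine ⟨colGL y x hyx, fun u' hu' => ?_⟩
    obtain ⟨ht', hd'⟩ := hU u' hu'
    obtain ⟨htm, -⟩ := hU _ (mul_mem hu' hu)
    set b := colGL y x hyx
    set N := (b⁻¹ * u' * b).1 with hN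
    have hu2 : (b⁻¹ * u * b).1 = !![1, 1; 0, 1] := by
      have h1 : u.1 * b.1 = b.1 * !![1, 1; 0, 1] := by
        have hy0 := congrFun huy 0
        have hy1 := congrFun huy 1
        have hx0 := congrFun hux 0
        have hx1 := congrFun hux 1
        simp only [Matrix.mulVec, dotProduct, Fin.sum_univ_two, Pi.add_apply] at hy0 hy1 hx0 hx1
        ext i j
        rw [coe_colGL, Matrix.mul_apply, Matrix.mul_apply, Fin.sum_univ_two, Fin.sum_univ_two]
        fin_cases i <;> fin_cases j <;> simp
        · exact hy0
        · rw [hx0, add_comm]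
        · exact hy1
        · rw [hx1, add_comm]
      rw [Units.val_mul, Units.val_mul, mul_assoc, h1, ← mul_assoc, ← Units.val_mul,
        inv_mul_cancel, Units.val_one, one_mul]
    have hconj : ∀ w : GL (Fin 2) F, (b⁻¹ * w * b).1.trace = w.1.trace := fun w => by
      rw [Units.val_mul, Matrix.trace_mul_comm, ← Units.val_mul, ← mul_assoc, mul_inv_cancel,
        one_mul]
    have hNt : N 0 0 + N 1 1 = 2 := by
      rw [← Matrix.trace_fin_two, hN, hconj, ht']
    -- The trace of `u' u` exceeds that of `u'` by the lower left entry of `u'` in this basis. Both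
    -- traces are `2`, so every `u'` fixes the line of `y`.
    have hNt2 : N 0 0 + N 1 0 + N 1 1 = 2 := by
      have h2 : b⁻¹ * (u' * u) * b = (b⁻¹ * u' * b) * (b⁻¹ * u * b) := by group
      have h3 := hconj (u' * u)
      rw [htm, h2, Units.val_mul, hu2, ← hN, Matrix.trace_fin_two, Matrix.mul_apply,
        Matrix.mul_apply, Fin.sum_univ_two, Fin.sum_univ_two] at h3
      simp at h3
      rw [← h3]; ring
    have hNd : N.det = 1 := by
      rw [hN, Units.val_mul, Units.val_mul, Matrix.det_mul_right_comm, ← Units.val_mul,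
        inv_mul_cancel, Units.val_one, Matrix.one_mul, hd']
    have h10 : N 1 0 = 0 := by linear_combination hNt2 - hNt
    have h11' : N 1 1 = 2 - N 0 0 := by rw [← hNt]; ring
    have h00 : N 0 0 = 1 := by
      rw [Matrix.det_fin_two, h10, h11'] at hNd
      have : (N 0 0 - 1) ^ 2 = 0 := by linear_combination -hNd
      exact sub_eq_zero.mp (pow_eq_zero_iff two_ne_zero |>.mp this)
    refine ⟨N 0 1, ?_⟩
    have h3 : N = !![1, N 0 1; 0, 1] := by
      ext i j
      fin_cases i <;> fin_cases j
      · exact h00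
      · rfl
      · exact h10
      · simp [h11', h00]; norm_num
    rw [← h3, hN, ← Units.val_mul, ← Units.val_mul]
    congr 1
    group
  · push Not at h
    refine ⟨1, fun u hu => ⟨0, ?_⟩⟩
    rw [h u hu, Units.val_one, one_mul, one_mul]
    ext i j
    fin_cases i <;> fin_cases j <;> rfl

end Matrix.GeneralLinearGroup

/-! ### Iwasawa decomposition relative to the Iwahori subgroup. -/

namespace BruhatTits

variable {K : Type*} [Field K] {O : ValuationSubring K}

theorem lowerGL_mem {x : K} (hx : O.valuation x < 1) :
    Matrix.GeneralLinearGroup.mkOfDetNeZero !![1, 0; x, 1] (by simp) ∈ iwahori O := by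
  rw [mem_iwahori_iff, mem_integralGL_iff]
  change ((∀ i j, !![1, 0; x, 1] i j ∈ O) ∧ O.valuation (!![1, 0; x, 1]).det = 1) ∧
    O.valuation (!![1, 0; x, 1] 1 0) < 1
  refine ⟨⟨fun i j => ?_, by simp⟩, by simpa using hx⟩
  fin_cases i <;> fin_cases j <;>
    simp [O.zero_mem, O.one_mem, (O.valuation_le_one_iff _).mp hx.le]

theorem upperGL_mem {x : K} (hx : x ∈ O) :
    Matrix.GeneralLinearGroup.mkOfDetNeZero !![1, x; 0, 1] (by simp) ∈ iwahori O := by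
  rw [mem_iwahori_iff, mem_integralGL_iff]
  change ((∀ i j, !![1, x; 0, 1] i j ∈ O) ∧ O.valuation (!![1, x; 0, 1]).det = 1) ∧
    O.valuation (!![1, x; 0, 1] 1 0) < 1
  refine ⟨⟨fun i j => ?_, by simp⟩, by simp⟩
  fin_cases i <;> fin_cases j <;> simp [O.zero_mem, O.one_mem, hx]

/-- The Iwasawa decomposition. -/
theorem exists_upper_mul (h : GL (Fin 2) K) :
    ∃ t : GL (Fin 2) K, t.1 1 0 = 0 ∧ ∃ s ∈ iwahori O, h = t * s ∨ h = t * swapGL K * s := by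
  -- A column operation with the larger entry of the lower row clears the smaller one. The operation
  -- is in the Iwahori group; a swap is needed if the surviving entry is the left one.
  by_cases hv : O.valuation (h.1 1 0) < O.valuation (h.1 1 1)
  · have h11 : h.1 1 1 ≠ 0 := by
      intro h0
      rw [h0, map_zero] at hv
      exact not_lt_zero hv
    have hx : O.valuation (h.1 1 0 / h.1 1 1) < 1 := by
      rw [map_div₀]
      exact (div_lt_one₀ (zero_lt_iff.mpr (by simpa using h11))).mpr hv
    refine ⟨h * (Matrix.GeneralLinearGroup.mkOfDetNeZero !![1, 0; h.1 1 0 / h.1 1 1, 1]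
      (by simp))⁻¹, ?_, _, lowerGL_mem hx, Or.inl (by rw [inv_mul_cancel_right])⟩
    rw [Units.val_mul, coe_inv_fin_two, Matrix.mul_apply, Fin.sum_univ_two]
    simp [Matrix.GeneralLinearGroup.mkOfDetNeZero]
    field_simp
    ring
  · have h10 : h.1 1 0 ≠ 0 := by
      intro h0
      rw [h0, map_zero, zero_lt_iff, not_not, map_eq_zero] at hv
      refine h.det_ne_zero ?_
      rw [Matrix.det_fin_two, h0, hv]; ring
    have hx : h.1 1 1 / h.1 1 0 ∈ O := by
      rw [← O.valuation_le_one_iff, map_div₀]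
      exact (div_le_one₀ (zero_lt_iff.mpr (by simpa using h10))).mpr (not_lt.mp hv)
    have hsw : swapGL K * swapGL K = 1 := by
      refine Units.ext ?_
      rw [Units.val_mul, coe_swapGL, Units.val_one]
      ext i j
      fin_cases i <;> fin_cases j <;> simp
    refine ⟨h * (Matrix.GeneralLinearGroup.mkOfDetNeZero !![1, h.1 1 1 / h.1 1 0; 0, 1]
      (by simp))⁻¹ * swapGL K, ?_, _, upperGL_mem hx, Or.inr (by
        rw [mul_assoc _ (swapGL K) (swapGL K), hsw, mul_one, inv_mul_cancel_right])⟩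
    rw [Units.val_mul, Units.val_mul, coe_inv_fin_two, coe_swapGL]
    simp [Matrix.GeneralLinearGroup.mkOfDetNeZero, Matrix.mul_apply, Fin.sum_univ_two]
    field_simp
    ring

end BruhatTits

/-! ### Harmonic cochains as additive functions of balls. -/

namespace Place

open BruhatTits

variable {k F : Type*} [Field k] [Field F] [Algebra k F] {P : Place k F}
  {π : F} (hπ : P.ring.IsUniformizer π)

include hπ

theorem ballGL_zero_zero : ballGL hπ.ne_zero 0 0 = 1 := by
  refine Units.ext ?_
  rw [coe_ballGL, zpow_zero, Units.val_one]
  ext i j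
  fin_cases i <;> fin_cases j <;> rfl

theorem ballGL_zero_mul (β c : F) (n : ℤ) :
    ballGL hπ.ne_zero β 0 * ballGL hπ.ne_zero c n = ballGL hπ.ne_zero (β + c) n := by
  rw [ballGL_mul, zpow_zero, one_mul, zero_add]

theorem edgeOf_ballGL_add (g : GL (Fin 2) F) (c : F) {x : F} (hx : x ∈ P.ring) (n : ℤ) :
    edgeOf hπ (g * ballGL hπ.ne_zero (c + π ^ n * x) n) = edgeOf hπ (g * ballGL hπ.ne_zero c n) := by
  have h1 : ballGL hπ.ne_zero c n * ballGL hπ.ne_zero x 0 = ballGL hπ.ne_zero (c + π ^ n * x) n := by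
    rw [ballGL_mul, add_zero]
  rw [← h1, ← mul_assoc]
  refine (edgeOf_eq_edgeOf_of_mem hπ ?_).symm
  rw [inv_mul_cancel_left]
  convert upperGL_mem hx using 1
  refine Units.ext ?_
  rw [coe_ballGL, zpow_zero]
  rfl

/-- Functions on balls that are additive and invariant under a finite group of translations are
divisible by the order of this group. -/
theorem card_dvd_of_translation_invariant [Fintype (IsLocalRing.ResidueField P.ring)]
    (Ψ : F → ℤ → ℤ) (h2 : ∀ c x n, x ∈ P.ring → Ψ (c + π ^ n * x) n = Ψ c n)
    (h3 : ∀ c n, Ψ c n = ∑ r, Ψ (c + π ^ n * P.residueRep r) (n + 1))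
    (B : AddSubgroup F) [Finite B] (h1 : ∀ β ∈ B, ∀ c n, Ψ (β + c) n = Ψ c n)
    (n : ℤ) (hB : ∀ β ∈ B, π ^ (-n) * β ∈ P.ring) (c : F) :
    (Nat.card B : ℤ) ∣ Ψ c n := by
  -- After `m` subdivisions the balls are so small that no nonzero element of `B` maps one of them
  -- to itself. The proof is by induction on this `m`.
  have hsep : ∃ m : ℕ, ∀ β ∈ B, π ^ (-(n + m)) * β ∈ P.ring → β = 0 := by
    have hex : ∀ β : F, ∃ m : ℕ, β ≠ 0 → ∀ j : ℕ, m ≤ j → π ^ (-(n + j)) * β ∉ P.ring := by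
      intro β
      by_cases hβ : β = 0
      · exact ⟨0, fun h => (h hβ).elim⟩
      obtain ⟨e, he⟩ := hπ.exists_zpow β hβ
      refine ⟨(e - n + 1).toNat, fun _ j hj hmem => ?_⟩
      rw [← ValuationSubring.valuation_le_one_iff, map_mul, map_zpow₀, he,
        ← zpow_add₀ hπ.ne_zero', ← zpow_zero (P.ring.valuation π), hπ.zpow_le_zpow_iff] at hmem
      omega
    choose m hm using hex
    have hfin : (B : Set F).Finite := Set.toFinite _
    obtain ⟨M, hM⟩ := (hfin.image m).bddAbove
    refine ⟨M, fun β hβ hmem => ?_⟩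
    by_contra h0
    exact hm β h0 M (hM ⟨β, hβ, rfl⟩) hmem
  obtain ⟨m, hm⟩ := hsep
  induction m generalizing n B c with
  | zero =>
    have hbot : B = ⊥ := by
      refine (AddSubgroup.eq_bot_iff_forall _).mpr fun β hβ => hm β hβ ?_
      simpa using hB β hβ
    rw [hbot]
    simp
  | succ m ih =>
    -- Through `τ` the group `B` translates the `Q` parts of the ball. The kernel `B'` preserves
    -- each part, so `|B'|` divides each term of the sum; the terms are constant on the cosets of
    -- the image of `τ`, which contributes the factor `|B| / |B'|`.
    let τ : B →+ IsLocalRing.ResidueField P.ring :=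
      { toFun := fun β => IsLocalRing.residue P.ring ⟨π ^ (-n) * β.1, hB β.1 β.2⟩
        map_zero' := by
          rw [← map_zero (IsLocalRing.residue P.ring)]
          refine congrArg _ (Subtype.ext ?_)
          simp
        map_add' := fun β β' => by
          rw [← map_add]
          refine congrArg _ (Subtype.ext ?_)
          exact mul_add _ _ _ }
    let B' : AddSubgroup F := τ.ker.map B.subtype
    have hB'le : B' ≤ B := by
      rintro _ ⟨β, -, rfl⟩; exact β.2
    have : Finite B' := Finite.Set.subset (B : Set F) hB'le
    have hker : ∀ β ∈ B', π ^ (-(n + 1)) * β ∈ P.ring := by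
      rintro _ ⟨β, hβ, rfl⟩
      have h4 : IsLocalRing.residue P.ring ⟨π ^ (-n) * β.1, hB β.1 β.2⟩ = 0 := hβ
      rw [IsLocalRing.residue_eq_zero_iff, ValuationSubring.valuation_lt_one_iff] at h4
      change P.ring.valuation (π ^ (-n) * β.1) < 1 at h4
      change π ^ (-(n + 1)) * β.1 ∈ P.ring
      by_cases hβ0 : β.1 = 0
      · rw [hβ0, mul_zero]; exact zero_mem _
      obtain ⟨e, he⟩ := hπ.exists_zpow β.1 hβ0
      rw [map_mul, map_zpow₀, he, ← zpow_add₀ hπ.ne_zero', ← zpow_zero (P.ring.valuation π),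
        hπ.zpow_lt_zpow_iff] at h4
      rw [← ValuationSubring.valuation_le_one_iff, map_mul, map_zpow₀, he,
        ← zpow_add₀ hπ.ne_zero', ← zpow_zero (P.ring.valuation π), hπ.zpow_le_zpow_iff]
      omega
    have hcard : Nat.card B = Nat.card B' * Nat.card τ.range := by
      rw [← τ.ker.card_mul_index, AddSubgroup.index_ker]
      congr 1
      exact Nat.card_congr (τ.ker.equivMapOfInjective B.subtype B.subtype_injective).toEquiv
    rw [hcard, h3 c n, Nat.cast_mul]
    refine AddSubgroup.mul_card_dvd_sum τ.range _ _ ?_ ?_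
    · rintro r _ ⟨β, rfl⟩
      have hτ : τ β = IsLocalRing.residue P.ring ⟨π ^ (-n) * β.1, hB β.1 β.2⟩ := rfl
      have hlt : P.ring.valuation (P.residueRep (r + τ β) - (P.residueRep r + π ^ (-n) * β.1)) < 1 := by
        rw [valuation_sub_lt_one_iff (residueRep_mem _) (add_mem (residueRep_mem r) (hB β.1 β.2)),
          residue_residueRep, hτ]
        nth_rewrite 1 [← residue_residueRep r]
        rw [← map_add]
        rfl
      have hx : π⁻¹ * (P.residueRep (r + τ β) - (P.residueRep r + π ^ (-n) * β.1)) ∈ P.ring := by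
        by_cases h0 : P.residueRep (r + τ β) - (P.residueRep r + π ^ (-n) * β.1) = 0
        · rw [h0, mul_zero]; exact zero_mem _
        obtain ⟨e, he⟩ := hπ.exists_zpow _ h0
        rw [he, ← zpow_zero (P.ring.valuation π), hπ.zpow_lt_zpow_iff] at hlt
        rw [← ValuationSubring.valuation_le_one_iff, map_mul, he, map_inv₀, ← zpow_neg_one,
          ← zpow_add₀ hπ.ne_zero', ← zpow_zero (P.ring.valuation π), hπ.zpow_le_zpow_iff]
        omega
      have heq : c + π ^ n * P.residueRep (r + τ β) = β.1 + (c + π ^ n * P.residueRep r) +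
          π ^ (n + 1) * (π⁻¹ * (P.residueRep (r + τ β) - (P.residueRep r + π ^ (-n) * β.1))) := by
        have h0 := hπ.ne_zero
        rw [zpow_add₀ h0, zpow_one, mul_assoc, mul_inv_cancel_left₀ h0, zpow_neg]
        have := zpow_ne_zero n h0
        field_simp
        ring
      rw [heq, h2 _ _ _ hx, h1 _ β.2]
    · intro r
      refine ih B' (fun β hβ => h1 β (hB'le hβ)) (n + 1) hker _ fun β hβ hmem => hm β (hB'le hβ) ?_
      push_cast
      rwa [add_comm (m : ℤ), ← add_assoc]

/-- The order of a group of unipotent matrices fixing an edge divides the value at this edge of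
an invariant harmonic cochain. -/
theorem card_dvd_apply_edgeOf [Finite (IsLocalRing.ResidueField P.ring)] {φ : P.TEdge → ℤ}
    (hφ : (treeGraph P.integers).IsHarmonic φ) (U : Subgroup (GL (Fin 2) F)) [Finite U]
    (hU : ∀ u ∈ U, u.1.trace = 2 ∧ u.1.det = 1)
    (hUφ : ∀ u ∈ U, ∀ e, φ (P.glMap u • e) = φ e) (g : GL (Fin 2) F)
    (hUg : ∀ u ∈ U, P.glMap u • edgeOf hπ g = edgeOf hπ g) :
    (Nat.card U : ℤ) ∣ φ (edgeOf hπ g) := by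
  have := Fintype.ofFinite (IsLocalRing.ResidueField P.ring)
  obtain ⟨b, hb⟩ := Matrix.GeneralLinearGroup.exists_conj_upper U hU
  -- One of the two orientations of the edge points to the end fixed by `U`; it is given by a matrix
  -- `b'` that is upper triangular in the basis `b`.
  obtain ⟨b', hbb', hedge⟩ : ∃ b' : GL (Fin 2) F, (b⁻¹ * b').1 1 0 = 0 ∧
      (edgeOf hπ g = edgeOf hπ b' ∨ (edgeOf hπ g).symm = edgeOf hπ b') := by
    obtain ⟨t, ht, s, hs, h | h⟩ := exists_upper_mul (O := P.ring) (b⁻¹ * g)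
    · refine ⟨b * t, by rwa [inv_mul_cancel_left], Or.inl (edgeOf_eq_edgeOf_of_mem hπ ?_).symm⟩
      rwa [mul_inv_rev, mul_assoc, h, inv_mul_cancel_left]
    · refine ⟨b * t * swapGL F * (diagGL hπ.ne_zero * swapGL F), ?_, Or.inr ?_⟩
      · rw [mul_assoc, mul_assoc, inv_mul_cancel_left, Units.val_mul, Units.val_mul,
          Units.val_mul, coe_swapGL, coe_diagGL]
        simp [Matrix.mul_apply, Fin.sum_univ_two, ht]
      · rw [← symm_edgeOf]
        congr 1
        refine (edgeOf_eq_edgeOf_of_mem hπ ?_).symm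
        rwa [mul_assoc b, mul_inv_rev, mul_assoc _ b⁻¹, h, inv_mul_cancel_left]
  have hdvd : (Nat.card U : ℤ) ∣ φ (edgeOf hπ b') := by
    have hfix : ∀ u ∈ U, P.glMap u • edgeOf hπ b' = edgeOf hπ b' := by
      intro u hu
      rcases hedge with h | h
      · rw [← h]; exact hUg u hu
      · rw [← h, ← smul_symm, hUg u hu]
    have hconj : ∀ u ∈ U, ∃ β : F, b'⁻¹ * u * b' = ballGL hπ.ne_zero β 0 := by
      intro u hu
      obtain ⟨β, hβ⟩ := hb u hu
      obtain ⟨t, ht⟩ : ∃ t, t = b⁻¹ * b' := ⟨_, rfl⟩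
      rw [← ht] at hbb'
      have hd : t.1.det ≠ 0 := t.det_ne_zero
      rw [Matrix.det_fin_two, hbb', mul_zero, sub_zero] at hd
      refine ⟨β * t.1 1 1 / t.1 0 0, ?_⟩
      have h1 : u * b = b * ballGL hπ.ne_zero β 0 := by
        refine Units.ext ?_
        rw [Units.val_mul, hβ, Units.val_mul, coe_ballGL, zpow_zero]
      have h2 : ballGL hπ.ne_zero β 0 * t = t * ballGL hπ.ne_zero (β * t.1 1 1 / t.1 0 0) 0 := by
        refine Units.ext ?_
        have h00 := left_ne_zero_of_mul hd
        rw [Units.val_mul, Units.val_mul, coe_ballGL, coe_ballGL, zpow_zero]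
        ext i j
        rw [Matrix.mul_apply, Matrix.mul_apply, Fin.sum_univ_two, Fin.sum_univ_two]
        fin_cases i <;> fin_cases j <;> simp [hbb']
        field_simp
        ring
      have h3 : b' = b * t := by rw [ht, mul_inv_cancel_left]
      rw [h3, mul_assoc, ← mul_assoc u, h1, mul_assoc b, h2, ← mul_assoc b, inv_mul_cancel_left]
    -- In the coordinates of `b'` the group `U` becomes a group of translations, and the edge
    -- becomes the ball with centre `0` and exponent `0`.
    let B : AddSubgroup F :=
      { carrier := {β | b' * ballGL hπ.ne_zero β 0 * b'⁻¹ ∈ U}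
        zero_mem' := by
          change _ ∈ U
          rw [ballGL_zero_zero hπ, mul_one, mul_inv_cancel]
          exact one_mem _
        add_mem' := fun {β β'} h h' => by
          change _ ∈ U
          rw [← ballGL_zero_mul hπ]
          have h1 := U.mul_mem h h'
          rwa [mul_assoc, ← mul_assoc b'⁻¹, ← mul_assoc b'⁻¹, inv_mul_cancel, one_mul, ← mul_assoc,
            mul_assoc b'] at h1
        neg_mem' := fun {β} h => by
          have h1 : ballGL hπ.ne_zero (-β) 0 = (ballGL hπ.ne_zero β 0)⁻¹ := by
            refine eq_inv_of_mul_eq_one_left ?_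
            rw [ballGL_zero_mul hπ, neg_add_cancel, ballGL_zero_zero hπ]
          change _ ∈ U
          rw [h1]
          have h2 := U.inv_mem h
          rwa [mul_inv_rev, mul_inv_rev, inv_inv, ← mul_assoc] at h2 }
    let e : B → U := fun β => ⟨_, β.2⟩
    have he : Function.Bijective e := by
      constructor
      · intro β β' h
        have h1 : b' * ballGL hπ.ne_zero β.1 0 * b'⁻¹ = b' * ballGL hπ.ne_zero β'.1 0 * b'⁻¹ :=
          congrArg Subtype.val h
        rw [mul_left_inj, mul_right_inj] at h1
        exact Subtype.ext (congrArg (fun m : GL (Fin 2) F => m.1 0 1) h1)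
      · rintro ⟨u, hu⟩
        obtain ⟨β, hβ⟩ := hconj u hu
        have h1 : b' * ballGL hπ.ne_zero β 0 * b'⁻¹ = u := by rw [← hβ]; group
        exact ⟨⟨β, by change _ ∈ U; rwa [h1]⟩, Subtype.ext h1⟩
    have : Finite B := Finite.of_injective e he.1
    rw [← Nat.card_congr (Equiv.ofBijective e he)]
    have hb0 : b' = b' * ballGL hπ.ne_zero 0 0 := by
      rw [ballGL_zero_zero hπ, mul_one]
    conv_rhs => rw [hb0]
    refine card_dvd_of_translation_invariant hπ
      (fun c n => φ (edgeOf hπ (b' * ballGL hπ.ne_zero c n))) ?_ ?_ B ?_ 0 ?_ 0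
    · intro c x n hx
      rw [edgeOf_ballGL_add hπ b' c hx]
    · intro c n
      rw [IsHarmonic.apply_edgeOf hπ hφ]
      refine Finset.sum_congr rfl fun r _ => ?_
      rw [mul_assoc, ballGL_mul]
    · intro β hβ c n
      have h1 := hUφ _ hβ (edgeOf hπ (b' * ballGL hπ.ne_zero c n))
      rwa [glMap_smul_edgeOf, ← mul_assoc, inv_mul_cancel_right, mul_assoc,
        ballGL_zero_mul hπ] at h1
    · intro β hβ
      have h1 := hfix _ hβ
      rw [glMap_smul_edgeOf_eq_iff] at h1
      · have h2 : b'⁻¹ * (b' * ballGL hπ.ne_zero β 0 * b'⁻¹) * b' = ballGL hπ.ne_zero β 0 := by group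
        rw [h2] at h1
        have := h1.1.1 0 1
        rw [coe_ballGL] at this
        simpa using this
      · rw [(hU _ hβ).2, map_one]
  rcases hedge with h | h
  · rw [h]; exact hdvd
  · have h1 := hφ.1 (edgeOf hπ g)
    change _ + φ (edgeOf hπ g).symm = 0 at h1
    rw [h] at h1
    rw [eq_neg_of_add_eq_zero_left h1]
    exact hdvd.neg_right

end Place

/-! ## Counting points of lattices in bounded sets -/

namespace Place

open BruhatTits

variable {k F : Type*} [Field k] [Field F] [Algebra k F]

/-- The elements of valuation at most that of `c`. -/
def closedBall (P : Place k F) (c : F) : AddSubgroup F where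
  carrier := {x | P.ring.valuation x ≤ P.ring.valuation c}
  zero_mem' := by simp
  add_mem' := fun {x y} h h' => by
    change P.ring.valuation (x + y) ≤ P.ring.valuation c
    exact Valuation.map_add_le _ h h'
  neg_mem' := fun {x} h => by
    change P.ring.valuation (-x) ≤ P.ring.valuation c
    rwa [Valuation.map_neg]

/-- The vectors that a matrix maps from the standard lattice. -/
def latticeOf (P : Place k F) (g : GL (Fin 2) F) : AddSubgroup (Fin 2 → F) where
  carrier := {x | ∀ i, (g⁻¹).1.mulVec x i ∈ P.ring}
  zero_mem' := fun i => by
    rw [Matrix.mulVec_zero]; exact zero_mem _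
  add_mem' := fun h h' i => by
    rw [Matrix.mulVec_add]; exact add_mem (h i) (h' i)
  neg_mem' := fun h i => by
    rw [Matrix.mulVec_neg]; exact neg_mem (h i)

variable {P : Place k F}

theorem mem_closedBall {c x : F} : x ∈ P.closedBall c ↔ P.ring.valuation x ≤ P.ring.valuation c := Iff.rfl

theorem mem_latticeOf {g : GL (Fin 2) F} {x : Fin 2 → F} :
    x ∈ P.latticeOf g ↔ ∀ i, (g⁻¹).1.mulVec x i ∈ P.ring := Iff.rfl

theorem mem_closedBall_iff_div {c x : F} (hc : c ≠ 0) : x ∈ P.closedBall c ↔ x / c ∈ P.ring := by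
  rw [mem_closedBall, ← ValuationSubring.valuation_le_one_iff, map_div₀,
    div_le_one₀ (zero_lt_iff.mpr (by simpa using hc))]

theorem mulVec_mem_latticeOf_iff {g h : GL (Fin 2) F} {x : Fin 2 → F} :
    h.1.mulVec x ∈ P.latticeOf g ↔ x ∈ P.latticeOf (h⁻¹ * g) := by
  rw [mem_latticeOf, mem_latticeOf, Matrix.mulVec_mulVec, ← Units.val_mul, mul_inv_rev, inv_inv]

theorem mulVec_mem_ring {M : Matrix (Fin 2) (Fin 2) F} (hM : ∀ i j, M i j ∈ P.ring)
    {x : Fin 2 → F} (hx : ∀ i, x i ∈ P.ring) (i : Fin 2) : M.mulVec x i ∈ P.ring := by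
  rw [Matrix.mulVec, dotProduct, Fin.sum_univ_two]
  exact add_mem (mul_mem (hM _ _) (hx _)) (mul_mem (hM _ _) (hx _))

theorem latticeOf_le {g h : GL (Fin 2) F} (hgh : ∀ i j, (h⁻¹ * g).1 i j ∈ P.ring) :
    P.latticeOf g ≤ P.latticeOf h := fun x hx => by
  have h1 : (h⁻¹).1.mulVec x = (h⁻¹ * g).1.mulVec ((g⁻¹).1.mulVec x) := by
    rw [Matrix.mulVec_mulVec, ← Units.val_mul, mul_inv_cancel_right]
  rw [mem_latticeOf, h1]
  exact mulVec_mem_ring hgh hx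

theorem latticeOf_mul_of_mem {g s : GL (Fin 2) F} (hs : s ∈ integralGL P.ring) :
    P.latticeOf (g * s) = P.latticeOf g := by
  refine le_antisymm (latticeOf_le fun i j => ?_) (latticeOf_le fun i j => ?_)
  · rw [inv_mul_cancel_left]; exact hs.1 i j
  · rw [mul_inv_rev, inv_mul_cancel_right]; exact hs.2 i j

variable [Finite k] (hF : IsFunctionFieldOfCurve k F)
  {π : F} (hπ : P.ring.IsUniformizer π)

include hF hπ

omit [Finite k] hF in
-- Division by `d` and reduction identify the quotient of the ball of `d` by that of `d π` with the
-- residue field.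
theorem relIndex_closedBall (c : F) (hc : c ≠ 0) (n : ℕ) :
    (P.closedBall (c * π ^ n)).relIndex (P.closedBall c) = Nat.card (IsLocalRing.ResidueField P.ring) ^ n := by
  have hπ0 := hπ.ne_zero
  have hle : ∀ n, P.closedBall (c * π ^ (n + 1)) ≤ P.closedBall (c * π ^ n) := fun n x hx => by
    refine mem_closedBall.mpr (le_trans (mem_closedBall.mp hx) ?_)
    rw [pow_succ, ← mul_assoc, map_mul _ (c * π ^ n)]
    exact mul_le_of_le_one_right' hπ.lt_one.le
  have hle' : ∀ n, P.closedBall (c * π ^ n) ≤ P.closedBall c := fun n => by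
    induction n with
    | zero => rw [pow_zero, mul_one]
    | succ n ih => exact (hle n).trans ih
  have hstep : ∀ d : F, d ≠ 0 → (P.closedBall (d * π)).relIndex (P.closedBall d) =
      Nat.card (IsLocalRing.ResidueField P.ring) := by
    intro d hd
    let ρ : P.closedBall d →+ IsLocalRing.ResidueField P.ring :=
      { toFun := fun x => IsLocalRing.residue P.ring ⟨x.1 / d, (mem_closedBall_iff_div hd).mp x.2⟩
        map_zero' := by
          rw [← map_zero (IsLocalRing.residue P.ring)]
          exact congrArg _ (Subtype.ext (zero_div d))
        map_add' := fun x y => by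
          rw [← map_add]
          exact congrArg _ (Subtype.ext (add_div _ _ d)) }
    have hker : ρ.ker = (P.closedBall (d * π)).addSubgroupOf (P.closedBall d) := by
      ext x
      rw [AddMonoidHom.mem_ker, AddSubgroup.mem_addSubgroupOf]
      change IsLocalRing.residue P.ring ⟨x.1 / d, (mem_closedBall_iff_div hd).mp x.2⟩ = 0 ↔
        P.ring.valuation x.1 ≤ P.ring.valuation (d * π)
      rw [IsLocalRing.residue_eq_zero_iff, ValuationSubring.valuation_lt_one_iff]
      change P.ring.valuation (x.1 / d) < 1 ↔ _
      have hd0 : 0 < P.ring.valuation d := zero_lt_iff.mpr (by simpa using hd)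
      rw [map_div₀, div_lt_one₀ hd0]
      by_cases hx : x.1 = 0
      · rw [hx, map_zero]; exact ⟨fun _ => zero_le, fun _ => hd0⟩
      obtain ⟨m, hm⟩ := hπ.exists_zpow x.1 hx
      obtain ⟨e, he⟩ := hπ.exists_zpow d hd
      rw [map_mul, hm, he, ← zpow_add_one₀ hπ.ne_zero', hπ.zpow_lt_zpow_iff, hπ.zpow_le_zpow_iff]
      rfl
    rw [AddSubgroup.relIndex, ← hker, AddSubgroup.index_ker]
    have hsurj : Function.Surjective ρ := fun r => by
      have hmem : P.residueRep r * d ∈ P.closedBall d := by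
        rw [mem_closedBall_iff_div hd, mul_div_cancel_right₀ _ hd]; exact residueRep_mem r
      refine ⟨⟨_, hmem⟩, ?_⟩
      refine Eq.trans (congrArg (IsLocalRing.residue P.ring) (Subtype.ext ?_)) (residue_residueRep r)
      exact mul_div_cancel_right₀ _ hd
    rw [AddMonoidHom.range_eq_top.mpr hsurj]
    exact Nat.card_congr AddSubgroup.topEquiv.toEquiv
  induction n with
  | zero => rw [pow_zero, mul_one, AddSubgroup.relIndex_self, pow_zero]
  | succ n ih =>
    rw [← AddSubgroup.relIndex_mul_relIndex _ _ _ (hle n) (hle' n), ih, pow_succ, ← mul_assoc,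
      hstep _ (mul_ne_zero hc (pow_ne_zero n hπ0)), pow_succ, mul_comm]

omit [Finite k] hF in
/-- The index of a sublattice of the standard lattice. -/
theorem relIndex_latticeOf_one {g : GL (Fin 2) F} (hg : ∀ i j, g.1 i j ∈ P.ring) {n : ℕ}
    (hn : P.ring.valuation g.1.det = P.ring.valuation π ^ n) :
    (P.latticeOf g).relIndex (P.latticeOf 1) = Nat.card (IsLocalRing.ResidueField P.ring) ^ n := by
  have hπ0 := hπ.ne_zero
  -- By the Iwasawa decomposition, `g` may be replaced by an upper triangular matrix with the same
  -- lattice.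
  obtain ⟨t, ht, htg, htL, htd⟩ : ∃ t : GL (Fin 2) F, t.1 1 0 = 0 ∧ (∀ i j, t.1 i j ∈ P.ring) ∧
      P.latticeOf t = P.latticeOf g ∧ P.ring.valuation t.1.det = P.ring.valuation g.1.det := by
    obtain ⟨t, ht, s, hs, hts⟩ := exists_upper_mul (O := P.ring) g
    obtain ⟨s', hs', hts'⟩ : ∃ s' ∈ integralGL P.ring, g = t * s' := by
      rcases hts with h | h
      · exact ⟨s, hs.1, h⟩
      · exact ⟨_, mul_mem (swapGL_mem) hs.1, by rw [h, mul_assoc]⟩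
    refine ⟨t, ht, fun i j => ?_, ?_, ?_⟩
    · have h1 : t = g * s'⁻¹ := by rw [hts', mul_inv_cancel_right]
      rw [h1, Units.val_mul, Matrix.mul_apply, Fin.sum_univ_two]
      exact add_mem (mul_mem (hg _ _) (hs'.2 _ _)) (mul_mem (hg _ _) (hs'.2 _ _))
    · rw [hts', latticeOf_mul_of_mem hs']
    · rw [hts', Units.val_mul, Matrix.det_mul, map_mul, ((mem_integralGL_iff _).mp hs').2, mul_one]
  rw [← htL]
  rw [← htd, Matrix.det_fin_two, ht, mul_zero, sub_zero] at hn
  have hd : t.1.det ≠ 0 := t.det_ne_zero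
  rw [Matrix.det_fin_two, ht, mul_zero, sub_zero] at hd
  have ha := left_ne_zero_of_mul hd
  have hdd := right_ne_zero_of_mul hd
  set a := t.1 0 0
  set b := t.1 0 1
  set d := t.1 1 1
  have hexp : ∀ x : F, x ≠ 0 → x ∈ P.ring → ∃ n : ℕ, P.ring.valuation x = P.ring.valuation π ^ n := by
    intro x hx hxO
    obtain ⟨m, hm⟩ := hπ.exists_zpow x hx
    rw [← ValuationSubring.valuation_le_one_iff, hm, ← zpow_zero (P.ring.valuation π),
      hπ.zpow_le_zpow_iff] at hxO
    exact ⟨m.toNat, by rw [hm, ← zpow_natCast, Int.toNat_of_nonneg hxO]⟩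
  obtain ⟨i, hi⟩ := hexp a ha (htg 0 0)
  obtain ⟨j, hj⟩ := hexp d hdd (htg 1 1)
  have hij : n = i + j := by
    rw [map_mul, hi, hj, ← pow_add, ← zpow_natCast, ← zpow_natCast] at hn
    have := le_antisymm (hπ.zpow_le_zpow_iff.mp hn.le) (hπ.zpow_le_zpow_iff.mp hn.ge)
    exact_mod_cast this
  have hball : ∀ c : F, ∀ m : ℕ, P.ring.valuation c = P.ring.valuation π ^ m →
      (P.closedBall c).relIndex (P.closedBall 1) = Nat.card (IsLocalRing.ResidueField P.ring) ^ m := by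
    intro c m hc
    rw [← relIndex_closedBall hπ 1 one_ne_zero m, one_mul]
    congr 1
    ext x
    rw [mem_closedBall, mem_closedBall, hc, map_pow]
  have hone : ∀ x : F, x ∈ P.closedBall 1 ↔ x ∈ P.ring := fun x => by
    rw [mem_closedBall, map_one, ValuationSubring.valuation_le_one_iff]
  have hstd : ∀ x : Fin 2 → F, x ∈ P.latticeOf 1 ↔ x 0 ∈ P.ring ∧ x 1 ∈ P.ring := fun x => by
    rw [mem_latticeOf, inv_one, Units.val_one, Matrix.one_mulVec, Fin.forall_fin_two]
  let p : (Fin 2 → F) →+ F := Pi.evalAddMonoidHom (fun _ => F) 1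
  let f : (Fin 2 → F) →+ F := Pi.evalAddMonoidHom (fun _ => F) 0 - (AddMonoidHom.mulLeft (b / d)).comp p
  have hf : ∀ x, f x = x 0 - b / d * x 1 := fun _ => rfl
  -- The index is computed in two steps through `K`, the vectors of `O²` whose second coordinate
  -- lies in `d O`. The second coordinate `p` gives the upper step, and the sheared first coordinate
  -- `f` the lower one.
  set K := (P.closedBall d).comap p ⊓ P.latticeOf 1
  have hKmem : ∀ x, x ∈ K ↔ x 1 / d ∈ P.ring ∧ x 0 ∈ P.ring ∧ x 1 ∈ P.ring := fun x => by
    rw [AddSubgroup.mem_inf, hstd, AddSubgroup.mem_comap, mem_closedBall_iff_div hdd]; rfl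
  have hbd : ∀ y, y / d ∈ P.ring → b / d * y ∈ P.ring := fun y hy => by
    rw [div_mul_eq_mul_div, mul_div_assoc]; exact mul_mem (htg 0 1) hy
  have hdy : ∀ y, y / d ∈ P.ring → y ∈ P.ring := fun y hy => by
    have := mul_mem hy (htg 1 1)
    change y / d * d ∈ _ at this
    rwa [div_mul_cancel₀ _ hdd] at this
  have hax : ∀ y, y / a ∈ P.ring → y ∈ P.ring := fun y hy => by
    have := mul_mem hy (htg 0 0)
    change y / a * a ∈ _ at this
    rwa [div_mul_cancel₀ _ ha] at this
  have htK : P.latticeOf t = (P.closedBall a).comap f ⊓ K := by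
    ext x
    rw [AddSubgroup.mem_inf, AddSubgroup.mem_comap, mem_closedBall_iff_div ha, hKmem, hf, mem_latticeOf,
      Fin.forall_fin_two]
    have e0 : (t⁻¹).1.mulVec x 0 = (x 0 - b / d * x 1) / a := by
      rw [coe_inv_fin_two, Matrix.smul_mulVec, Matrix.det_fin_two, ht]
      simp [dotProduct, Fin.sum_univ_two]
      change d⁻¹ * a⁻¹ * (d * x 0 + -(b * x 1)) = (x 0 - b / d * x 1) / a
      field_simp
      ring
    have e1 : (t⁻¹).1.mulVec x 1 = x 1 / d := by
      rw [coe_inv_fin_two, Matrix.smul_mulVec, Matrix.det_fin_two, ht]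
      simp [dotProduct, Fin.sum_univ_two]
      change d⁻¹ * a⁻¹ * (a * x 1) = x 1 / d
      field_simp
    rw [e0, e1]
    refine ⟨fun ⟨h0, h1⟩ => ⟨h0, h1, ?_, hdy _ h1⟩, fun ⟨h0, h1, _⟩ => ⟨h0, h1⟩⟩
    have := add_mem (hax _ h0) (hbd _ h1)
    rwa [sub_add_cancel] at this
  have hmapK : K.map f = P.closedBall 1 := by
    ext y
    rw [hone, AddSubgroup.mem_map]
    constructor
    · rintro ⟨x, hx, rfl⟩
      obtain ⟨h1, h2, h3⟩ := (hKmem x).mp hx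
      rw [hf]
      exact sub_mem h2 (hbd _ h1)
    · intro hy
      refine ⟨![y, 0], (hKmem _).mpr ?_, by rw [hf]; simp⟩
      simpa using hy
  have hmapV : (P.latticeOf 1).map p = P.closedBall 1 := by
    ext y
    rw [hone, AddSubgroup.mem_map]
    constructor
    · rintro ⟨x, hx, rfl⟩
      exact ((hstd x).mp hx).2
    · intro hy
      exact ⟨![0, y], (hstd _).mpr (by simpa using hy), rfl⟩
  rw [← AddSubgroup.relIndex_mul_relIndex (P.latticeOf t) K (P.latticeOf 1)
    (by rw [htK]; exact inf_le_right) inf_le_right, htK, AddSubgroup.inf_relIndex_right,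
    AddSubgroup.inf_relIndex_right, AddSubgroup.relIndex_comap, AddSubgroup.relIndex_comap, hmapK,
    hmapV, hball a i hi, hball d j hj, hij, pow_add]

omit [Finite k] hF in
/-- The index of a lattice in another one. -/
theorem relIndex_latticeOf {g h : GL (Fin 2) F} (hgh : ∀ i j, (h⁻¹ * g).1 i j ∈ P.ring) {n : ℕ}
    (hn : P.ring.valuation (h⁻¹ * g).1.det = P.ring.valuation π ^ n) :
    (P.latticeOf g).relIndex (P.latticeOf h) = Nat.card (IsLocalRing.ResidueField P.ring) ^ n := by
  rw [← relIndex_latticeOf_one hπ hgh hn]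
  let f : (Fin 2 → F) →+ (Fin 2 → F) := (Matrix.mulVecLin (h⁻¹).1).toAddMonoidHom
  have hcomap : ∀ x : GL (Fin 2) F, P.latticeOf x = (P.latticeOf (h⁻¹ * x)).comap f := by
    intro x
    ext y
    rw [AddSubgroup.mem_comap]
    change _ ↔ (h⁻¹).1.mulVec y ∈ _
    rw [mulVec_mem_latticeOf_iff, inv_inv, mul_inv_cancel_left]
  have hsurj : Function.Surjective f := fun y => ⟨h.1.mulVec y, by
    change (h⁻¹).1.mulVec (h.1.mulVec y) = y
    rw [Matrix.mulVec_mulVec, ← Units.val_mul, inv_mul_cancel, Units.val_one, Matrix.one_mulVec]⟩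
  rw [hcomap g, AddSubgroup.relIndex_comap, hcomap h, inv_mul_cancel,
    AddSubgroup.map_comap_eq_self_of_surjective hsurj]

/-- A group meets a sublattice in not much fewer points than the lattice. -/
theorem card_inf_latticeOf_le (S : AddSubgroup (Fin 2 → F)) {g h : GL (Fin 2) F}
    (hgh : ∀ i j, (h⁻¹ * g).1 i j ∈ P.ring) {n : ℕ}
    (hn : P.ring.valuation (h⁻¹ * g).1.det = P.ring.valuation π ^ n) :
    Nat.card (S ⊓ P.latticeOf h : AddSubgroup (Fin 2 → F)) ≤
      Nat.card (S ⊓ P.latticeOf g : AddSubgroup (Fin 2 → F)) *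
        Nat.card (IsLocalRing.ResidueField P.ring) ^ n := by
  have := P.finite_residueField hF
  have hle : S ⊓ P.latticeOf g ≤ S ⊓ P.latticeOf h := inf_le_inf_left _ (latticeOf_le hgh)
  have h1 : (S ⊓ P.latticeOf g).relIndex (S ⊓ P.latticeOf h) =
      (P.latticeOf g).relIndex (S ⊓ P.latticeOf h) := by
    have h2 : S ⊓ P.latticeOf g = P.latticeOf g ⊓ (S ⊓ P.latticeOf h) := by
      refine le_antisymm (le_inf inf_le_right hle) ?_
      exact le_inf (inf_le_right.trans inf_le_left) inf_le_left
    conv_lhs => rw [h2]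
    exact AddSubgroup.inf_relIndex_right _ _
  have h3 := AddSubgroup.relIndex_mul_relIndex ⊥ _ _ bot_le hle
  rw [AddSubgroup.relIndex_bot_left, AddSubgroup.relIndex_bot_left, h1] at h3
  rw [← h3, ← relIndex_latticeOf hπ hgh hn]
  refine Nat.mul_le_mul_left _ (AddSubgroup.relIndex_le_of_le_right inf_le_right ?_)
  rw [relIndex_latticeOf hπ hgh hn]
  exact pow_ne_zero _ Nat.card_pos.ne'

theorem exists_natCast_sub_le : ∃ e : ℕ, ∀ f : F, ∃ a ∈ P.regularAway,
    P.ring.valuation (f - a) ≤ P.ring.valuation π ^ (-(e : ℤ)) := by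
  obtain ⟨c, hc⟩ := P.exists_sub_le hF
  obtain ⟨e, he⟩ : ∃ e : ℕ, P.ring.valuation c ≤ P.ring.valuation π ^ (-(e : ℤ)) := by
    by_cases h0 : c = 0
    · exact ⟨0, by rw [h0, map_zero]; exact zero_le⟩
    · obtain ⟨n, hn⟩ := hπ.exists_zpow c h0
      refine ⟨(-n).toNat, ?_⟩
      rw [hn, hπ.zpow_le_zpow_iff]
      omega
  refine ⟨e, fun f => ?_⟩
  obtain ⟨a, ha, hfa⟩ := hc f
  exact ⟨a, ha, hfa.trans he⟩

/-- An analogue of Minkowski's theorem. -/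
theorem exists_pow_le_card_inf : ∃ C : ℤ, ∀ (g : GL (Fin 2) F) (D : ℤ) (n : ℕ),
    P.ring.valuation g.1.det = P.ring.valuation π ^ D → n + D + C ≤ 0 →
    Nat.card (IsLocalRing.ResidueField P.ring) ^ n ≤
      Nat.card ((AddSubgroup.pi Set.univ fun _ : Fin 2 => P.regularAway.toAddSubgroup) ⊓
        P.latticeOf g : AddSubgroup (Fin 2 → F)) := by
  have hfinκ := P.finite_residueField hF
  have hπ0 := hπ.ne_zero
  have hπv := hπ.ne_zero'
  obtain ⟨e, he⟩ := exists_natCast_sub_le hF hπ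
  -- Each of the two coordinates loses at most `e`, the defect of `A` from covering `F` by unit
  -- balls.
  refine ⟨2 * e, fun g D n hD hn => ?_⟩
  set Q := Nat.card (IsLocalRing.ResidueField P.ring)
  have hQ : 0 < Q := Nat.card_pos
  set S : AddSubgroup (Fin 2 → F) :=
    AddSubgroup.pi Set.univ fun _ : Fin 2 => P.regularAway.toAddSubgroup
  obtain ⟨c, hc1, hc⟩ := P.exists_valuation_ge (n := 4) ![g.1 0 0, g.1 0 1, g.1 1 0, g.1 1 1]
  have hc0 : c ≠ 0 := by rintro rfl; simp at hc1
  obtain ⟨m, hm⟩ := hπ.exists_zpow c hc0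
  -- With this `N` the lattice of `g` is contained in `π ^ (-N) O²`, the lattice of `h`, where the
  -- points of `A²` can be counted coordinate by coordinate.
  set N : ℕ := e + (-m).toNat with hN
  have hπN : (π ^ N : F) ≠ 0 := pow_ne_zero _ hπ0
  set h : GL (Fin 2) F := (scalarGL (Units.mk0 (π ^ N) hπN))⁻¹ with hh
  have hhg : ∀ i j, (h⁻¹ * g).1 i j ∈ P.ring := by
    intro i j
    rw [hh, inv_inv, scalarGL_mul_apply, Units.val_mk0, ← ValuationSubring.valuation_le_one_iff,
      map_mul]
    have hgc : P.ring.valuation (g.1 i j) ≤ P.ring.valuation c := by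
      have h0 := hc 0
      have h1 := hc 1
      have h2 := hc 2
      have h3 := hc 3
      fin_cases i <;> fin_cases j <;> assumption
    calc _ ≤ P.ring.valuation (π ^ N) * P.ring.valuation c := by gcongr
      _ = P.ring.valuation π ^ ((N : ℤ) + m) := by
        rw [hm, map_pow, zpow_add₀ hπv, zpow_natCast]
      _ ≤ 1 := by
        rw [← zpow_zero (P.ring.valuation π), hπ.zpow_le_zpow_iff]
        omega
  have hdet : P.ring.valuation (h⁻¹ * g).1.det = P.ring.valuation π ^ (2 * N + D) := by
    rw [hh, inv_inv, det_scalarGL_mul, map_mul, hD, Units.val_mk0, map_pow, map_pow, ← pow_mul,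
      zpow_add₀ hπv, mul_comm N]
    norm_cast
  have hdet0 : 0 ≤ 2 * N + D := by
    rw [← hπ.zpow_le_zpow_iff, ← hdet, zpow_zero, ValuationSubring.valuation_le_one_iff,
      Matrix.det_fin_two]
    exact sub_mem (mul_mem (hhg _ _) (hhg _ _)) (mul_mem (hhg _ _) (hhg _ _))
  obtain ⟨M, hM⟩ := Int.eq_ofNat_of_zero_le hdet0
  rw [hM, zpow_natCast] at hdet
  have hkey := card_inf_latticeOf_le hF hπ S hhg hdet
  set A0 : AddSubgroup F := P.regularAway.toAddSubgroup ⊓ P.closedBall (π ^ N)⁻¹ with hA0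
  have hA0fin : Finite A0 := (P.finite_regularAway_le hF (π ^ N)⁻¹ : Set.Finite _)
  have hA0card : Q ^ (N - e) ≤ Nat.card A0 := by
    have hb : (P.closedBall (π ^ e)⁻¹) = P.closedBall ((π ^ N)⁻¹ * π ^ (N - e)) := by
      congr 1
      rw [pow_sub₀ _ hπ0 (by omega)]
      field_simp
    have hble : P.closedBall (π ^ e)⁻¹ ≤ P.closedBall (π ^ N)⁻¹ := fun x hx => by
      refine mem_closedBall.mpr (le_trans (mem_closedBall.mp hx) ?_)
      rw [← zpow_natCast, ← zpow_natCast, ← zpow_neg, ← zpow_neg, map_zpow₀, map_zpow₀,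
        hπ.zpow_le_zpow_iff]
      omega
    have h1 : (P.closedBall (π ^ e)⁻¹).relIndex (P.closedBall (π ^ N)⁻¹) = Q ^ (N - e) := by
      rw [hb, relIndex_closedBall hπ _ (inv_ne_zero hπN)]
    -- As `A` and the ball of `π ^ (-e)` span `F`, the points of `A` in the larger ball meet every
    -- class modulo the smaller one.
    have h2 : A0 ⊔ P.closedBall (π ^ e)⁻¹ = P.closedBall (π ^ N)⁻¹ := by
      refine le_antisymm (sup_le inf_le_right hble) fun x hx => ?_
      obtain ⟨a, ha, hxa⟩ := he x
      have hxa' : x - a ∈ P.closedBall (π ^ e)⁻¹ := by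
        rw [mem_closedBall, ← zpow_natCast, ← zpow_neg, map_zpow₀]; exact hxa
      rw [← add_sub_cancel a x]
      refine AddSubgroup.add_mem_sup ⟨ha, ?_⟩ hxa'
      have := sub_mem hx (hble hxa')
      rwa [sub_sub_cancel] at this
    rw [← h1, ← h2, AddSubgroup.relIndex_sup_right]
    exact Nat.le_of_dvd Nat.card_pos (AddSubgroup.relIndex_dvd_card _ _)
  have hScard : Nat.card A0 * Nat.card A0 ≤ Nat.card (S ⊓ P.latticeOf h : AddSubgroup (Fin 2 → F)) := by
    have hmem : ∀ x y : A0, ![x.1, y.1] ∈ S ⊓ P.latticeOf h := by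
      rintro ⟨x, hx, hx'⟩ ⟨y, hy, hy'⟩
      have key : ∀ z ∈ P.closedBall (π ^ N)⁻¹, π ^ N * z ∈ P.ring := fun z hz => by
        have := (mem_closedBall_iff_div (inv_ne_zero hπN)).mp hz
        rwa [div_inv_eq_mul, mul_comm] at this
      refine ⟨fun i _ => ?_, fun i => ?_⟩
      · fin_cases i
        · exact hx
        · exact hy
      · rw [hh, inv_inv, scalarGL_mulVec]
        fin_cases i
        · exact key x hx'
        · exact key y hy'
    have hSfin : Finite (S ⊓ P.latticeOf h : AddSubgroup (Fin 2 → F)) := by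
      refine (((Set.Finite.pi' fun _ : Fin 2 => P.finite_regularAway_le hF (π ^ N)⁻¹).subset ?_ :
        Set.Finite _))
      rintro x ⟨hx1, hx2⟩ i
      refine ⟨hx1 i trivial, ?_⟩
      have h1 := hx2 i
      rw [hh, inv_inv, scalarGL_mulVec] at h1
      refine mem_closedBall.mp ((mem_closedBall_iff_div (inv_ne_zero hπN)).mpr ?_)
      rwa [div_inv_eq_mul, mul_comm]
    rw [← Nat.card_prod]
    refine Nat.card_le_card_of_injective (fun z : A0 × A0 => (⟨_, hmem z.1 z.2⟩ :
      (S ⊓ P.latticeOf h : AddSubgroup (Fin 2 → F)))) fun z w hzw => ?_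
    have h0 := congrFun (congrArg Subtype.val hzw) 0
    have h1 := congrFun (congrArg Subtype.val hzw) 1
    exact Prod.ext (Subtype.ext h0) (Subtype.ext h1)
  -- Since `M = 2N + D`, the hypothesis `n + D + 2e ≤ 0` says that `n + M ≤ 2(N - e)`.
  have h5 : Q ^ n * Q ^ M ≤ Nat.card (S ⊓ P.latticeOf g : AddSubgroup (Fin 2 → F)) * Q ^ M := by
    refine le_trans ?_ hkey
    refine le_trans ?_ hScard
    refine le_trans ?_ (Nat.mul_le_mul hA0card hA0card)
    rw [← pow_add, ← pow_add]
    refine Nat.pow_le_pow_right hQ ?_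
    omega
  exact Nat.le_of_mul_le_mul_right h5 (pow_pos hQ M)

end Place

/-! ## Reduction theory -/

theorem Set.exists_finite_subset_of_finite_image {α β : Type*} {f : α → β} {S : Set α}
    (hf : (f '' S).Finite) : ∃ S' ⊆ S, S'.Finite ∧ ∀ x ∈ S, ∃ x' ∈ S', f x = f x' := by
  obtain ⟨S', hS', hbij⟩ := S.exists_subset_bijOn f
  refine ⟨S', hS', Set.Finite.of_finite_image (hbij.image_eq ▸ hf) hbij.injOn, fun x hx => ?_⟩
  obtain ⟨x', hx', h⟩ := hbij.surjOn ⟨x, hx, rfl⟩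
  exact ⟨x', hx', h.symm⟩

namespace Place

open BruhatTits

variable {k F : Type*} [Field k] [Field F] [Algebra k F] {P : Place k F}
  {π : F} (hπ : P.ring.IsUniformizer π)

theorem mem_latticeOf_scalarGL_mul {c : Fˣ} {g : GL (Fin 2) F} {x : Fin 2 → F} :
    x ∈ P.latticeOf (scalarGL c * g) ↔ ∀ i, (c : F)⁻¹ * (g⁻¹).1.mulVec x i ∈ P.ring := by
  rw [Matrix.GeneralLinearGroup.scalar_commute, mem_latticeOf, mul_inv_rev, ← map_inv,
    Units.val_mul]
  refine forall_congr' fun i => ?_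
  rw [← Matrix.mulVec_mulVec, scalarGL_mulVec, Units.val_inv_eq_inv_val]
  rfl

theorem vertexOf_scalarGL_mul (c : Fˣ) (g : GL (Fin 2) F) :
    P.vertexOf (scalarGL c * g) = P.vertexOf g := by
  rw [vertexOf, map_mul, Matrix.GeneralLinearGroup.map_scalar, mul_smul, smul_mk_eq_of_scalar,
    vertexOf]

include hπ

theorem exists_valuation_le_zpow (c : F) :
    ∃ m : ℕ, P.ring.valuation c ≤ P.ring.valuation π ^ (-(m : ℤ)) := by
  by_cases h0 : c = 0
  · exact ⟨0, by rw [h0, map_zero]; exact zero_le⟩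
  · obtain ⟨n, hn⟩ := hπ.exists_zpow c h0
    refine ⟨(-n).toNat, ?_⟩
    rw [hn, hπ.zpow_le_zpow_iff]
    omega

variable [Finite k] (hF : IsFunctionFieldOfCurve k F)

include hF

omit hπ in
/-- Vertices given by matrices with bounded entries are finite in
number. -/
theorem finite_vertexOf (z : GL (Fin 2) F) (c : F) :
    {v | ∃ X : GL (Fin 2) F, (∀ i j, P.ring.valuation (X.1 i j) ≤ P.ring.valuation c) ∧
      (∀ i j, P.ring.valuation ((X⁻¹).1 i j) ≤ P.ring.valuation c) ∧
      v = P.vertexOf (z * X)}.Finite := by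
  set S : Set (GL (Fin 2) F) := {X | (∀ i j, P.ring.valuation (X.1 i j) ≤ P.ring.valuation c) ∧
      (∀ i j, P.ring.valuation ((X⁻¹).1 i j) ≤ P.ring.valuation c)}
  by_cases hc : c = 0
  · convert Set.finite_empty
    rw [Set.eq_empty_iff_forall_notMem]
    rintro v ⟨X, hX, -⟩
    refine X.det_ne_zero ?_
    have h0 : ∀ i j, X.1 i j = 0 := fun i j => by
      have := hX i j
      rwa [hc, map_zero, nonpos_iff_eq_zero, map_eq_zero] at this
    rw [Matrix.det_fin_two, h0 0 0, h0 0 1, zero_mul, zero_mul, sub_zero]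
  obtain ⟨s, hs, hsx⟩ := P.exists_finite_residues_of_le hF (c * c)
  choose! σ hσ hσ' using hsx
  have hσc : ∀ X ∈ S, ∀ i j, P.ring.valuation (X.1 i j * c) ≤ P.ring.valuation (c * c) := by
    intro X hX i j
    rw [map_mul, map_mul]
    gcongr
    exact hX.1 i j
  obtain ⟨S', hS', hfin, hSS'⟩ := Set.exists_finite_subset_of_finite_image (S := S)
    (f := fun X : GL (Fin 2) F => fun i j => σ (X.1 i j * c))
    ((Set.Finite.pi' fun _ : Fin 2 => Set.Finite.pi' fun _ : Fin 2 => hs).subset (by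
      rintro _ ⟨X, hX, rfl⟩ i j
      exact hσ _ (hσc X hX i j)))
  refine (hfin.image fun X => P.vertexOf (z * X)).subset ?_
  rintro _ ⟨X, hX1, hX2, rfl⟩
  have hX : X ∈ S := ⟨hX1, hX2⟩
  obtain ⟨X', hX'S, hXX'⟩ := hSS' X hX
  have hX' := hS' hX'S
  refine ⟨X', hX'S, ?_⟩
  -- Matrices with the same residues differ by entries that the bounded matrices `X⁻¹` and `X'⁻¹`
  -- turn into integral ones. So `X⁻¹ X'` and its inverse are integral, and the vertices coincide.
  have hsub : ∀ i j, (X.1 i j - X'.1 i j) * c ∈ P.ring := fun i j => by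
    have h1 := hσ' _ (hσc X hX i j)
    have h2 := hσ' _ (hσc X' hX' i j)
    have h3 : σ (X.1 i j * c) = σ (X'.1 i j * c) := congrFun (congrFun hXX' i) j
    rw [h3] at h1
    have := Valuation.map_sub_le _ h1 h2
    rwa [sub_sub_sub_cancel_right, ← sub_mul, ValuationSubring.valuation_le_one_iff] at this
  have key : ∀ X ∈ S, ∀ X' : GL (Fin 2) F, (∀ i j, (X.1 i j - X'.1 i j) * c ∈ P.ring) →
      ∀ i j, (X⁻¹ * X').1 i j ∈ P.ring := by
    intro X hX X' hsub i j
    have h1 : (X⁻¹ * X').1 = 1 - (X⁻¹).1 * (X.1 - X'.1) := by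
      rw [mul_sub, ← Units.val_mul, ← Units.val_mul, inv_mul_cancel, Units.val_one, sub_sub_cancel]
    rw [h1, Matrix.sub_apply, Matrix.mul_apply, Fin.sum_univ_two]
    have h2 : ∀ l, (X⁻¹).1 i l * (X.1 - X'.1) l j ∈ P.ring := fun l => by
      have e1 : (X⁻¹).1 i l * (X.1 - X'.1) l j =
          ((X⁻¹).1 i l / c) * ((X.1 l j - X'.1 l j) * c) := by
        rw [Matrix.sub_apply]; field_simp
      rw [e1]
      refine mul_mem ?_ (hsub l j)
      rw [← mem_closedBall_iff_div hc]
      exact hX.2 i l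
    refine sub_mem ?_ (add_mem (h2 0) (h2 1))
    rw [Matrix.one_apply]; split_ifs
    · exact one_mem _
    · exact zero_mem _
  have h0 : scalarGL (1 : Fˣ) = 1 := map_one _
  refine (vertexOf_eq_vertexOf_of_mem (c := 1) ?_).symm
  rw [h0, one_mul, mul_inv_rev, mul_assoc, inv_mul_cancel_left]
  refine ⟨key X hX X' hsub, ?_⟩
  rw [mul_inv_rev, inv_inv]
  refine key X' hX' X fun i j => ?_
  have := neg_mem (hsub i j)
  rwa [← neg_mul, neg_sub] at this

variable {Y : Submodule P.regularAway (Fin 2 → F)} (hY : P.IsALattice Y)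

include hY

/-- A multiple of a lattice has finitely many cosets. -/
theorem IsALattice.exists_finite_residues {μ : F} (hμ : μ ∈ P.regularAway) (hμ0 : μ ≠ 0) :
    ∃ R : Set (Fin 2 → F), R.Finite ∧ ∀ y ∈ Y, ∃ r ∈ R, ∃ z ∈ Y, y - r = μ • z := by
  obtain ⟨y1, hy1, y2, hy2, hyy⟩ := hY.exists_crossDet_ne_zero hF
  obtain ⟨e, he⟩ := exists_natCast_sub_le hF hπ
  set h := colGL y1 y2 hyy
  let c : Fˣ := Units.mk0 (μ * π ^ (-(e : ℤ))) (mul_ne_zero hμ0 (zpow_ne_zero _ hπ.ne_zero))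
  refine ⟨_, hY.finite_inter hF (scalarGL c * h), fun y hy => ?_⟩
  -- Rounding the coordinates of `y / μ` in the basis `h` to elements of `A` leaves a remainder in
  -- `Y` that lies in a fixed bounded lattice.
  set x := μ⁻¹ • (h⁻¹).1.mulVec y with hx
  choose b hb hb' using fun i : Fin 2 => he (x i)
  have hz : h.1.mulVec b ∈ Y := by
    rw [colGL_mulVec]
    exact add_mem (Y.smul_mem ⟨_, hb 0⟩ hy1) (Y.smul_mem ⟨_, hb 1⟩ hy2)
  refine ⟨y - μ • h.1.mulVec b, ⟨sub_mem hy (Y.smul_mem ⟨μ, hμ⟩ hz), ?_⟩, _, hz,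
    sub_sub_cancel _ _⟩
  refine mem_latticeOf_scalarGL_mul.mpr fun i => ?_
  have h1 : (h⁻¹).1.mulVec (y - μ • h.1.mulVec b) i = μ * (x i - b i) := by
    rw [Matrix.mulVec_sub, Matrix.mulVec_smul, Matrix.mulVec_mulVec, ← Units.val_mul,
      inv_mul_cancel, Units.val_one, Matrix.one_mulVec, hx]
    simp only [Pi.sub_apply, Pi.smul_apply, smul_eq_mul]
    field_simp
  rw [h1, Units.val_mk0, ← ValuationSubring.valuation_le_one_iff]
  have h2 : (μ * π ^ (-(e : ℤ)))⁻¹ * (μ * (x i - b i)) = (x i - b i) / π ^ (-(e : ℤ)) := by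
    field_simp
  rw [h2, ValuationSubring.valuation_le_one_iff,
    ← mem_closedBall_iff_div (zpow_ne_zero _ hπ.ne_zero), mem_closedBall, map_zpow₀]
  exact hb' i

/-- An analogue of Minkowski's theorem for lattices. -/
theorem IsALattice.exists_pow_le_card_inf : ∃ C : ℤ, ∀ (g : GL (Fin 2) F) (D : ℤ) (n : ℕ),
    P.ring.valuation g.1.det = P.ring.valuation π ^ D → n + D + C ≤ 0 →
    Nat.card (IsLocalRing.ResidueField P.ring) ^ n ≤
      Nat.card (Y.toAddSubgroup ⊓ P.latticeOf g : AddSubgroup (Fin 2 → F)) := by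
  obtain ⟨C, hC⟩ := Place.exists_pow_le_card_inf hF hπ
  obtain ⟨y1, hy1, y2, hy2, hyy⟩ := hY.exists_crossDet_ne_zero hF
  set h := colGL y1 y2 hyy
  obtain ⟨d, hd⟩ := hπ.exists_zpow h.1.det h.det_ne_zero
  refine ⟨C - d, fun g D n hD hn => ?_⟩
  -- The matrix `h` maps `A²` into `Y`, so the bound for `A²` applies to `h⁻¹ g`, with the constant
  -- shifted by the exponent of `det h`.
  have hdet : P.ring.valuation (h⁻¹ * g).1.det = P.ring.valuation π ^ (D - d) := by
    have h1 : h.1.det * (h⁻¹ * g).1.det = g.1.det := by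
      rw [← Matrix.det_mul, ← Units.val_mul, mul_inv_cancel_left]
    have h2 := congrArg P.ring.valuation h1
    rw [map_mul, hd, hD] at h2
    rw [zpow_sub₀ hπ.ne_zero', ← h2, mul_div_cancel_left₀ _ (zpow_ne_zero _ hπ.ne_zero')]
  refine (hC _ _ n hdet (by omega)).trans ?_
  have hfin : Finite (Y.toAddSubgroup ⊓ P.latticeOf g : AddSubgroup (Fin 2 → F)) :=
    (hY.finite_inter hF g : Set.Finite _)
  refine Nat.card_le_card_of_injective (fun x => ⟨h.1.mulVec x.1, ?_, ?_⟩) fun x x' hxx => ?_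
  · change h.1.mulVec x.1 ∈ Y
    rw [colGL_mulVec]
    exact add_mem (Y.smul_mem ⟨_, x.2.1 0 trivial⟩ hy1) (Y.smul_mem ⟨_, x.2.1 1 trivial⟩ hy2)
  · exact mulVec_mem_latticeOf_iff.mpr x.2.2
  · have h1 := congrArg (fun z => (h⁻¹).1.mulVec z.1) hxx
    simp only [Matrix.mulVec_mulVec, ← Units.val_mul, inv_mul_cancel, Units.val_one,
      Matrix.one_mulVec] at h1
    exact Subtype.ext h1

/-- Every vertex is represented by a matrix whose lattice contains a nonzero vector of `Y` such
that no multiple of the lattice does. -/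
theorem IsALattice.exists_reduced (v : Vertex P.integers) :
    ∃ g : GL (Fin 2) F, v = P.vertexOf g ∧ (∃ y ∈ Y, y ≠ 0 ∧ y ∈ P.latticeOf g) ∧
      ∀ y ∈ Y, (∀ i, π⁻¹ * (g⁻¹).1.mulVec y i ∈ P.ring) → y = 0 := by
  obtain ⟨g, rfl⟩ := exists_eq_vertexOf hπ v
  let c : ℤ → Fˣ := fun n => Units.mk0 (π ^ n) (zpow_ne_zero n hπ.ne_zero)
  -- The multiples by `π ^ n` shrink as `n` grows, and each contains finitely many vectors of `Y`.
  -- So there is a greatest `n` for which a nonzero vector of `Y` remains.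
  let p : ℤ → Prop := fun n => ∃ y ∈ Y, y ≠ 0 ∧ y ∈ P.latticeOf (scalarGL (c n) * g)
  have hmem : ∀ n y, y ∈ P.latticeOf (scalarGL (c n) * g) ↔
      ∀ i, P.ring.valuation ((g⁻¹).1.mulVec y i) ≤ P.ring.valuation π ^ n := fun n y => by
    rw [mem_latticeOf_scalarGL_mul]
    refine forall_congr' fun i => ?_
    rw [inv_mul_eq_div, ← mem_closedBall_iff_div (c n).ne_zero, mem_closedBall, Units.val_mk0,
      map_zpow₀]
  have hmono : ∀ n m y, n ≤ m → y ∈ P.latticeOf (scalarGL (c m) * g) →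
      y ∈ P.latticeOf (scalarGL (c n) * g) := fun n m y hnm hy => by
    rw [hmem] at hy ⊢
    exact fun i => (hy i).trans (hπ.zpow_le_zpow_iff.mpr hnm)
  obtain ⟨n0, hn0⟩ : ∃ n, p n := by
    obtain ⟨y, hy, y', hy', hyy⟩ := hY.exists_crossDet_ne_zero hF
    have hy0 : y ≠ 0 := by
      rintro rfl
      simp [crossDet] at hyy
    obtain ⟨m0, h0⟩ := exists_valuation_le_zpow hπ ((g⁻¹).1.mulVec y 0)
    obtain ⟨m1, h1⟩ := exists_valuation_le_zpow hπ ((g⁻¹).1.mulVec y 1)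
    refine ⟨-(m0 + m1 : ℤ), y, hy, hy0, (hmem _ _).mpr (Fin.forall_fin_two.mpr ⟨?_, ?_⟩)⟩
    · exact h0.trans (hπ.zpow_le_zpow_iff.mpr (by omega))
    · exact h1.trans (hπ.zpow_le_zpow_iff.mpr (by omega))
  have hbdd : ∃ b, ∀ n, p n → n ≤ b := by
    have hex : ∀ y : Fin 2 → F, ∃ b : ℤ, y ≠ 0 → ∀ n, y ∈ P.latticeOf (scalarGL (c n) * g) → n ≤ b := by
      intro y
      by_cases hy : y = 0
      · exact ⟨0, fun h => (h hy).elim⟩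
      obtain ⟨i, hi⟩ : ∃ i, (g⁻¹).1.mulVec y i ≠ 0 := by
        by_contra! hcon
        refine hy ?_
        have h1 : (g⁻¹).1.mulVec y = 0 := funext hcon
        have h2 := congrArg g.1.mulVec h1
        rwa [Matrix.mulVec_mulVec, ← Units.val_mul, mul_inv_cancel, Units.val_one,
          Matrix.one_mulVec, Matrix.mulVec_zero] at h2
      obtain ⟨e, he⟩ := hπ.exists_zpow _ hi
      refine ⟨e, fun _ n hn => ?_⟩
      have := (hmem n y).mp hn i
      rwa [he, hπ.zpow_le_zpow_iff] at this
    choose b hb using hex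
    obtain ⟨B, hB⟩ := ((hY.finite_inter hF (scalarGL (c n0) * g)).image b).bddAbove
    refine ⟨max B n0, fun n ⟨y, hy, hy0, hyn⟩ => ?_⟩
    rcases le_total n n0 with h | h
    · exact h.trans (le_max_right _ _)
    · exact (hb y hy0 n hyn).trans ((hB ⟨y, ⟨hy, hmono _ _ y h hyn⟩, rfl⟩).trans (le_max_left _ _))
  obtain ⟨n, ⟨y, hy, hy0, hyn⟩, hmax⟩ := Int.exists_greatest_of_bdd hbdd ⟨n0, hn0⟩
  refine ⟨scalarGL (c n) * g, (vertexOf_scalarGL_mul _ _).symm, ⟨y, hy, hy0, hyn⟩, fun y' hy' h => ?_⟩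
  by_contra h0
  have h1 : p (n + 1) := by
    refine ⟨y', hy', h0, mem_latticeOf_scalarGL_mul.mpr fun i => ?_⟩
    have h2 := h i
    rw [Matrix.GeneralLinearGroup.scalar_commute, mul_inv_rev, ← map_inv, Units.val_mul,
      ← Matrix.mulVec_mulVec, scalarGL_mulVec, Units.val_inv_eq_inv_val, Pi.smul_apply,
      smul_eq_mul, ← mul_assoc] at h2
    convert h2 using 2
    rw [Units.val_mk0, Units.val_mk0, zpow_add_one₀ hπ.ne_zero, mul_inv_rev]
  have := hmax _ h1
  omega

end Place

/-! ## Finiteness of the supports of cuspidal cochains -/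

namespace Place

open BruhatTits

variable {k F : Type*} [Field k] [Field F] [Algebra k F] {P : Place k F}
  {π : F} (hπ : P.ring.IsUniformizer π)

theorem apply_glMap_smul {Γ : Subgroup (GL (Fin 2) F)} {φ : P.TEdge → ℤ}
    (hφ : φ ∈ P.cuspidalCochains Γ) {γ : GL (Fin 2) F} (hγ : γ ∈ Γ) (e : P.TEdge) :
    φ (P.glMap γ • e) = φ e :=
  hφ.2.1 _ ⟨γ, hγ, rfl⟩ e

/-- An invariant function supported on finitely many orbits has finitely many values. -/
theorem finite_range_cochain {Γ : Subgroup (GL (Fin 2) F)} {φ : P.TEdge → ℤ}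
    (hφ : φ ∈ P.cuspidalCochains Γ) : (Set.range φ).Finite := by
  obtain ⟨S', hS', hfin, h⟩ := Set.exists_finite_subset_of_finite_image hφ.2.2
  refine ((Set.finite_singleton 0).union (hfin.image φ)).subset ?_
  rintro _ ⟨e, rfl⟩
  by_cases he : φ e = 0
  · exact Or.inl he
  · obtain ⟨e', he', hee⟩ := h e he
    obtain ⟨⟨_, g, hg, rfl⟩, hge⟩ := Quotient.exact hee
    refine Or.inr ⟨e', he', ?_⟩
    rw [← hge]
    exact (apply_glMap_smul hφ hg e').symm

include hπ

/-- Cuspidal cochains vanish at the vertices with many unipotent elements in their stabilizers. -/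
theorem eq_zero_of_unipotents [Finite (IsLocalRing.ResidueField P.ring)]
    {Γ : Subgroup (GL (Fin 2) F)} {φ : P.TEdge → ℤ}
    (hφ : φ ∈ P.cuspidalCochains Γ) {d : ℕ}
    (hd : ∀ f : F, ∃ a ∈ P.regularAway, P.ring.valuation (f - a) ≤ P.ring.valuation π ^ (-(d : ℤ)))
    {b : GL (Fin 2) F} {ε : F} (hε0 : ε ≠ 0)
    (hε : P.ring.valuation ε ≤ P.ring.valuation π ^ (d + 1))
    (hb : ∀ f ∈ P.regularAway, ∃ u ∈ Γ, u * b = b * ballGL hπ.ne_zero (f * ε) 0)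
    {e : P.TEdge} (he : e.fst = P.vertexOf b) : φ e = 0 := by
  have := Fintype.ofFinite (IsLocalRing.ResidueField P.ring)
  have hharm : (treeGraph P.integers).IsHarmonic φ := hφ.1
  set Ψ : F → ℤ → ℤ := fun c n => φ (edgeOf hπ (b * ballGL hπ.ne_zero c n))
  have hinv : ∀ f ∈ P.regularAway, ∀ c n, Ψ (f * ε + c) n = Ψ c n := by
    intro f hf c n
    obtain ⟨u, hu, hub⟩ := hb f hf
    change φ (edgeOf hπ (b * _)) = φ (edgeOf hπ (b * _))
    rw [← apply_glMap_smul hφ hu (edgeOf hπ (b * ballGL hπ.ne_zero c n)), glMap_smul_edgeOf,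
      ← mul_assoc, hub, mul_assoc, ballGL_zero_mul hπ]
  -- By the choice of `d` and the bound on `ε`, translations by `A ε` act transitively on the balls
  -- of each exponent `n ≤ 1`. The bound is `1` rather than `0` because the star of the vertex also
  -- involves the balls of exponent `1`.
  have hconst : ∀ n : ℤ, n ≤ 1 → ∀ c, Ψ c n = Ψ 0 n := by
    intro n hn c
    obtain ⟨a, ha, hca⟩ := hd (c / ε)
    have hx : (c / ε - a) * ε / π ^ n ∈ P.ring := by
      rw [← mem_closedBall_iff_div (zpow_ne_zero n hπ.ne_zero), mem_closedBall, map_mul, map_zpow₀]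
      calc _ ≤ P.ring.valuation π ^ (-(d : ℤ)) * P.ring.valuation π ^ (d + 1) := by gcongr
        _ = P.ring.valuation π ^ (1 : ℤ) := by
          rw [← zpow_natCast, ← zpow_add₀ hπ.ne_zero']; congr 1; push_cast; ring
        _ ≤ _ := hπ.zpow_le_zpow_iff.mpr hn
    have hc : c = a * ε + (0 + π ^ n * ((c / ε - a) * ε / π ^ n)) := by
      rw [zero_add, mul_div_cancel₀ _ (zpow_ne_zero n hπ.ne_zero), sub_mul, div_mul_cancel₀ _ hε0]
      ring
    rw [hc, hinv a ha]
    change φ _ = φ _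
    rw [edgeOf_ballGL_add hπ b 0 hx]
  have hstep : ∀ n : ℤ, n ≤ 0 → Ψ 0 n = Nat.card (IsLocalRing.ResidueField P.ring) * Ψ 0 (n + 1) := by
    intro n hn
    have h1 : Ψ 0 n = ∑ r, Ψ (0 + π ^ n * P.residueRep r) (n + 1) := by
      change φ _ = _
      rw [IsHarmonic.apply_edgeOf hπ hharm]
      refine Finset.sum_congr rfl fun r _ => ?_
      rw [mul_assoc, ballGL_mul]
    rw [h1, Finset.sum_congr rfl fun r _ => hconst (n + 1) (by omega) _, Finset.sum_const,
      Finset.card_univ, nsmul_eq_mul, Nat.card_eq_fintype_card]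
  -- Each enlargement of the ball multiplies the value by `Q`. As `φ` has finitely many values, the
  -- value at exponent `1` must be zero.
  have hpow : ∀ j : ℕ, Ψ 0 (1 - j) = Nat.card (IsLocalRing.ResidueField P.ring) ^ j * Ψ 0 1 := by
    intro j
    induction j with
    | zero => simp
    | succ j ih =>
      rw [hstep _ (by push_cast; omega), pow_succ']
      have : (1 : ℤ) - ((j + 1 : ℕ) : ℤ) + 1 = 1 - j := by push_cast; ring
      rw [this, ih]
      ring
  have h1 : Ψ 0 1 = 0 := by
    by_contra h0
    refine Set.infinite_of_injective_forall_mem (s := Set.range φ) (f := fun j : ℕ => Ψ 0 (1 - j))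
      (fun i j hij => ?_) (fun j => ⟨_, rfl⟩) (finite_range_cochain hφ)
    change Ψ 0 (1 - i) = Ψ 0 (1 - j) at hij
    rw [hpow, hpow, mul_left_inj' h0] at hij
    exact Nat.pow_right_injective (Finite.one_lt_card (α := IsLocalRing.ResidueField P.ring))
      (by exact_mod_cast hij)
  have h0 : Ψ 0 0 = 0 := by
    rw [hstep 0 le_rfl, zero_add, h1, mul_zero]
  obtain ⟨r, rfl⟩ : e ∈ Set.range (starEdge hπ b) := by rw [range_starEdge]; exact he
  cases r with
  | none =>
    change φ (edgeOf hπ (b * _)) = 0 at h0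
    rw [ballGL_zero_zero hπ, mul_one] at h0
    exact h0
  | some r =>
    have h2 := hharm.1 (edgeOf hπ (b * flipGL (P.residueRep r)))
    change _ + φ (edgeOf hπ (b * flipGL (P.residueRep r))).symm = 0 at h2
    rw [symm_edgeOf_flip] at h2
    change _ + Ψ (P.residueRep r) 1 = 0 at h2
    rwa [hconst 1 le_rfl, h1, add_zero] at h2

omit hπ in
-- A vector with a unit coordinate can be completed to a basis of `O²`.
theorem exists_integralGL_mulVec {x : Fin 2 → F} (hx : ∀ i, x i ∈ P.ring)
    (hx1 : ∃ i, P.ring.valuation (x i) = 1) :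
    ∃ B ∈ integralGL P.ring, B.1.mulVec ![1, 0] = x := by
  obtain ⟨i, hi⟩ := hx1
  have hi0 : x i ≠ 0 := fun h => by simp [h] at hi
  fin_cases i
  · refine ⟨Matrix.GeneralLinearGroup.mkOfDetNeZero !![x 0, 0; x 1, 1] (by simpa using hi0),
      (mem_integralGL_iff _).mpr ⟨fun i j => ?_, ?_⟩, ?_⟩
    · change !![x 0, 0; x 1, 1] i j ∈ P.ring
      fin_cases i <;> fin_cases j <;> simp [hx, zero_mem, one_mem]
    · change P.ring.valuation (!![x 0, 0; x 1, 1]).det = 1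
      simpa using hi
    · change Matrix.mulVec !![x 0, 0; x 1, 1] ![1, 0] = x
      ext i
      fin_cases i <;> simp
  · refine ⟨Matrix.GeneralLinearGroup.mkOfDetNeZero !![x 0, 1; x 1, 0] (by simpa using hi0),
      (mem_integralGL_iff _).mpr ⟨fun i j => ?_, ?_⟩, ?_⟩
    · change !![x 0, 1; x 1, 0] i j ∈ P.ring
      fin_cases i <;> fin_cases j <;> simp [hx, zero_mem, one_mem]
    · change P.ring.valuation (!![x 0, 1; x 1, 0]).det = 1
      simpa using hi
    · change Matrix.mulVec !![x 0, 1; x 1, 0] ![1, 0] = x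
      ext i
      fin_cases i <;> simp

variable [Finite k] (hF : IsFunctionFieldOfCurve k F)
  {Y : Submodule P.regularAway (Fin 2 → F)} (hY : P.IsALattice Y)
  {𝔞 : Ideal P.regularAway} (h𝔞 : 𝔞 ≠ ⊥)

include hF hY h𝔞

/-- Bases of `F²` in a lattice with bounded determinants are finite in number modulo a congruence
subgroup. -/
theorem IsALattice.exists_finite_bases (c : F) :
    ∃ H : Set ((Fin 2 → F) × (Fin 2 → F)), H.Finite ∧ (∀ p ∈ H, crossDet p.1 p.2 ≠ 0) ∧
      ∀ y ∈ Y, ∀ y' ∈ Y, crossDet y y' ≠ 0 → P.ring.valuation (crossDet y y') ≤ P.ring.valuation c →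
        ∃ p ∈ H, ∃ γ ∈ P.congruenceSubgroup Y 𝔞, γ.1.mulVec y = p.1 ∧ γ.1.mulVec y' = p.2 := by
  obtain ⟨a, ha, ha0, haY⟩ := hY.exists_mul_mem hF
  obtain ⟨a1, ha1, ha10⟩ := Submodule.exists_mem_ne_zero_of_ne_bot h𝔞
  have hcross : ∀ y ∈ Y, ∀ y' ∈ Y, a ^ 2 * crossDet y y' ∈ P.regularAway := by
    intro y hy y' hy'
    have : a ^ 2 * crossDet y y' = (a * y 0) * (a * y' 1) - (a * y 1) * (a * y' 0) := by
      rw [crossDet]; ring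
    rw [this]
    exact sub_mem (mul_mem (haY y hy 0) (haY y' hy' 1)) (mul_mem (haY y hy 1) (haY y' hy' 0))
  let S : Set ((Fin 2 → F) × (Fin 2 → F)) := {p | p.1 ∈ Y ∧ p.2 ∈ Y ∧ crossDet p.1 p.2 ≠ 0 ∧
    P.ring.valuation (crossDet p.1 p.2) ≤ P.ring.valuation c}
  -- The multiples of the determinants by `a ^ 2` are elements of `A` of bounded size.
  have hΔ : ((fun p => crossDet p.1 p.2) '' S).Finite := by
    refine Set.Finite.of_finite_image (f := fun δ => a ^ 2 * δ)
      ((P.finite_regularAway_le hF (a ^ 2 * c)).subset ?_)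
      fun x _ y _ h => mul_left_cancel₀ (pow_ne_zero 2 ha0) h
    rintro _ ⟨_, ⟨p, ⟨h1, h2, -, h3⟩, rfl⟩, rfl⟩
    refine ⟨hcross _ h1 _ h2, ?_⟩
    change P.ring.valuation (a ^ 2 * crossDet p.1 p.2) ≤ P.ring.valuation (a ^ 2 * c)
    rw [map_mul, map_mul _ _ c]
    gcongr
  obtain ⟨f, hf, hf0, hfΔ⟩ := exists_mul_mem_of_finite (P := P) hF (hΔ.image fun δ => δ⁻¹)
  -- The modulus `μ` is chosen so that a change of basis congruent to the identity modulo `μ Y` is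
  -- one modulo `𝔞 Y` on all of `Y`: in Cramer's rule `f` absorbs the inverse determinant and `a ^
  -- 2` makes the numerators regular, which leaves the factor `a1` in `𝔞`.
  set μ : F := a1.1 * (f * a ^ 2) with hμ
  have hμA : μ ∈ P.regularAway := mul_mem a1.2 (mul_mem hf (pow_mem ha 2))
  have hμ0 : μ ≠ 0 := mul_ne_zero (fun h => ha10 (Subtype.ext h))
    (mul_ne_zero hf0 (pow_ne_zero 2 ha0))
  obtain ⟨R, hR, hRY⟩ := hY.exists_finite_residues hπ hF hμA hμ0
  choose! ρ hρ z hz hρz using hRY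
  obtain ⟨H, hHS, hH, hSH⟩ := Set.exists_finite_subset_of_finite_image (S := S)
    (f := fun p => (crossDet p.1 p.2, ρ p.1, ρ p.2))
    ((hΔ.prod (hR.prod hR)).subset (by
      rintro _ ⟨p, hp, rfl⟩
      exact ⟨⟨p, hp, rfl⟩, hρ _ hp.1, hρ _ hp.2.1⟩))
  have key : ∀ p ∈ S, ∀ p' ∈ S, crossDet p.1 p.2 = crossDet p'.1 p'.2 → ρ p.1 = ρ p'.1 →
      ρ p.2 = ρ p'.2 → ∀ γ : GL (Fin 2) F, γ.1.mulVec p.1 = p'.1 → γ.1.mulVec p.2 = p'.2 →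
      ∀ y ∈ Y, γ.1.mulVec y - y ∈ 𝔞 • Y := by
    intro p hp p' hp' hδ h1 h2 γ hγ1 hγ2 y hy
    set δ := crossDet p.1 p.2 with hδdef
    have hδ0 : δ ≠ 0 := hp.2.2.1
    have e1 : p'.1 - p.1 = μ • (z p'.1 - z p.1) := by
      rw [smul_sub, ← hρz _ hp'.1, ← hρz _ hp.1, h1]; abel
    have e2 : p'.2 - p.2 = μ • (z p'.2 - z p.2) := by
      rw [smul_sub, ← hρz _ hp'.2.1, ← hρz _ hp.2.1, h2]; abel
    have hcoef : ∀ x ∈ Y, ∀ x' ∈ Y, f * δ⁻¹ * (a ^ 2 * crossDet x x') ∈ P.regularAway :=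
      fun x hx x' hx' => mul_mem (hfΔ _ ⟨_, ⟨p, hp, rfl⟩, rfl⟩) (hcross x hx x' hx')
    have e3 : γ.1.mulVec y - y =
        a1 • ((⟨_, hcoef y hy p.2 hp.2.1⟩ : P.regularAway) • (z p'.1 - z p.1)) +
        a1 • ((⟨_, hcoef p.1 hp.1 y hy⟩ : P.regularAway) • (z p'.2 - z p.2)) := by
      change _ = a1.1 • ((f * δ⁻¹ * (a ^ 2 * crossDet y p.2)) • (z p'.1 - z p.1)) +
        a1.1 • ((f * δ⁻¹ * (a ^ 2 * crossDet p.1 y)) • (z p'.2 - z p.2))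
      have e4 : y = δ⁻¹ • (crossDet y p.2 • p.1 + crossDet p.1 y • p.2) := by
        rw [← crossDet_smul_eq, inv_smul_smul₀ hδ0]
      have e5 : γ.1.mulVec y - y =
          δ⁻¹ • (crossDet y p.2 • (p'.1 - p.1) + crossDet p.1 y • (p'.2 - p.2)) := by
        have e6 : γ.1.mulVec y = δ⁻¹ • (crossDet y p.2 • p'.1 + crossDet p.1 y • p'.2) := by
          conv_lhs => rw [e4]
          rw [Matrix.mulVec_smul, Matrix.mulVec_add, Matrix.mulVec_smul, Matrix.mulVec_smul, hγ1,
            hγ2]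
        calc γ.1.mulVec y - y = δ⁻¹ • (crossDet y p.2 • p'.1 + crossDet p.1 y • p'.2) -
              δ⁻¹ • (crossDet y p.2 • p.1 + crossDet p.1 y • p.2) := by rw [e6, ← e4]
          _ = _ := by module
      rw [e5, e1, e2]
      simp only [smul_smul, smul_add, hμ]
      congr 2 <;> ring
    rw [e3]
    exact add_mem (Submodule.smul_mem_smul ha1 (Y.smul_mem _ (sub_mem (hz _ hp'.1) (hz _ hp.1))))
      (Submodule.smul_mem_smul ha1 (Y.smul_mem _ (sub_mem (hz _ hp'.2.1) (hz _ hp.2.1))))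
  refine ⟨H, hH, fun p hp => (hHS hp).2.2.1, fun y hy y' hy' h0 hc => ?_⟩
  have hyS : (y, y') ∈ S := ⟨hy, hy', h0, hc⟩
  obtain ⟨p, hpH, hp⟩ := hSH _ hyS
  have hpS := hHS hpH
  obtain ⟨hp1, hp23⟩ := Prod.mk.inj hp
  obtain ⟨hp2, hp3⟩ := Prod.mk.inj hp23
  set γ := colGL p.1 p.2 hpS.2.2.1 * (colGL y y' h0)⁻¹ with hγ
  have hcol : ∀ (x x' : Fin 2 → F) (h : crossDet x x' ≠ 0), (colGL x x' h).1.mulVec ![1, 0] = x ∧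
      (colGL x x' h).1.mulVec ![0, 1] = x' := fun x x' h => by
    rw [colGL_mulVec, colGL_mulVec]; simp
  have hγcol : ∀ (x x' w w' : Fin 2 → F) (h : crossDet x x' ≠ 0) (h' : crossDet w w' ≠ 0),
      (colGL w w' h' * (colGL x x' h)⁻¹).1.mulVec x = w ∧
      (colGL w w' h' * (colGL x x' h)⁻¹).1.mulVec x' = w' := fun x x' w w' h h' => by
    have e1 := (hcol x x' h).1
    have e2 := (hcol x x' h).2
    constructor
    · nth_rewrite 2 [← e1]
      rw [Matrix.mulVec_mulVec, ← Units.val_mul, inv_mul_cancel_right, (hcol w w' h').1]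
    · nth_rewrite 2 [← e2]
      rw [Matrix.mulVec_mulVec, ← Units.val_mul, inv_mul_cancel_right, (hcol w w' h').2]
  obtain ⟨hγ1, hγ2⟩ := hγcol y y' p.1 p.2 h0 hpS.2.2.1
  have hγ' : γ⁻¹ = colGL y y' h0 * (colGL p.1 p.2 hpS.2.2.1)⁻¹ := by rw [hγ]; group
  have hkey1 := key (y, y') hyS p hpS hp1 hp2 hp3 γ hγ1 hγ2
  have hkey2 : ∀ x ∈ Y, (γ⁻¹).1.mulVec x - x ∈ 𝔞 • Y := by
    obtain ⟨h1, h2⟩ := hγcol p.1 p.2 y y' hpS.2.2.1 h0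
    rw [← hγ'] at h1 h2
    exact key p hpS (y, y') hyS hp1.symm hp2.symm hp3.symm γ⁻¹ h1 h2
  have hle : 𝔞 • Y ≤ Y := Submodule.smul_le_right
  refine ⟨p, hpH, γ, ⟨fun x => ⟨fun hx => ?_, fun hx => ?_⟩, hkey1⟩, hγ1, hγ2⟩
  · have h1 := add_mem (hle (hkey2 _ hx)) hx
    rwa [sub_add_cancel, Matrix.mulVec_mulVec, ← Units.val_mul, inv_mul_cancel, Units.val_one,
      Matrix.one_mulVec] at h1
  · have h1 := add_mem (hle (hkey1 _ hx)) hx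
    rwa [sub_add_cancel] at h1

end Place

/-! ### Reduced matrices with bounded determinant: finiteness modulo a congruence subgroup. -/

namespace Place

open BruhatTits

variable {k F : Type*} [Field k] [Field F] [Algebra k F] {P : Place k F}
  {π : F} (hπ : P.ring.IsUniformizer π)
  [Finite k] (hF : IsFunctionFieldOfCurve k F)
  {Y : Submodule P.regularAway (Fin 2 → F)} (hY : P.IsALattice Y)
  {𝔞 : Ideal P.regularAway} (h𝔞 : 𝔞 ≠ ⊥)

omit [Finite k] in
include hπ in
theorem exists_valuation_eq_one {x : Fin 2 → F} (hx : ∀ i, x i ∈ P.ring)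
    (hx1 : ¬∀ i, π⁻¹ * x i ∈ P.ring) : ∃ i, P.ring.valuation (x i) = 1 := by
  by_contra! hne
  refine hx1 fun i => ?_
  have h3 : P.ring.valuation (x i) < 1 :=
    lt_of_le_of_ne ((P.ring.valuation_le_one_iff _).mpr (hx i)) (hne i)
  rw [inv_mul_eq_div, ← mem_closedBall_iff_div hπ.ne_zero, mem_closedBall]
  by_cases h0 : x i = 0
  · rw [h0, map_zero]; exact zero_le
  obtain ⟨e, he⟩ := hπ.exists_zpow _ h0
  rw [he, ← zpow_zero (P.ring.valuation π), hπ.zpow_lt_zpow_iff] at h3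
  rw [he]
  nth_rewrite 2 [← zpow_one (P.ring.valuation π)]
  rw [hπ.zpow_le_zpow_iff]
  omega

include hπ hF hY

/-- The determinants of the reduced matrices are bounded. -/
theorem IsALattice.exists_le_of_reduced : ∃ C : ℤ, ∀ (g : GL (Fin 2) F) (D : ℤ),
    P.ring.valuation g.1.det = P.ring.valuation π ^ D →
    (∀ y ∈ Y, (∀ i, π⁻¹ * (g⁻¹).1.mulVec y i ∈ P.ring) → y = 0) → C ≤ D := by
  have := P.finite_residueField hF
  obtain ⟨C, hC⟩ := hY.exists_pow_le_card_inf hπ hF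
  refine ⟨-C - 2, fun g D hD hred => ?_⟩
  by_contra! hcon
  let c : Fˣ := Units.mk0 π hπ.ne_zero
  have hdet : P.ring.valuation (scalarGL c * g).1.det = P.ring.valuation π ^ (D + 2) := by
    rw [det_scalarGL_mul, map_mul, hD, map_pow, zpow_add₀ hπ.ne_zero', mul_comm]
    rfl
  -- If the exponent `D` were smaller, the multiple of the lattice by `π`, whose determinant has
  -- exponent `D + 2`, would still contain a nonzero vector of `Y`.
  have h1 := hC _ _ 1 hdet (by push_cast; omega)
  have h2 : (Y.toAddSubgroup ⊓ P.latticeOf (scalarGL c * g) : AddSubgroup (Fin 2 → F)) = ⊥ := by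
    refine (AddSubgroup.eq_bot_iff_forall _).mpr fun y hy => hred y hy.1 ?_
    exact mem_latticeOf_scalarGL_mul.mp hy.2
  rw [h2, AddSubgroup.card_bot, pow_one] at h1
  exact absurd (Finite.one_lt_card (α := IsLocalRing.ResidueField P.ring)) (not_lt.mpr h1)

/-- A reduced matrix with bounded determinant has a second short vector. -/
theorem IsALattice.exists_second_vector (D₀ : ℤ) : ∃ m : ℕ, ∀ (g : GL (Fin 2) F) (D : ℤ),
    P.ring.valuation g.1.det = P.ring.valuation π ^ D → D < D₀ →
    (∀ y ∈ Y, (∀ i, π⁻¹ * (g⁻¹).1.mulVec y i ∈ P.ring) → y = 0) →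
    ∀ y ∈ Y, y ≠ 0 → y ∈ P.latticeOf g →
    ∃ y' ∈ Y, (∀ i, π ^ m * (g⁻¹).1.mulVec y' i ∈ P.ring) ∧ crossDet y y' ≠ 0 := by
  have := P.finite_residueField hF
  have hπ0 := hπ.ne_zero
  obtain ⟨C, hC⟩ := hY.exists_pow_le_card_inf hπ hF
  -- For this `m` the multiple by `π ^ (-m)` contains at least `Q ^ (m + 2)` points of `Y`, and at
  -- most `Q ^ (m + 1)` of them are on the line of `y`.
  set m := (D₀ + C + 2).toNat with hm
  refine ⟨m, fun g D hD hlt hred y hy hy0 hyg => ?_⟩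
  have hπm : (π ^ m : F) ≠ 0 := pow_ne_zero _ hπ0
  let c : Fˣ := (Units.mk0 (π ^ m) hπm)⁻¹
  have hc : ((c : Fˣ) : F) = (π ^ m)⁻¹ := by simp [c]
  have hdet : P.ring.valuation (scalarGL c * g).1.det = P.ring.valuation π ^ (D - 2 * m) := by
    rw [det_scalarGL_mul, map_mul, hD, hc, map_pow, map_inv₀, map_pow, zpow_sub₀ hπ.ne_zero',
      div_eq_mul_inv, mul_comm, inv_pow, ← pow_mul, mul_comm m]
    norm_cast
  have h1 := hC _ _ (m + 2) hdet (by push_cast; omega)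
  set L := (Y.toAddSubgroup ⊓ P.latticeOf (scalarGL c * g) : AddSubgroup (Fin 2 → F))
  by_contra! hcon
  have hline : ∀ x ∈ L, ∃ f : F, x = f • y := by
    intro x hx
    refine exists_smul_of_crossDet_eq_zero hy0 (hcon x hx.1 fun i => ?_)
    have h2 := mem_latticeOf_scalarGL_mul.mp hx.2 i
    rwa [hc, inv_inv] at h2
  obtain ⟨i, hi⟩ := exists_valuation_eq_one hπ hyg fun h => hy0 (hred y hy h)
  -- The coefficients of the points on the line are in the ball of `π ^ (-m)` because `y` has a unit
  -- coordinate in the lattice. By reducedness only zero lies in the ball of `π`, so `J` embeds in a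
  -- quotient of order `Q ^ (m + 1)`.
  let J : AddSubgroup F := Y.toAddSubgroup.comap
    ((LinearMap.toSpanSingleton F (Fin 2 → F) y).toAddMonoidHom) ⊓ P.closedBall (π ^ m)⁻¹
  have hJ : ∀ f, f ∈ J ↔ f • y ∈ Y ∧ f ∈ P.closedBall (π ^ m)⁻¹ := fun f => Iff.rfl
  have hJbot : P.closedBall π ⊓ J = ⊥ := by
    refine (AddSubgroup.eq_bot_iff_forall _).mpr fun f hf => ?_
    have h4 : f • y = 0 := hred _ ((hJ f).mp hf.2).1 fun i => by
      rw [Matrix.mulVec_smul, Pi.smul_apply, smul_eq_mul, ← mul_assoc, inv_mul_eq_div]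
      exact mul_mem ((mem_closedBall_iff_div hπ0).mp hf.1) (hyg i)
    exact (smul_eq_zero.mp h4).resolve_right hy0
  have hJcard : Nat.card J ≤ Nat.card (IsLocalRing.ResidueField P.ring) ^ (m + 1) := by
    have h5 : P.closedBall π = P.closedBall ((π ^ m)⁻¹ * π ^ (m + 1)) := by
      congr 1
      rw [pow_succ, ← mul_assoc, inv_mul_cancel₀ hπm, one_mul]
    have h6 : (P.closedBall π).relIndex J = Nat.card J := by
      rw [← AddSubgroup.inf_relIndex_right, hJbot, AddSubgroup.relIndex_bot_left]
    rw [← h6, ← relIndex_closedBall hπ _ (inv_ne_zero hπm), ← h5]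
    refine AddSubgroup.relIndex_le_of_le_right inf_le_right ?_
    rw [h5, relIndex_closedBall hπ _ (inv_ne_zero hπm)]
    exact pow_ne_zero _ Nat.card_pos.ne'
  have hJfin : Finite J := by
    refine Nat.finite_of_card_ne_zero ?_
    have h6 : (P.closedBall π).relIndex J = Nat.card J := by
      rw [← AddSubgroup.inf_relIndex_right, hJbot, AddSubgroup.relIndex_bot_left]
    have h5 : P.closedBall π = P.closedBall ((π ^ m)⁻¹ * π ^ (m + 1)) := by
      congr 1
      rw [pow_succ, ← mul_assoc, inv_mul_cancel₀ hπm, one_mul]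
    rw [← h6]
    intro h7
    have h8 := AddSubgroup.relIndex_eq_zero_of_le_right (inf_le_right : J ≤ _) h7
    rw [h5, relIndex_closedBall hπ _ (inv_ne_zero hπm)] at h8
    exact pow_ne_zero _ Nat.card_pos.ne' h8
  have hLJ : Nat.card L ≤ Nat.card J := by
    choose f hf using hline
    refine Nat.card_le_card_of_injective (fun x : L => ⟨f x.1 x.2, (hJ _).mpr ⟨?_, ?_⟩⟩)
      fun x x' hxx => Subtype.ext ?_
    · rw [← hf]; exact x.2.1
    · have h2 := mem_latticeOf_scalarGL_mul.mp x.2.2 i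
      rw [hc, inv_inv] at h2
      nth_rewrite 1 [hf x.1 x.2] at h2
      rw [Matrix.mulVec_smul, Pi.smul_apply, smul_eq_mul, ← mul_assoc,
        ← ValuationSubring.valuation_le_one_iff, map_mul, hi, mul_one,
        ValuationSubring.valuation_le_one_iff] at h2
      rw [mem_closedBall_iff_div (inv_ne_zero hπm), div_inv_eq_mul, mul_comm]
      exact h2
    · rw [hf x.1 x.2, hf x'.1 x'.2]
      exact congrArg (fun z : J => z.1 • y) hxx
  have h9 := (h1.trans hLJ).trans hJcard
  exact absurd h9 (not_le.mpr (Nat.pow_lt_pow_right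
    (Finite.one_lt_card (α := IsLocalRing.ResidueField P.ring)) (by omega)))

include h𝔞

/-- Reduced matrices with bounded determinants give finitely many vertices modulo a congruence
subgroup. -/
theorem IsALattice.exists_finite_reduced (D₀ : ℤ) :
    ∃ T : Set (Vertex P.integers), T.Finite ∧ ∀ (g : GL (Fin 2) F) (D : ℤ),
    P.ring.valuation g.1.det = P.ring.valuation π ^ D → D < D₀ →
    (∀ y ∈ Y, (∀ i, π⁻¹ * (g⁻¹).1.mulVec y i ∈ P.ring) → y = 0) →
    ∀ y ∈ Y, y ≠ 0 → y ∈ P.latticeOf g →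
    ∃ γ ∈ P.congruenceSubgroup Y 𝔞, P.vertexOf (γ * g) ∈ T := by
  have hπ0 := hπ.ne_zero
  have hπv := hπ.ne_zero'
  obtain ⟨C, hC⟩ := hY.exists_le_of_reduced hπ hF
  obtain ⟨m, hm⟩ := hY.exists_second_vector hπ hF D₀
  obtain ⟨a, ha, ha0, haY⟩ := hY.exists_mul_mem hF
  obtain ⟨H, hH, hH0, hHY⟩ := hY.exists_finite_bases hπ hF h𝔞 (π ^ (C - m))
  have hπm : (π ^ m : F) ≠ 0 := pow_ne_zero _ hπ0
  -- The first entry bounds the coordinates of `y` and `y'` in the lattice of `g`. The second bounds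
  -- the inverse of that coordinate matrix: `π ^ C` is for `det g`, and `a ^ 2` for the inverse of
  -- the determinant of `y, y'`.
  obtain ⟨c, hc1, hc⟩ := P.exists_valuation_ge (n := 2)
    ![(π ^ m)⁻¹, π ^ C * (a ^ 2) * (π ^ m)⁻¹]
  have hc0 := hc 0
  have hc1 := hc 1
  simp only [Matrix.cons_val_zero, Matrix.cons_val_one] at hc0 hc1
  let z : H → GL (Fin 2) F := fun p => colGL p.1.1 p.1.2 (hH0 p.1 p.2)
  have : Finite H := hH
  refine ⟨⋃ p : H, _, Set.finite_iUnion fun p : H => finite_vertexOf hF (z p) c,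
    fun g D hD hlt hred y hy hy0 hyg => ?_⟩
  obtain ⟨y', hy', hyg', h0⟩ := hm g D hD hlt hred y hy hy0 hyg
  have hgy : ∀ i, P.ring.valuation ((g⁻¹).1.mulVec y i) ≤ 1 := fun i =>
    (P.ring.valuation_le_one_iff _).mpr (hyg i)
  have hgy' : ∀ i, P.ring.valuation ((g⁻¹).1.mulVec y' i) ≤ P.ring.valuation (π ^ m)⁻¹ := fun i => by
    rw [← mem_closedBall, mem_closedBall_iff_div (inv_ne_zero hπm), div_inv_eq_mul, mul_comm]
    exact hyg' i
  have hm1 : (1 : P.ring.ValueGroup) ≤ P.ring.valuation (π ^ m)⁻¹ := by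
    rw [← zpow_natCast, ← zpow_neg, map_zpow₀, ← zpow_zero (P.ring.valuation π),
      hπ.zpow_le_zpow_iff]
    omega
  have hcross : crossDet y y' = g.1.det * crossDet ((g⁻¹).1.mulVec y) ((g⁻¹).1.mulVec y') := by
    rw [← crossDet_mulVec, Matrix.mulVec_mulVec, Matrix.mulVec_mulVec, ← Units.val_mul,
      mul_inv_cancel, Units.val_one, Matrix.one_mulVec, Matrix.one_mulVec]
  have hgdet : P.ring.valuation g.1.det ≤ P.ring.valuation π ^ C := by
    rw [hD, hπ.zpow_le_zpow_iff]; exact hC g D hD hred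
  have hδ : P.ring.valuation (crossDet y y') ≤ P.ring.valuation (π ^ (C - m)) := by
    rw [hcross, map_mul, map_zpow₀, sub_eq_add_neg, zpow_add₀ hπv]
    refine mul_le_mul' hgdet ?_
    have h1 : P.ring.valuation (π ^ m)⁻¹ = P.ring.valuation π ^ (-(m : ℤ)) := by
      rw [← zpow_natCast, ← zpow_neg, map_zpow₀]
    rw [← h1, crossDet]
    refine Valuation.map_sub_le _ ?_ ?_
    · rw [map_mul]; exact mul_le_of_le_one_of_le (hgy _) (hgy' _)
    · rw [map_mul]; exact mul_le_of_le_one_of_le (hgy _) (hgy' _)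
  obtain ⟨p, hp, γ, hγ, hγy, hγy'⟩ := hHY y hy y' hy' h0 hδ
  refine ⟨γ, hγ, Set.mem_iUnion.mpr ⟨⟨p, hp⟩, ?_⟩⟩
  -- Modulo the congruence subgroup the basis `h` is one of finitely many `z p`, and `γ g = z p (h⁻¹
  -- g)` with a bounded matrix `h⁻¹ g`.
  set h := colGL y y' h0 with hh
  have hγh : γ * h = z ⟨p, hp⟩ := by
    refine Units.ext ?_
    have e0 := congrFun hγy 0
    have e1 := congrFun hγy 1
    have e2 := congrFun hγy' 0
    have e3 := congrFun hγy' 1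
    simp only [Matrix.mulVec, dotProduct, Fin.sum_univ_two] at e0 e1 e2 e3
    rw [Units.val_mul, hh, coe_colGL]
    change _ = (colGL p.1 p.2 _).1
    rw [coe_colGL]
    ext i j
    rw [Matrix.mul_apply, Fin.sum_univ_two]
    fin_cases i <;> fin_cases j
    · exact e0
    · exact e2
    · exact e1
    · exact e3
  have hinv : ∀ i, (g⁻¹ * h).1 i 0 = (g⁻¹).1.mulVec y i ∧
      (g⁻¹ * h).1 i 1 = (g⁻¹).1.mulVec y' i := fun i => by
    rw [Units.val_mul, hh, coe_colGL, Matrix.mul_apply, Matrix.mul_apply, Fin.sum_univ_two,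
      Fin.sum_univ_two, Matrix.mulVec, Matrix.mulVec, dotProduct, dotProduct, Fin.sum_univ_two,
      Fin.sum_univ_two]
    exact ⟨rfl, rfl⟩
  have hinvle : ∀ i j, P.ring.valuation ((g⁻¹ * h).1 i j) ≤ P.ring.valuation (π ^ m)⁻¹ := by
    intro i j
    fin_cases j
    · exact (hinv i).1 ▸ (hgy i).trans hm1
    · exact (hinv i).2 ▸ hgy' i
  refine ⟨h⁻¹ * g, fun i j => ?_, fun i j => ?_, ?_⟩
  · refine le_trans ?_ hc1
    have h1 : h⁻¹ * g = (g⁻¹ * h)⁻¹ := by group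
    have hdet : (g⁻¹ * h).1.det⁻¹ = g.1.det * (crossDet y y')⁻¹ := by
      have h2 : g.1.det * (g⁻¹ * h).1.det = crossDet y y' := by
        rw [← Matrix.det_mul, ← Units.val_mul, mul_inv_cancel_left, hh, det_colGL]
      have h3 := g.det_ne_zero
      rw [← h2, mul_inv, mul_inv_cancel_left₀ h3]
    have hδa : P.ring.valuation (crossDet y y')⁻¹ ≤ P.ring.valuation (a ^ 2) := by
      rw [map_inv₀]
      refine inv_le_of_inv_le₀ (zero_lt_iff.mpr (by simpa using ha0)) ?_
      have h4 : a ^ 2 * crossDet y y' ∈ P.regularAway := by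
        have : a ^ 2 * crossDet y y' = (a * y 0) * (a * y' 1) - (a * y 1) * (a * y' 0) := by
          rw [crossDet]; ring
        rw [this]
        exact sub_mem (mul_mem (haY y hy 0) (haY y' hy' 1))
          (mul_mem (haY y hy 1) (haY y' hy' 0))
      -- A nonzero element of `A` cannot be small at `P`; this bounds the determinant of `y, y'`
      -- from below.
      have h5 : 1 ≤ P.ring.valuation (a ^ 2 * crossDet y y') := by
        by_contra! hlt1
        exact mul_ne_zero (pow_ne_zero 2 ha0) h0 (P.eq_zero_of_mem_regularAway hF h4 hlt1)
      rw [map_mul] at h5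
      exact (inv_le_iff_one_le_mul₀' (zero_lt_iff.mpr (by simpa using ha0))).mpr h5
    have hentry : ∀ w, (∃ i j, w = (g⁻¹ * h).1 i j ∨ w = -(g⁻¹ * h).1 i j) →
        P.ring.valuation (g.1.det * (crossDet y y')⁻¹ * w) ≤
        P.ring.valuation (π ^ C * a ^ 2 * (π ^ m)⁻¹) := by
      rintro w ⟨i, j, hw⟩
      have hw' : P.ring.valuation w ≤ P.ring.valuation (π ^ m)⁻¹ := by
        rcases hw with rfl | rfl
        · exact hinvle i j
        · rw [Valuation.map_neg]; exact hinvle i j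
      rw [map_mul, map_mul, map_mul _ _ (π ^ m)⁻¹, map_mul _ (π ^ C), map_zpow₀]
      exact mul_le_mul' (mul_le_mul' hgdet hδa) hw'
    rw [h1, coe_inv_fin_two, hdet]
    fin_cases i <;> fin_cases j
    · exact hentry _ ⟨1, 1, Or.inl rfl⟩
    · exact hentry _ ⟨0, 1, Or.inr rfl⟩
    · exact hentry _ ⟨1, 0, Or.inr rfl⟩
    · exact hentry _ ⟨0, 0, Or.inl rfl⟩
  · rw [mul_inv_rev, inv_inv]
    exact (hinvle i j).trans hc0
  · rw [← hγh, mul_assoc, mul_inv_cancel_left]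

end Place

/-! ### Vanishing at the cusps and boundedness of supports. -/

namespace Place

open BruhatTits

variable {k F : Type*} [Field k] [Field F] [Algebra k F] {P : Place k F}
  {π : F} (hπ : P.ring.IsUniformizer π)
  [Finite k] (hF : IsFunctionFieldOfCurve k F)
  {Y : Submodule P.regularAway (Fin 2 → F)} (hY : P.IsALattice Y)
  {𝔞 : Ideal P.regularAway} (h𝔞 : 𝔞 ≠ ⊥)

include hπ hF hY h𝔞

/-- Cuspidal cochains vanish at the vertices given by reduced matrices with large determinants. -/
theorem IsALattice.exists_eq_zero_of_reduced : ∃ D₀ : ℤ, ∀ Γ : Subgroup (GL (Fin 2) F),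
    P.congruenceSubgroup Y 𝔞 ≤ Γ → ∀ φ ∈ P.cuspidalCochains Γ, ∀ (g : GL (Fin 2) F) (D : ℤ),
    P.ring.valuation g.1.det = P.ring.valuation π ^ D → D₀ ≤ D →
    (∀ y ∈ Y, (∀ i, π⁻¹ * (g⁻¹).1.mulVec y i ∈ P.ring) → y = 0) →
    ∀ y ∈ Y, y ≠ 0 → y ∈ P.latticeOf g → ∀ e : P.TEdge, e.fst = P.vertexOf g → φ e = 0 := by
  have := P.finite_residueField hF
  have hπ0 := hπ.ne_zero
  have hπv := hπ.ne_zero'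
  obtain ⟨C, hC⟩ := Place.exists_pow_le_card_inf hF hπ
  obtain ⟨d, hd⟩ := exists_natCast_sub_le hF hπ
  obtain ⟨a, ha, ha0, haY⟩ := hY.exists_mul_mem hF
  obtain ⟨a1, ha1, ha10⟩ := Submodule.exists_mem_ne_zero_of_ne_bot h𝔞
  have ha10' : (a1 : F) ≠ 0 := fun h => ha10 (Subtype.ext h)
  obtain ⟨α, hα⟩ := hπ.exists_zpow a ha0
  obtain ⟨α1, hα1⟩ := hπ.exists_zpow (a1 : F) ha10'
  obtain ⟨t, ht1, ht⟩ : ∃ t : ℕ, 1 ≤ t ∧ (d : ℤ) + 1 ≤ α1 + t :=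
    ⟨1 + (d + 1 - α1).toNat, by omega, by omega⟩
  -- For these `D` the Minkowski bound still gives a nonzero point of `A²` in the dual-type lattice
  -- given by `c * g`. The margin `t` makes the parameter `ε` below smaller than `π ^ (d + 1)`,
  -- after a loss of `α1` from `𝔞`.
  refine ⟨1 + 2 * t - 2 * α + C, fun Γ hΓ φ hφ g D hD hlt hred y hy hy0 hyg e he => ?_⟩
  have hg0 := g.det_ne_zero
  have hπt : (π ^ t : F) ≠ 0 := pow_ne_zero _ hπ0
  -- The scaling is such that the functional `crossDet (a • x)` is at most `π ^ t` on the lattice of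
  -- `g` whenever `x` is in the scaled lattice. For `x` in `A²` it also has values in `A` on `Y`.
  let c : Fˣ := Units.mk0 (a⁻¹ * π ^ t / g.1.det)
    (div_ne_zero (mul_ne_zero (inv_ne_zero ha0) hπt) hg0)
  have hc : (c : F) = a⁻¹ * π ^ t / g.1.det := rfl
  have hdet : P.ring.valuation (scalarGL c * g).1.det =
      P.ring.valuation π ^ (2 * t - 2 * α - D) := by
    have h1 : (scalarGL c * g).1.det = π ^ (2 * t) / a ^ 2 / g.1.det := by
      rw [det_scalarGL_mul, hc]
      field_simp
      ring
    rw [h1, map_div₀, map_div₀, map_pow, map_pow, hα, hD, zpow_sub₀ hπv, zpow_sub₀ hπv,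
      mul_comm 2 α, zpow_mul _ α]
    norm_cast
  have hcard := hC _ _ 1 hdet (by push_cast; omega)
  obtain ⟨x, ⟨hxA, hxg⟩, hx0⟩ : ∃ x ∈ ((AddSubgroup.pi Set.univ
      fun _ : Fin 2 => P.regularAway.toAddSubgroup) ⊓ P.latticeOf (scalarGL c * g) :
      AddSubgroup (Fin 2 → F)), x ≠ 0 := by
    by_contra! h
    rw [(AddSubgroup.eq_bot_iff_forall _).mpr h, AddSubgroup.card_bot, pow_one] at hcard
    exact absurd (Finite.one_lt_card (α := IsLocalRing.ResidueField P.ring)) (not_lt.mpr hcard)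
  have hcrossA : ∀ z ∈ Y, crossDet (a • x) z ∈ P.regularAway := fun z hz => by
    have : crossDet (a • x) z = x 0 * (a * z 1) - x 1 * (a * z 0) := by
      rw [crossDet_smul_left, crossDet]; ring
    rw [this]
    exact sub_mem (mul_mem (hxA 0 trivial) (haY z hz 1)) (mul_mem (hxA 1 trivial) (haY z hz 0))
  have hcrossO : ∀ w : Fin 2 → F, (∀ i, w i ∈ P.ring) →
      P.ring.valuation (crossDet (a • x) (g.1.mulVec w)) ≤ P.ring.valuation π ^ t := by
    intro w hw
    set x' := (g⁻¹).1.mulVec x with hx'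
    have hxx : x = g.1.mulVec x' := by
      rw [hx', Matrix.mulVec_mulVec, ← Units.val_mul, mul_inv_cancel, Units.val_one,
        Matrix.one_mulVec]
    have h2 := mem_latticeOf_scalarGL_mul.mp hxg
    have h3 : crossDet (a • x) (g.1.mulVec w) =
        π ^ t * ((c : F)⁻¹ * x' 0 * w 1 - (c : F)⁻¹ * x' 1 * w 0) := by
      rw [crossDet_smul_left, hxx, crossDet_mulVec, crossDet, hc]
      field_simp
    rw [h3, map_mul, map_pow]
    refine mul_le_of_le_one_right' ((P.ring.valuation_le_one_iff _).mpr ?_)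
    exact sub_mem (mul_mem (h2 0) (hw 1)) (mul_mem (h2 1) (hw 0))
  have hmul : ∀ (M N : GL (Fin 2) F) v, (M * N).1.mulVec v = M.1.mulVec (N.1.mulVec v) :=
    fun M N v => by rw [Units.val_mul, Matrix.mulVec_mulVec]
  set w := (g⁻¹).1.mulVec y with hw
  have hyw : y = g.1.mulVec w := by
    rw [hw, Matrix.mulVec_mulVec, ← Units.val_mul, mul_inv_cancel, Units.val_one,
      Matrix.one_mulVec]
  -- The value of the functional at the short vector `y` is in `A` and smaller than `1`, hence zero:
  -- `a • x` is proportional to `y`.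
  obtain ⟨β, hβ⟩ : ∃ β : F, a • x = β • y := by
    refine exists_smul_of_crossDet_eq_zero hy0 ?_
    rw [crossDet_comm, neg_eq_zero]
    refine P.eq_zero_of_mem_regularAway hF (hcrossA y hy) (lt_of_le_of_lt ?_ hπ.lt_one)
    nth_rewrite 1 [hyw]
    exact (hcrossO w hyg).trans (pow_le_of_le_one zero_le hπ.lt_one.le (by omega))
  have hβ0 : β ≠ 0 := by
    rintro rfl
    rw [zero_smul] at hβ
    exact smul_ne_zero ha0 hx0 hβ
  obtain ⟨B, hB, hBw⟩ := exists_integralGL_mulVec hyg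
    (exists_valuation_eq_one hπ hyg fun h => hy0 (hred y hy h))
  -- Change the basis of the lattice so that its first vector is `y`, which is possible as `y` is
  -- primitive there. Transvections along `y` then become translations.
  set b := g * B with hb
  have hb1 : b.1.mulVec ![1, 0] = y := by
    rw [hb, Units.val_mul, ← Matrix.mulVec_mulVec, hBw, ← hw, ← hyw]
  set z := b.1.mulVec ![0, 1] with hz
  have hbdet : crossDet y z = b.1.det := by
    rw [← hb1, hz, crossDet_mulVec]
    simp [crossDet]
  have hvert : P.vertexOf g = P.vertexOf b := by
    refine vertexOf_eq_vertexOf_of_mem (c := 1) ?_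
    have h0 : scalarGL (1 : Fˣ) = 1 := map_one _
    rwa [h0, one_mul, hb, inv_mul_cancel_left]
  have hβb : P.ring.valuation (β * b.1.det) ≤ P.ring.valuation π ^ t := by
    rw [← hbdet, ← crossDet_smul_left, ← hβ, hz, hb, Units.val_mul, ← Matrix.mulVec_mulVec]
    refine hcrossO _ fun i => ?_
    rw [Matrix.mulVec, dotProduct, Fin.sum_univ_two]
    simpa using hB.1 i 1
  refine eq_zero_of_unipotents hπ hφ hd (b := b) (ε := a1 * (β * b.1.det))
    (mul_ne_zero ha10' (mul_ne_zero hβ0 b.det_ne_zero)) ?_ (fun f hf => ?_) (he.trans hvert)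
  · rw [map_mul, hα1]
    refine (mul_le_mul_right hβb _).trans ?_
    rw [← zpow_natCast, ← zpow_natCast, ← zpow_add₀ hπv, hπ.zpow_le_zpow_iff]
    push_cast
    exact ht
  · obtain ⟨u, hu⟩ := exists_transvection (f * a1 * β) y
    refine ⟨u, hΓ (transvection_mem hu fun y' hy' => ?_), Units.ext ?_⟩
    · have h1 : f * a1 * β * crossDet y y' = a1 * (f * crossDet (a • x) y') := by
        rw [hβ, crossDet_smul_left]; ring
      rw [h1, mul_smul]
      exact Submodule.smul_mem_smul ha1 (Y.smul_mem ⟨_, mul_mem hf (hcrossA y' hy')⟩ hy)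
    · have h10 : crossDet (![1, 0] : Fin 2 → F) ![0, 1] ≠ 0 := by simp [crossDet]
      refine mulVec_eq_iff h10 ?_ ?_
      · have h2 : (ballGL hπ.ne_zero (f * (a1 * (β * b.1.det))) 0).1.mulVec ![1, 0] = ![1, 0] := by
          rw [coe_ballGL]
          ext i
          fin_cases i <;> simp
        rw [hmul u b, hmul b, h2, hb1,
          hu, crossDet_self, mul_zero, zero_smul, add_zero]
      · have h2 : (ballGL hπ.ne_zero (f * (a1 * (β * b.1.det))) 0).1.mulVec ![0, 1] =
            (f * (a1 * (β * b.1.det))) • ![1, 0] + ![0, 1] := by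
          rw [coe_ballGL]
          ext i
          fin_cases i <;> simp
        rw [hmul u b, hmul b, h2,
          Matrix.mulVec_add, Matrix.mulVec_smul, hb1, ← hz, hu, hbdet, add_comm]
        congr 2
        ring

/-- The supports of cuspidal cochains are bounded modulo an arithmetic group. -/
theorem IsALattice.exists_finite_support : ∃ T : Set (Vertex P.integers), T.Finite ∧
    ∀ Γ : Subgroup (GL (Fin 2) F), P.congruenceSubgroup Y 𝔞 ≤ Γ → ∀ φ ∈ P.cuspidalCochains Γ,
    ∀ e, φ e ≠ 0 → ∃ γ ∈ Γ, P.glMap γ • e.fst ∈ T := by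
  obtain ⟨D₀, hD₀⟩ := hY.exists_eq_zero_of_reduced hπ hF h𝔞
  obtain ⟨T, hT, h⟩ := hY.exists_finite_reduced hπ hF h𝔞 D₀
  refine ⟨T, hT, fun Γ hΓ φ hφ e he => ?_⟩
  obtain ⟨g, hg, ⟨y, hy, hy0, hyg⟩, hred⟩ := hY.exists_reduced hπ hF e.fst
  obtain ⟨D, hD⟩ := hπ.exists_zpow g.1.det g.det_ne_zero
  rcases lt_or_ge D D₀ with hlt | hge
  · obtain ⟨γ, hγ, hγT⟩ := h g D hD hlt hred y hy hy0 hyg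
    exact ⟨γ, hΓ hγ, by rwa [hg, glMap_smul_vertexOf]⟩
  · exact (he (hD₀ Γ hΓ φ hφ g D hD hge hred y hy hy0 hyg e hg)).elim

end Place

/-! ## Invariant functions on the edges of a tree and functions on the quotient graph -/

section GroupAction

variable {G E V : Type*} [Group G] [MulAction G E] [MulAction G V]

theorem MulAction.card_stabilizer_smul (g : G) (e : E) :
    Nat.card (stabilizer G (g • e)) = Nat.card (stabilizer G e) := by
  refine Nat.card_congr (stabilizerEquivStabilizerOfOrbitRel ?_).toEquiv
  exact ⟨g, rfl⟩

variable {o : E → V} (ho : ∀ (g : G) e, o (g • e) = g • o e)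

include ho

/-- The edges equivalent to `e₀` with the same origin form one orbit of the stabilizer of this
origin, and that stabilizer contains the one of `e₀`. -/
theorem MulAction.ncard_mul_card_stabilizer (e₀ : E) :
    {e : E | o e = o e₀ ∧ e ∈ orbit G e₀}.ncard * Nat.card (stabilizer G e₀) =
      Nat.card (stabilizer G (o e₀)) := by
  have h1 : {e : E | o e = o e₀ ∧ e ∈ orbit G e₀} = orbit (stabilizer G (o e₀)) e₀ := by
    ext e
    constructor
    · rintro ⟨he, g, rfl⟩
      refine ⟨⟨g, ?_⟩, rfl⟩
      rw [mem_stabilizer_iff, ← ho]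
      exact he
    · rintro ⟨⟨g, hg⟩, rfl⟩
      refine ⟨?_, g, rfl⟩
      rw [mem_stabilizer_iff, ← ho] at hg
      exact hg
  have h2 : Nat.card (stabilizer (stabilizer G (o e₀)) e₀) = Nat.card (stabilizer G e₀) := by
    refine Nat.card_congr ⟨fun g => ⟨g.1.1, g.2⟩, fun g => ⟨⟨g.1, ?_⟩, g.2⟩, fun _ => rfl,
      fun _ => rfl⟩
    rw [mem_stabilizer_iff, ← ho, mem_stabilizer_iff.mp g.2]
  rw [h1, ← index_stabilizer, ← h2, mul_comm, Subgroup.card_mul_index]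

/-- Summation over a star, weighted with the orders of the stabilizers. -/
theorem MulAction.finsum_card_stabilizer_mul {v : V} (hv : {e : E | o e = v}.Finite)
    (ψ : orbitRel.Quotient G E → ℤ) (o' : orbitRel.Quotient G E → orbitRel.Quotient G V)
    (ho' : ∀ e : E, o' (Quotient.mk _ e) = Quotient.mk _ (o e)) :
    ∑ᶠ (e : E) (_ : o e = v), (Nat.card (stabilizer G e) : ℤ) * ψ (Quotient.mk _ e) =
      Nat.card (stabilizer G v) *
        ∑ᶠ (q : orbitRel.Quotient G E) (_ : o' q = Quotient.mk _ v), ψ q := by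
  classical
  let p : E → orbitRel.Quotient G E := fun e => Quotient.mk _ e
  have himage : {q | o' q = Quotient.mk _ v} = p '' {e : E | o e = v} := by
    ext q
    constructor
    · intro hq
      induction q using Quotient.inductionOn with
      | _ e =>
        obtain ⟨g, hg⟩ := Quotient.exact ((ho' e).symm.trans hq)
        change g • v = o e at hg
        refine ⟨g⁻¹ • e, ?_, Quotient.sound ⟨g⁻¹, rfl⟩⟩
        change o (g⁻¹ • e) = v
        rw [ho, ← hg, inv_smul_smul]
    · rintro ⟨e, rfl, rfl⟩
      exact ho' e
  have hfin : {q | o' q = Quotient.mk _ v}.Finite := himage ▸ hv.image p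
  have e1 := finsum_mem_eq_finite_toFinset_sum
    (fun e : E => (Nat.card (stabilizer G e) : ℤ) * ψ (Quotient.mk _ e)) hv
  have e2 := finsum_mem_eq_finite_toFinset_sum ψ hfin
  simp only [Set.mem_ofPred_eq] at e1 e2
  -- Group the star by orbits: each orbit contributes `|G_v| / |G_e|` equal terms with the factor
  -- `|G_e|`.
  rw [e1, e2, Finset.mul_sum, ← Finset.sum_fiberwise_of_maps_to (g := p) (t := hfin.toFinset)]
  · refine Finset.sum_congr rfl fun q hq => ?_
    rw [Set.Finite.mem_toFinset, himage] at hq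
    obtain ⟨e₀, rfl, rfl⟩ := hq
    have h1 : ∀ e ∈ hv.toFinset.filter (fun e => p e = p e₀), (Nat.card (stabilizer G e) : ℤ) *
        ψ (Quotient.mk _ e) = Nat.card (stabilizer G e₀) * ψ (p e₀) := by
      intro e he
      obtain ⟨-, he⟩ := Finset.mem_filter.mp he
      change _ * ψ (p e) = _
      rw [he]
      obtain ⟨g, rfl⟩ := Quotient.exact he
      rw [card_stabilizer_smul]
    rw [Finset.sum_congr rfl h1, Finset.sum_const, nsmul_eq_mul, ← mul_assoc]
    congr 1
    rw [← ncard_mul_card_stabilizer ho e₀, Nat.cast_mul, ← Set.ncard_coe_finset]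
    congr 3
    ext e
    rw [Finset.mem_coe, Finset.mem_filter, Set.Finite.mem_toFinset]
    exact and_congr_right fun _ => ⟨fun h => Quotient.exact h, fun h => Quotient.sound h⟩
  · intro e he
    rw [Set.Finite.mem_toFinset] at he ⊢
    exact (ho' e).trans (congrArg _ he)

end GroupAction

namespace BruhatTits

variable {K : Type*} [Field K] {O : ValuationSubring K} {G : Subgroup (GL (Fin 2) K)}

theorem stabilizer_symm (e : Edge O) :
    MulAction.stabilizer G e.symm = MulAction.stabilizer G e := by
  ext g
  rw [MulAction.mem_stabilizer_iff, MulAction.mem_stabilizer_iff]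
  change (g.1 • e).symm = e.symm ↔ _
  exact SimpleGraph.Dart.symm_involutive.injective.eq_iff

/-- Cuspidal cochains correspond to circulations of the quotient graph, up to the orders of the
stabilizers. -/
theorem mem_HShriek_iff (hstar : ∀ v : Vertex O, {e : Edge O | e.fst = v}.Finite)
    (hne : ∀ v : Vertex O, ∃ e : Edge O, e.fst = v)
    (hfin : ∀ e : Edge O, Finite (MulAction.stabilizer G e)) {c : ℤ} (hc : c ≠ 0)
    {φ : Edge O → ℤ} {ψ : QEdge O G → ℤ}
    (h : ∀ e, c * φ e = Nat.card (MulAction.stabilizer G e) * ψ (toQEdge O G e)) :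
    φ ∈ HShriek O G ℤ ↔ (quotientGraph O G).IsCirculation ψ := by
  have hs : ∀ e : Edge O, (Nat.card (MulAction.stabilizer G e) : ℤ) ≠ 0 := fun e =>
    Nat.cast_ne_zero.mpr Nat.card_pos.ne'
  have hsupp : toQEdge O G '' Function.support φ = Function.support ψ := by
    have h1 : ∀ e, φ e ≠ 0 ↔ ψ (toQEdge O G e) ≠ 0 := fun e => by
      rw [← mul_ne_zero_iff_left hc, h, mul_ne_zero_iff_left (hs e)]
    ext q
    constructor
    · rintro ⟨e, he, rfl⟩
      exact (h1 e).mp he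
    · induction q using Quotient.inductionOn with
      | _ e => exact fun hq => ⟨e, (h1 e).mpr hq, rfl⟩
  have halt : ∀ e, φ e + φ e.symm = 0 ↔
      ψ (toQEdge O G e) + ψ ((quotientGraph O G).bar (toQEdge O G e)) = 0 := fun e => by
    have h1 := h e.symm
    rw [stabilizer_symm] at h1
    rw [← mul_right_inj' hc, mul_add, h, h1, ← mul_add, mul_zero, mul_eq_zero,
      or_iff_right (hs e)]
    rfl
  -- Multiplied by `c`, the sum over the star of `v` is `|G_v|` times the divergence of `ψ`.
  have hdiv : ∀ v, ∑ᶠ (e : Edge O) (_ : e.fst = v), φ e = 0 ↔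
      (quotientGraph O G).divergence ψ (Quotient.mk _ v) = 0 := fun v => by
    have h1 := MulAction.finsum_card_stabilizer_mul (G := G) (E := Edge O) (V := Vertex O)
      (o := fun e => e.fst) (fun _ _ => rfl) (hstar v) ψ (quotientGraph O G).o (fun _ => rfl)
    have h2 : c * ∑ᶠ (e : Edge O) (_ : e.fst = v), φ e = ∑ᶠ (e : Edge O) (_ : e.fst = v),
        (Nat.card (MulAction.stabilizer G e) : ℤ) * ψ (toQEdge O G e) := by
      have h3 := mul_finsum_mem (s := {e : Edge O | e.fst = v}) φ c
      simp only [Set.mem_ofPred_eq, h] at h3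
      exact h3
    -- `Nat.card` vanishes on infinite groups, so finiteness of the vertex stabilizer is needed
    -- here; it follows from that of an edge stabilizer, whose index in it is finite.
    have h4 : (Nat.card (MulAction.stabilizer G v) : ℤ) ≠ 0 := by
      obtain ⟨e, rfl⟩ := hne v
      have h5 := MulAction.ncard_mul_card_stabilizer (G := G) (E := Edge O) (V := Vertex O)
        (o := fun e => e.fst) (fun _ _ => rfl) e
      rw [Nat.cast_ne_zero, ← h5]
      refine mul_ne_zero ?_ Nat.card_pos.ne'
      rw [Ne, Set.ncard_eq_zero ((hstar e.fst).subset fun e' he' => he'.1)]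
      exact Set.Nonempty.ne_empty ⟨e, rfl, MulAction.mem_orbit_self e⟩
    rw [← mul_right_inj' hc, mul_zero, h2]
    change ∑ᶠ (e : Edge O) (_ : e.fst = v), (Nat.card (MulAction.stabilizer G e) : ℤ) *
      ψ (Quotient.mk _ e) = 0 ↔ _
    rw [h1, mul_eq_zero, or_iff_right h4]
    rfl
  have hinv : ∀ g ∈ G, ∀ e, φ (g • e) = φ e := fun g hg e => by
    have h1 := MulAction.card_stabilizer_smul (⟨g, hg⟩ : G) e
    change Nat.card (MulAction.stabilizer G (g • e)) = _ at h1
    have h2 : toQEdge O G (g • e) = toQEdge O G e := Quotient.sound ⟨⟨g, hg⟩, rfl⟩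
    rw [← mul_right_inj' hc, h, h, h1, h2]
  constructor
  · rintro ⟨⟨h1, h2⟩, -, h3⟩
    refine ⟨hsupp ▸ h3, fun q => ?_, fun q => ?_⟩
    · induction q using Quotient.inductionOn with
      | _ e => exact (halt e).mp (h1 e)
    · induction q using Quotient.inductionOn with
      | _ v => exact (hdiv v).mp (h2 v).2
  · rintro ⟨h1, h2, h3⟩
    exact ⟨⟨fun e => (halt e).mpr (h2 _), fun v => ⟨(hstar v).subset fun e he => he.1,
      (hdiv v).mpr (h3 _)⟩⟩, hinv, hsupp ▸ h1⟩

end BruhatTits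

/-! ### Orders of stabilizers, divisibility of cochains, and finite generation. -/

namespace Place

open BruhatTits

variable {k F : Type*} [Field k] [Finite k] [Field F] [Algebra k F]
  (hF : IsFunctionFieldOfCurve k F) {P : Place k F}
  {Y : Submodule P.regularAway (Fin 2 → F)} (hY : P.IsALattice Y)
  {Γ : Subgroup (GL (Fin 2) F)} (hΓ : Γ ≤ P.stabLattice Y)

include hF hY hΓ

theorem finite_edgeStabilizer (e : P.TEdge) : Finite (P.edgeStabilizer Γ e) := by
  obtain ⟨π, hπ⟩ := P.exists_uniformizer hF
  obtain ⟨g, rfl⟩ := exists_eq_edgeOf hπ e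
  have := finite_edgeSubgroup hF hY hΓ g
  exact Finite.of_equiv _ (edgeStabilizerEquiv hπ (fun γ hγ => hY.valuation_det hF (hΓ hγ)) g)

variable {𝔞 : Ideal P.regularAway} (h𝔞 : 𝔞 ≠ ⊥) (hΓ' : P.congruenceSubgroup Y 𝔞 ≤ Γ)

include h𝔞 hΓ'

theorem card_center_dvd_card_edgeStabilizer (e : P.TEdge) :
    Nat.card (Subgroup.center Γ) ∣ Nat.card (P.edgeStabilizer Γ e) := by
  obtain ⟨π, hπ⟩ := P.exists_uniformizer hF
  obtain ⟨g, rfl⟩ := exists_eq_edgeOf hπ e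
  obtain ⟨U, m, -, -, -, h⟩ := exists_card_edgeSubgroup hF hY hΓ g
  rw [← Nat.card_congr (edgeStabilizerEquiv hπ (fun γ hγ => hY.valuation_det hF (hΓ hγ)) g), h,
    card_center hF hY h𝔞 hΓ']
  exact Dvd.intro_left m rfl |>.mul_right _

theorem card_center_ne_zero : Nat.card (Subgroup.center Γ) ≠ 0 := by
  obtain ⟨π, hπ⟩ := P.exists_uniformizer hF
  have := finite_edgeStabilizer hF hY hΓ (edgeOf hπ 1)
  exact ne_zero_of_dvd_ne_zero (Nat.card_pos.ne')
    (card_center_dvd_card_edgeStabilizer hF hY hΓ h𝔞 hΓ' (edgeOf hπ 1))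

/-- In the factorization `m z(Γ) |U|` of the order, `m` divides `Q - 1` and `|U|` divides `φ e`. -/
theorem card_edgeStabilizer_dvd {φ : P.TEdge → ℤ} (hφ : φ ∈ P.cuspidalCochains Γ) (e : P.TEdge) :
    (Nat.card (P.edgeStabilizer Γ e) : ℤ) ∣
      ((Nat.card k ^ P.degree - 1 : ℕ) * Nat.card (Subgroup.center Γ)) * φ e := by
  obtain ⟨π, hπ⟩ := P.exists_uniformizer hF
  have := P.finite_residueField hF
  have hdet : ∀ γ ∈ Γ, P.ring.valuation γ.1.det = 1 := fun γ hγ => hY.valuation_det hF (hΓ hγ)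
  obtain ⟨g, rfl⟩ := exists_eq_edgeOf hπ e
  obtain ⟨U, m, hU, hU1, hm, h⟩ := exists_card_edgeSubgroup hF hY hΓ g
  have := finite_edgeSubgroup hF hY hΓ g
  have : Finite U := Finite.of_injective _ (Subgroup.inclusion_injective hU)
  have hmem : ∀ u ∈ U, u ∈ Γ := fun u hu => (mem_edgeSubgroup.mp (hU hu)).1
  have h1 : (Nat.card U : ℤ) ∣ φ (edgeOf hπ g) :=
    card_dvd_apply_edgeOf hπ hφ.1 U hU1 (fun u hu e => apply_glMap_smul hφ (hmem u hu) e) g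
      fun u hu => (glMap_smul_edgeOf_eq_iff hπ (hdet u (hmem u hu))).mpr
        (mem_edgeSubgroup.mp (hU hu)).2
  rw [← Nat.card_congr (edgeStabilizerEquiv hπ hdet g), h, card_center hF hY h𝔞 hΓ',
    ← P.card_residueField hF, Nat.cast_mul, Nat.cast_mul]
  exact mul_dvd_mul (mul_dvd_mul_right (Int.natCast_dvd_natCast.mpr hm) _) h1

omit hΓ in
-- Reduction theory gives a single finite set `T` that serves all cochains, so restriction to the
-- finitely many edges with origin in `T` is injective.
theorem fg_cuspidalCochains : AddGroup.FG (P.cuspidalCochains Γ) := by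
  obtain ⟨π, hπ⟩ := P.exists_uniformizer hF
  obtain ⟨T, hT, h⟩ := hY.exists_finite_support hπ hF h𝔞
  have hE : {e : P.TEdge | e.fst ∈ T}.Finite := by
    have : {e : P.TEdge | e.fst ∈ T} = ⋃ v ∈ T, {e : P.TEdge | e.fst = v} := by ext; simp
    rw [this]
    exact hT.biUnion fun v _ => finite_star hπ hF v
  have : Finite {e : P.TEdge | e.fst ∈ T} := hE
  let f : P.cuspidalCochains Γ →+ ({e : P.TEdge | e.fst ∈ T} → ℤ) :=
    AddMonoidHom.mk' (fun φ e => φ.1 e) fun _ _ => rfl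
  have hf : Function.Injective f := by
    refine (injective_iff_map_eq_zero f).mpr fun φ hφ => Subtype.ext (funext fun e => ?_)
    by_contra he
    obtain ⟨γ, hγ, hγT⟩ := h Γ hΓ' φ.1 φ.2 e he
    refine he ?_
    rw [← apply_glMap_smul φ.2 hγ]
    exact congrFun hφ ⟨P.glMap γ • e, hγT⟩
  have : IsNoetherian ℤ (P.cuspidalCochains Γ) := isNoetherian_of_injective f.toIntLinearMap hf
  exact Module.Finite.iff_addGroup_fg.mp inferInstance

end Place

open Place in
theorem proposition10p4 {k F : Type*} [Field k] [Finite k] [Field F] [Algebra k F]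
    (hF : IsFunctionFieldOfCurve k F) (P : Place k F)
    (Γ : Subgroup (GL (Fin 2) F)) (hΓ : P.IsArithmetic Γ) :
    Finite (Subgroup.center Γ) ∧
    (∀ e : P.TEdge, Finite (P.edgeStabilizer Γ e)) ∧
    ∃ j : (P.quotientGraph Γ).H1 →+ P.cuspidalCochains Γ,
      (∀ (φ : (P.quotientGraph Γ).H1) (e : P.TEdge),
        ((j φ).1 e : ℚ) =
          Nat.card (P.edgeStabilizer Γ e) * φ.1 (P.toQuotient Γ e) /
            Nat.card (Subgroup.center Γ)) ∧
      Function.Injective j ∧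
      Finite (P.cuspidalCochains Γ ⧸ j.range) ∧
      AddMonoid.exponent (P.cuspidalCochains Γ ⧸ j.range) ∣ Nat.card k ^ P.degree - 1 := by
  obtain ⟨Y, 𝔞, hY, h𝔞, hΓ, hΓ'⟩ := hΓ
  obtain ⟨π, hπ⟩ := P.exists_uniformizer hF
  have := P.finite_residueField hF
  have hz := card_center_ne_zero hF hY hΓ h𝔞 hΓ'
  have hfin := finite_edgeStabilizer hF hY hΓ
  set z := Nat.card (Subgroup.center Γ) with hzdef
  have hz0 : (z : ℤ) ≠ 0 := Nat.cast_ne_zero.mpr hz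
  have hs : ∀ e : P.TEdge, (Nat.card (P.edgeStabilizer Γ e) : ℤ) ≠ 0 := fun e =>
    Nat.cast_ne_zero.mpr (Nat.card_pos (α := P.edgeStabilizer Γ e)).ne'
  have hcirc := fun c (hc : c ≠ 0) φ ψ => BruhatTits.mem_HShriek_iff (O := P.integers)
    (G := P.localGroup Γ) (finite_star hπ hF)
    (fun v => (exists_eq_vertexOf hπ v).imp' (edgeOf hπ) fun _ hg => hg.symm) hfin (c := c) hc
    (φ := φ) (ψ := ψ)
  have hdvd : ∀ e, (z : ℤ) ∣ Nat.card (P.edgeStabilizer Γ e) := fun e =>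
    Int.natCast_dvd_natCast.mpr (card_center_dvd_card_edgeStabilizer hF hY hΓ h𝔞 hΓ' e)
  -- The weight `w e` is `|Γ_e| / z(Γ)`; working with it keeps the definition of `j` inside the
  -- integers.
  choose w hw using hdvd
  have hwψ : ∀ (ψ : (P.quotientGraph Γ).E → ℤ) (e : P.TEdge), z * (w e * ψ (P.toQuotient Γ e)) =
      Nat.card (P.edgeStabilizer Γ e) * ψ (P.toQuotient Γ e) := fun ψ e => by rw [hw, mul_assoc]
  let j : (P.quotientGraph Γ).H1 →+ P.cuspidalCochains Γ := AddMonoidHom.mk'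
    (fun ψ => ⟨fun e => w e * ψ.1 (P.toQuotient Γ e),
      (hcirc z hz0 _ _ (hwψ ψ.1)).mpr (OrientedGraph.mem_H1_iff.mp ψ.2)⟩)
    fun ψ ψ' => Subtype.ext (funext fun e => mul_add _ _ _)
  have hj : ∀ ψ e, z * (j ψ).1 e = Nat.card (P.edgeStabilizer Γ e) * ψ.1 (P.toQuotient Γ e) :=
    fun ψ e => hwψ ψ.1 e
  have hQ : Nat.card k ^ P.degree - 1 ≠ 0 := by
    rw [← P.card_residueField hF]
    exact (Nat.sub_pos_of_lt (Finite.one_lt_card (α := IsLocalRing.ResidueField P.ring))).ne'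
  set N := Nat.card k ^ P.degree - 1 with hN
  have hN0 : (N : ℤ) ≠ 0 := Nat.cast_ne_zero.mpr hQ
  have hexp : ∀ x : P.cuspidalCochains Γ ⧸ j.range, N • x = 0 := by
    intro x
    induction x using QuotientAddGroup.induction_on with
    | H φ =>
      have h1 := card_edgeStabilizer_dvd hF hY hΓ h𝔞 hΓ' φ.2
      choose a ha using h1
      -- The quotient `(Q - 1) z(Γ) φ(e) / |Γ_e|` is read off at one representative of each orbit.
      -- Both `φ` and the orders of the stabilizers are constant on orbits, so the relation holds at
      -- every edge.
      let ψ : (P.quotientGraph Γ).E → ℤ := fun q => a (Quotient.out q)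
      have hψ : ∀ e, (N * z : ℤ) * φ.1 e =
          Nat.card (P.edgeStabilizer Γ e) * ψ (P.toQuotient Γ e) := fun e => by
        obtain ⟨γ, hγ⟩ := Quotient.exact (Quotient.out_eq (P.toQuotient Γ e))
        have h2 : γ • e = Quotient.out (P.toQuotient Γ e) := hγ
        have h3 := MulAction.card_stabilizer_smul γ e
        change _ = _ * a (Quotient.out (P.toQuotient Γ e))
        rw [← h3, ← h2, ← ha]
        congr 1
        exact (φ.2.2.1 _ γ.2 e).symm
      have hψH : ψ ∈ (P.quotientGraph Γ).H1 := OrientedGraph.mem_H1_iff.mpr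
        ((hcirc (N * z) (mul_ne_zero hN0 hz0) _ _ hψ).mp φ.2)
      rw [← QuotientAddGroup.mk_nsmul, QuotientAddGroup.eq_zero_iff]
      refine ⟨⟨ψ, hψH⟩, Subtype.ext (funext fun e => ?_)⟩
      refine mul_left_cancel₀ hz0 ?_
      rw [hj, ← hψ]
      change _ = (z : ℤ) * (N • φ.1 e)
      rw [nsmul_eq_mul]
      ring
  refine ⟨Nat.finite_of_card_ne_zero hz, hfin, j, fun ψ e => ?_, ?_, ?_,
    AddMonoid.exponent_dvd_of_forall_nsmul_eq_zero hexp⟩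
  · rw [eq_div_iff (Nat.cast_ne_zero.mpr hz), mul_comm]
    exact_mod_cast hj ψ e
  · refine (injective_iff_map_eq_zero j).mpr fun ψ hψ => Subtype.ext (funext fun q => ?_)
    induction q using Quotient.inductionOn with
    | _ e =>
      have h1 := hj ψ e
      rw [hψ] at h1
      change (z : ℤ) * 0 = _ at h1
      rw [mul_zero] at h1
      exact (mul_eq_zero.mp h1.symm).resolve_left (hs e)
  -- A finitely generated abelian group killed by the nonzero integer `N` is finite.
  · have := fg_cuspidalCochains hF hY h𝔞 hΓ'
    have : AddGroup.FG (P.cuspidalCochains Γ ⧸ j.range) := QuotientAddGroup.fg j.range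
    exact AddCommGroup.finite_of_fg_isAddTorsion _
      (ExponentExists.isAddTorsion ⟨N, Nat.pos_of_ne_zero hQ, hexp⟩)
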